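/- Let $n\in\mathbb N$, $r\in(0,+\infty]$, and let $W_n$ be the set of words in the letters $1,\dots,n$; write $|\alpha|$ for the length of $\alpha\in W_n$ and $\zeta_\alpha=\zeta_{\alpha_1}\cdots\zeta_{\alpha_d}$. All algebras are complex, associative and unital. A Fréchet algebra is a complete metrizable locally convex algebra with jointly continuous multiplication. **Quantum algebras.** For $q\in\mathbb C^\times$ and $k\in\mathbb Z_{\ge0}^n$ put $|k|=k_1+\dots+k_n$, let $w_q(k)=1$ if $|q|\ge1$ and $w_q(k)=|q|^{\sum_{i<j}k_ik_j}$ if $|q|<1$, and let $[m]_t!=\prod_{s=1}^m(1+t+\dots+t^{s-1})$. Then $\mathcal O_q(\mathbb D^n_r)$ and $\mathcal O_q(\mathbb B^n_r)$ are the algebras of power series $\sum_k c_kx^k$, $x^k=x_1^{k_1}\cdots x_n^{k_n}$, with the multiplication determined by $x_ix_j=qx_jx_i$ $(i<j)$, for which $$\sum_k|c_k|\,w_q(k)\,\rho^{|k|}<\infty,\qquad\text{respectively}\qquad \sum_k|c_k|\Bigl(\tfrac{[k_1]_{t}!\cdots[k_n]_{t}!}{[|k|]_{t}!}\Bigr)^{1/2}\rho^{|k|}<\infty\quad(t=|q|^{-2}),$$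 for all $\rho\in(0,r)$, topologized by these norms. **Free algebras.** $\mathcal F(\mathbb D^n_r)$ and $\mathcal F(\mathbb B^n_r)$ are the algebras of free power series $\sum_{\alpha\in W_n}c_\alpha\zeta_\alpha$ for which $$\sum_\alpha|c_\alpha|\rho^{|\alpha|}\tau^{b(\alpha)}<\infty\ \ (\rho\in(0,r),\ \tau\ge1),\qquad\text{respectively}\qquad \sum_{k\in\mathbb Z_{\ge0}^n}\Bigl(\sum_{\alpha\in p^{-1}(k)}|c_\alpha|^2\Bigr)^{1/2}\rho^{|k|}<\infty\ \ (\rho\in(0,r)),$$ topologized by these norms, where $b(\alpha)$ is the number of maximal constant blocks of $\alpha$ (so $b=0$ for the empty word) and $p(\alpha)\in\mathbb Z_{\ge0}^n$ records how often each letter occurs in $\alpha$. **Deformation algebras.** For $\mathcal F=\mathcal F(\mathbb D^n_r)$ or $\mathcal F(\mathbb B^n_r)$ let $\mathcal O(\mathbb C^\times,\mathcal F)$ be the algebra of holomorphic $\mathcal F$-valued functions on $\mathbb C^\times$ with the topology of uniform convergence on compact sets, and let $\mathcal O_{\mathrm{def}}(\mathbb D^n_r)$, respectively $\mathcal O_{\mathrm{def}}(\mathbb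 B^n_r)$, be its quotient by the closed two-sided ideal generated by the elements $\zeta_i\zeta_j-z\,\zeta_j\zeta_i$ $(i<j)$, where $z$ is the coordinate on $\mathbb C^\times$. **Bundles.** Let $X$ be a locally compact Hausdorff space. A *Fréchet algebra bundle* over $X$ is a set $E$ with a surjection $p:E\to X$, an algebra structure on each fiber $E_x=p^{-1}(x)$, a topology on $E$, and a directed family $\{\|\cdot\|_\lambda\}$ of functions $E\to[0,\infty)$ that are seminorms on each fiber (directed: any two of them are bounded by a constant times a third one; the family is considered up to mutual domination up to constants) such that: $p$ is continuous and open; the zero section $X\to E$, the addition and multiplication $E\times_XE\to E$ and the scalar multiplication $\mathbb C\times E\to E$ are continuous; for each $x\in X$ the sets $\{u\in E:p(u)\in U,\ \|u\|_\lambda<\varepsilon\}$, with $\varepsilon>0$ and $U$ an open neighborhood of $x$, form a base of open neighborhoods of $0\in E_x$; and each $E_x$, with the topology induced from $E$, is a Fréchet algebra. For a topological algebra $R$ with a continuous homomorphism from $\mathcal O(\mathbb C^\times)$ to its center, let $R_q=R/\overline{M_qR}$, where $M_q=\{f\in\mathcal O(\mathbb C^\times):f(q)=0\}$, and let $a_q$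 be the image of $a\in R$ in $R_q$. Let $E(R)=\bigsqcup_{q\in\mathbb C^\times}R_q$, with the fiberwise quotient seminorms of all continuous seminorms $s$ on $R$, and with the topology generated by the sets $\{u\in E(R):p(u)\in V,\ \|u-a_{p(u)}\|_s<\varepsilon\}$, where $a\in R$, $V\subseteq\mathbb C^\times$ is open, $s$ is a continuous seminorm on $R$ and $\varepsilon>0$. **Theorem.** (i) $\mathcal O_{\mathrm{def}}(\mathbb D^n_r)$ is a Fréchet algebra, the canonical map $\mathcal O(\mathbb C^\times)\to\mathcal O_{\mathrm{def}}(\mathbb D^n_r)$ is a continuous homomorphism to the center, and $D=E(\mathcal O_{\mathrm{def}}(\mathbb D^n_r))$ is a Fréchet algebra bundle over $\mathbb C^\times$ such that for each $q\in\mathbb C^\times$ the fiber $D_q$ is topologically isomorphic, as an algebra, to $\mathcal O_q(\mathbb D^n_r)$. (ii) $\mathcal O_{\mathrm{def}}(\mathbb B^n_r)$ is a Fréchet algebra, the canonical map $\mathcal O(\mathbb C^\times)\to\mathcal O_{\mathrm{def}}(\mathbb B^n_r)$ is a continuous homomorphism to the center, and $B=E(\mathcal O_{\mathrm{def}}(\mathbb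 B^n_r))$ is a Fréchet algebra bundle over $\mathbb C^\times$ such that for each $q\in\mathbb C^\times$ the fiber $B_q$ is topologically isomorphic, as an algebra, to $\mathcal O_q(\mathbb B^n_r)$. -/

import Mathlib

open scoped ENNReal

/-- Free formal power series `∑ c_α ζ_α` in `n` non-commuting variables, indexed by words. -/
def FreeSeries (n : ℕ) : Type := List (Fin n) → ℂ

namespace FreeSeries
variable {n : ℕ}

noncomputable instance : AddCommGroup (FreeSeries n) :=
  inferInstanceAs (AddCommGroup (List (Fin n) → ℂ))

noncomputable instance : Module ℂ (FreeSeries n) :=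
  inferInstanceAs (Module ℂ (List (Fin n) → ℂ))

/-- The coefficient of the word `w`. -/
def coeff (w : List (Fin n)) (a : FreeSeries n) : ℂ := a w

/-- The word `ζ_w` as a series. -/
def word (w : List (Fin n)) : FreeSeries n := fun v => if v = w then 1 else 0

/-- Concatenation product: `(ab)_w` is the sum of `a_u b_v` over all splittings `w = uv`. -/
noncomputable instance : Mul (FreeSeries n) :=
  ⟨fun a b w => ∑ i ∈ Finset.range (w.length + 1), a (w.take i) * b (w.drop i)⟩

noncomputable instance : One (FreeSeries n) := ⟨word []⟩

/-- Left shift of a series. -/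
def shift (x : Fin n) (a : FreeSeries n) : FreeSeries n := fun w => a (x :: w)

theorem ext' {a b : FreeSeries n} (h : ∀ w, a w = b w) : a = b := funext h

theorem add_apply' (a b : FreeSeries n) (w) : (a + b) w = a w + b w := rfl
theorem smul_apply' (c : ℂ) (a : FreeSeries n) (w) : (c • a) w = c * a w := rfl
theorem mul_apply' (a b : FreeSeries n) (w) :
    (a * b) w = ∑ i ∈ Finset.range (w.length + 1), a (w.take i) * b (w.drop i) := rfl

theorem mul_nil (a b : FreeSeries n) : (a * b) [] = a [] * b [] := by
  simp [mul_apply']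

theorem mul_cons (a b : FreeSeries n) (x w) :
    (a * b) (x :: w) = a [] * b (x :: w) + (shift x a * b) w := by
  rw [mul_apply', mul_apply', List.length_cons, Finset.sum_range_succ', add_comm]
  simp [shift]

theorem add_mul' (a b c : FreeSeries n) : (a + b) * c = a * c + b * c := by
  refine ext' fun w => ?_
  simp only [mul_apply', add_apply', add_mul, Finset.sum_add_distrib]

theorem mul_add' (a b c : FreeSeries n) : a * (b + c) = a * b + a * c := by
  refine ext' fun w => ?_
  simp only [mul_apply', add_apply', mul_add, Finset.sum_add_distrib]

theorem smul_mul' (t : ℂ) (a b : FreeSeries n) : (t • a) * b = t • (a * b) := by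
  refine ext' fun w => ?_
  simp only [mul_apply', smul_apply', mul_assoc, Finset.mul_sum]

theorem mul_smul' (t : ℂ) (a b : FreeSeries n) : a * (t • b) = t • (a * b) := by
  refine ext' fun w => ?_
  simp only [mul_apply', smul_apply', mul_left_comm, Finset.mul_sum]

theorem shift_mul (x : Fin n) (a b : FreeSeries n) :
    shift x (a * b) = a [] • shift x b + shift x a * b :=
  ext' fun w => mul_cons a b x w

theorem mul_assoc' (a b c : FreeSeries n) : a * b * c = a * (b * c) := by
  refine ext' fun w => ?_
  induction w generalizing a b c with
  | nil => simp only [mul_nil, mul_assoc]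
  | cons x w ih =>
    rw [mul_cons, mul_cons, shift_mul, add_mul', add_apply', smul_mul', ih, mul_nil, mul_cons,
      smul_apply']
    ring

theorem one_mul' (a : FreeSeries n) : 1 * a = a := by
  refine ext' fun w => ?_
  cases w with
  | nil => rw [mul_nil]; exact one_mul _
  | cons x w =>
    have h : shift x (1 : FreeSeries n) = 0 :=
      ext' fun v => if_neg (c := x :: v = []) (t := (1 : ℂ)) (e := 0) (List.cons_ne_nil x v)
    rw [mul_cons, h]
    have h0 : (0 * a : FreeSeries n) w = 0 := by
      rw [mul_apply']; exact Finset.sum_eq_zero fun i _ => zero_mul _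
    rw [h0, add_zero]; exact one_mul _

theorem mul_one' (a : FreeSeries n) : a * 1 = a := by
  refine ext' fun w => ?_
  induction w generalizing a with
  | nil => rw [mul_nil]; exact mul_one _
  | cons x w ih =>
    have h : (1 : FreeSeries n) (x :: w) = 0 :=
      if_neg (c := x :: w = []) (t := (1 : ℂ)) (e := 0) (List.cons_ne_nil x w)
    rw [mul_cons, ih, h, mul_zero, zero_add]; rfl

noncomputable instance : Ring (FreeSeries n) where
  __ := (inferInstance : AddCommGroup (FreeSeries n))
  left_distrib := mul_add'
  right_distrib := add_mul'
  zero_mul a := ext' fun w => Finset.sum_eq_zero fun i _ => zero_mul _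
  mul_zero a := ext' fun w => Finset.sum_eq_zero fun i _ => mul_zero _
  mul_assoc := mul_assoc'
  one_mul := one_mul'
  mul_one := mul_one'

noncomputable instance : Algebra ℂ (FreeSeries n) := Algebra.ofModule smul_mul' mul_smul'

end FreeSeries

/-- An extended submultiplicative seminorm on a complex algebra (the value `∞` is allowed). -/
structure ExtSeminorm (A : Type) [Ring A] [Algebra ℂ A] where
  /-- The underlying function. -/
  toFun : A → ℝ≥0∞
  zero_eq : toFun 0 = 0
  add_le : ∀ a b, toFun (a + b) ≤ toFun a + toFun b
  smul_le : ∀ (c : ℂ) a, toFun (c • a) ≤ ‖c‖ₑ * toFun a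
  mul_le : ∀ a b, toFun (a * b) ≤ toFun a * toFun b
  one_lt_top : toFun 1 < ⊤

namespace ExtSeminorm
variable {A : Type} [Ring A] [Algebra ℂ A] {ι : Type}

theorem neg_le (N : ExtSeminorm A) (a : A) : N.toFun (-a) ≤ N.toFun a := by
  simpa using N.smul_le (-1) a

/-- The subalgebra of all elements at which all the extended seminorms `N i` are finite. -/
def finiteSubalgebra (N : ι → ExtSeminorm A) : Subalgebra ℂ A where
  carrier := {a | ∀ i, (N i).toFun a < ⊤}
  mul_mem' ha hb i := ((N i).mul_le _ _).trans_lt (ENNReal.mul_lt_top (ha i) (hb i))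
  add_mem' ha hb i := ((N i).add_le _ _).trans_lt (ENNReal.add_lt_top.2 ⟨ha i, hb i⟩)
  algebraMap_mem' c i := by
    rw [Algebra.algebraMap_eq_smul_one]
    exact ((N i).smul_le c 1).trans_lt (ENNReal.mul_lt_top (by simp) (N i).one_lt_top)

/-- The algebra of all elements at which all the `N i` are finite, topologized by the `N i`. -/
def FiniteAlg (N : ι → ExtSeminorm A) : Type := finiteSubalgebra N

variable (N : ι → ExtSeminorm A)

noncomputable instance : Ring (FiniteAlg N) := inferInstanceAs (Ring (finiteSubalgebra N))
noncomputable instance : Algebra ℂ (FiniteAlg N) :=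
  inferInstanceAs (Algebra ℂ (finiteSubalgebra N))

/-- The inclusion of `FiniteAlg N` into the ambient algebra. -/
def incl : FiniteAlg N →ₐ[ℂ] A := (finiteSubalgebra N).val

theorem incl_lt_top (i : ι) (a : FiniteAlg N) : (N i).toFun (incl N a) < ⊤ :=
  Subtype.property (p := fun a => ∀ i, (N i).toFun a < ⊤) a i

/-- The restriction of `N i` to `FiniteAlg N`, as a real valued ring seminorm. -/
noncomputable def ringSeminorm (i : ι) : RingSeminorm (FiniteAlg N) where
  toFun a := ((N i).toFun (incl N a)).toReal
  map_zero' := by rw [map_zero, (N i).zero_eq, ENNReal.toReal_zero]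
  add_le' a b := by
    rw [map_add, ← ENNReal.toReal_add (incl_lt_top N i a).ne (incl_lt_top N i b).ne]
    exact ENNReal.toReal_mono
      (ENNReal.add_lt_top.2 ⟨incl_lt_top N i a, incl_lt_top N i b⟩).ne ((N i).add_le _ _)
  neg' a := by
    have h : (N i).toFun (-(incl N a)) = (N i).toFun (incl N a) :=
      le_antisymm ((N i).neg_le _) (by simpa using (N i).neg_le (-(incl N a)))
    rw [map_neg, h]
  mul_le' a b := by
    rw [map_mul, ← ENNReal.toReal_mul]
    exact ENNReal.toReal_mono
      (ENNReal.mul_lt_top (incl_lt_top N i a) (incl_lt_top N i b)).ne ((N i).mul_le _ _)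

/-- The topology defined by the seminorm `N i` alone. -/
@[reducible] noncomputable def topologyAt (i : ι) : TopologicalSpace (FiniteAlg N) :=
  (ringSeminorm N i).toSeminormedRing.toPseudoMetricSpace.toUniformSpace.toTopologicalSpace

theorem isTopologicalRing_topologyAt (i : ι) :
    @IsTopologicalRing (FiniteAlg N) (topologyAt N i) _ := by
  let := (ringSeminorm N i).toSeminormedRing
  exact (inferInstance : IsTopologicalRing (FiniteAlg N))

theorem continuousSMul_topologyAt (i : ι) :
    @ContinuousSMul ℂ (FiniteAlg N) _ _ (topologyAt N i) := by
  let := (ringSeminorm N i).toSeminormedRing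
  let : NormedSpace ℂ (FiniteAlg N) :=
    { norm_smul_le := fun c a => by
        have h := ENNReal.toReal_mono (ENNReal.mul_lt_top (by simp) (incl_lt_top N i a)).ne
          ((N i).smul_le c (incl N a))
        rw [ENNReal.toReal_mul, toReal_enorm] at h
        change ((N i).toFun (incl N (c • a))).toReal ≤ _
        rw [map_smul]
        exact h }
  exact (inferInstance : ContinuousSMul ℂ (FiniteAlg N))

/-- The topology defined by the family of seminorms `N i`. -/
noncomputable instance : TopologicalSpace (FiniteAlg N) := ⨅ i, topologyAt N i

instance : IsTopologicalRing (FiniteAlg N) :=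
  have hm : ContinuousMul (FiniteAlg N) :=
    continuousMul_iInf fun i => (isTopologicalRing_topologyAt N i).toContinuousMul
  have ha : IsTopologicalAddGroup (FiniteAlg N) :=
    topologicalAddGroup_iInf fun i =>
      @IsTopologicalRing.to_topologicalAddGroup _ _ (topologyAt N i)
        (isTopologicalRing_topologyAt N i)
  { ha, hm with }

instance : ContinuousSMul ℂ (FiniteAlg N) :=
  continuousSMul_iInf fun i => continuousSMul_topologyAt N i

end ExtSeminorm

namespace FreeSeries
variable {n : ℕ}

/-- Concatenation product of `[0, ∞]`-valued functions on words. -/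
noncomputable def conv (F G : List (Fin n) → ℝ≥0∞) (w : List (Fin n)) : ℝ≥0∞ :=
  ∑ i ∈ Finset.range (w.length + 1), F (w.take i) * G (w.drop i)


/-- Splittings of words are the same as pairs of words. -/
def splitEquiv : (Σ w : List (Fin n), Fin (w.length + 1)) ≃ List (Fin n) × List (Fin n) where
  toFun s := (s.1.take s.2, s.1.drop s.2)
  invFun p := ⟨p.1 ++ p.2, ⟨p.1.length, by simp⟩⟩
  left_inv := by
    rintro ⟨w, i, hi⟩
    have hi' : i ≤ w.length := by omega
    refine Sigma.ext (List.take_append_drop i w) ?_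
    refine (Fin.heq_ext_iff ?_).2 ?_
    · simp
    · simp [hi']
  right_inv := by
    rintro ⟨u, v⟩
    simp

theorem tsum_conv (F G : List (Fin n) → ℝ≥0∞) :
    ∑' w, conv F G w = (∑' w, F w) * ∑' w, G w := by
  have h1 : ∑' w, conv F G w
      = ∑' s : (Σ w : List (Fin n), Fin (w.length + 1)),
          F (splitEquiv s).1 * G (splitEquiv s).2 := by
    rw [ENNReal.tsum_sigma']
    refine tsum_congr fun w => ?_
    rw [tsum_fintype, conv, Finset.sum_range]
    rfl
  rw [h1, splitEquiv.tsum_eq (fun p : List (Fin n) × List (Fin n) => F p.1 * G p.2),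
    ENNReal.tsum_prod']
  simp only [ENNReal.tsum_mul_left, ENNReal.tsum_mul_right]

theorem enorm_mul_le (a b : FreeSeries n) (w : List (Fin n)) :
    ‖(a * b) w‖ₑ ≤ conv (fun u => ‖a u‖ₑ) (fun v => ‖b v‖ₑ) w := by
  rw [mul_apply']
  refine (enorm_sum_le _ _).trans (Finset.sum_le_sum fun i _ => ?_)
  exact (enorm_mul _ _).le

/-- The number of maximal constant blocks of a word: `0` for the empty word, and otherwise
one more than the number of indices `i` with `α_i ≠ α_{i+1}`. -/
def blocks : List (Fin n) → ℕ
  | [] => 0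
  | [_] => 1
  | x :: y :: w => blocks (y :: w) + if x = y then 0 else 1

theorem blocks_cons_le (x : Fin n) (w : List (Fin n)) : blocks (x :: w) ≤ blocks w + 1 := by
  cases w with
  | nil => simp [blocks]
  | cons y w => simp only [blocks]; split_ifs <;> omega

theorem blocks_append_le (u v : List (Fin n)) : blocks (u ++ v) ≤ blocks u + blocks v := by
  induction u with
  | nil => simp [blocks]
  | cons x u ih =>
    cases u with
    | nil => simpa [blocks, add_comm] using blocks_cons_le x v
    | cons y u =>
      simp only [List.cons_append, blocks] at ih ⊢
      omega

/-- The norm `‖a‖_{ρ,τ} = ∑_α |c_α| ρ^{|α|} τ^{b(α)}`, where `b(α)` is the number of blocks. -/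
noncomputable def polydiskNorm (ρ τ : ℝ) (hρ : 0 < ρ) (hτ : 1 ≤ τ) : ExtSeminorm (FreeSeries n) where
  toFun a := ∑' w, ‖a.coeff w‖ₑ * ENNReal.ofReal (ρ ^ w.length * τ ^ blocks w)
  zero_eq := by
    refine ENNReal.tsum_eq_zero.2 fun w => ?_
    have : (0 : FreeSeries n).coeff w = 0 := rfl
    simp [this]
  add_le a b := by
    rw [← ENNReal.tsum_add]
    refine ENNReal.tsum_le_tsum fun w => ?_
    rw [← add_mul]
    gcongr
    exact enorm_add_le (a w) (b w)
  smul_le c a := by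
    rw [← ENNReal.tsum_mul_left]
    refine ENNReal.tsum_le_tsum fun w => ?_
    rw [← mul_assoc]
    gcongr
    exact (enorm_mul c (a w)).le
  mul_le a b := by
    rw [← tsum_conv]
    refine ENNReal.tsum_le_tsum fun w => ?_
    refine (mul_le_mul_left (enorm_mul_le a b w) _).trans ?_
    rw [conv, conv, Finset.sum_mul]
    refine Finset.sum_le_sum fun i hi => ?_
    rw [mul_mul_mul_comm]
    refine mul_le_mul_right ?_ _
    rw [← ENNReal.ofReal_mul (by positivity)]
    refine ENNReal.ofReal_le_ofReal ?_
    have h1 : (w.take i).length + (w.drop i).length = w.length := by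
      rw [← List.length_append, List.take_append_drop]
    have h2 : blocks w ≤ blocks (w.take i) + blocks (w.drop i) := by
      simpa using blocks_append_le (w.take i) (w.drop i)
    calc ρ ^ w.length * τ ^ blocks w
        ≤ ρ ^ w.length * τ ^ (blocks (w.take i) + blocks (w.drop i)) := by gcongr
      _ = _ := by rw [← h1]; ring
  one_lt_top := by
    rw [tsum_eq_single []]
    · exact ENNReal.mul_lt_top (by simp) ENNReal.ofReal_lt_top
    · intro w hw
      have : (1 : FreeSeries n).coeff w = 0 := if_neg hw
      simp [this]


/-- The number of occurrences of each letter in a word. -/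
noncomputable def content (w : List (Fin n)) : Fin n →₀ ℕ :=
  Finsupp.equivFunOnFinite.symm fun j => w.count j

theorem content_append (u v : List (Fin n)) : content (u ++ v) = content u + content v := by
  ext j; simp [content]

theorem sum_content (w : List (Fin n)) : ∑ j, content w j = w.length := by
  simp only [content, Finsupp.equivFunOnFinite_symm_apply_apply]
  induction w with
  | nil => simp
  | cons x w ih => simp [List.count_cons, Finset.sum_add_distrib, ih]

/-- The `ℓ²`-norm of the part of `F` supported on the words of content `k`. -/
noncomputable def l2 (F : List (Fin n) → ℝ≥0∞) (k : Fin n →₀ ℕ) : ℝ≥0∞ :=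
  (∑' w : {w : List (Fin n) // content w = k}, F w ^ 2) ^ (1 / 2 : ℝ)

theorem l2_mono {F G : List (Fin n) → ℝ≥0∞} {k : Fin n →₀ ℕ}
    (h : ∀ w, content w = k → F w ≤ G w) : l2 F k ≤ l2 G k := by
  refine ENNReal.rpow_le_rpow (ENNReal.tsum_le_tsum fun w => ?_) (by norm_num)
  gcongr
  exact h w w.2

theorem l2_add_le (F G : List (Fin n) → ℝ≥0∞) (k : Fin n →₀ ℕ) :
    l2 (fun w => F w + G w) k ≤ l2 F k + l2 G k := by
  let _ : MeasurableSpace {w : List (Fin n) // content w = k} := ⊤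
  have h := ENNReal.lintegral_Lp_add_le
    (μ := (MeasureTheory.Measure.count : MeasureTheory.Measure {w : List (Fin n) // content w = k}))
    (p := 2) (f := fun w => F w) (g := fun w => G w)
    (measurable_of_countable _).aemeasurable (measurable_of_countable _).aemeasurable (by norm_num)
  simpa [MeasureTheory.lintegral_count, l2] using h

theorem l2_zero (k : Fin n →₀ ℕ) : l2 (fun _ : List (Fin n) => 0) k = 0 := by
  simp [l2]

theorem l2_sum_le {κ : Type} (s : Finset κ) (F : κ → List (Fin n) → ℝ≥0∞) (k : Fin n →₀ ℕ) :
    l2 (fun w => ∑ i ∈ s, F i w) k ≤ ∑ i ∈ s, l2 (F i) k := by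
  classical
  induction s using Finset.induction_on with
  | empty => simp [l2_zero]
  | insert i s hi ih =>
    simp only [Finset.sum_insert hi]
    exact (l2_add_le _ _ k).trans (by gcongr)

theorem l2_mul_left (c : ℝ≥0∞) (F : List (Fin n) → ℝ≥0∞) (k : Fin n →₀ ℕ) :
    l2 (fun w => c * F w) k = c * l2 F k := by
  have h : (c ^ 2) ^ (1 / 2 : ℝ) = c := by
    rw [← ENNReal.rpow_natCast, ← ENNReal.rpow_mul]; norm_num
  simp only [l2, mul_pow, ENNReal.tsum_mul_left]
  rw [ENNReal.mul_rpow_of_nonneg _ _ (by norm_num), h]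

open Classical in
/-- The part of `F` supported on the words of content `k`. -/
noncomputable def part (F : List (Fin n) → ℝ≥0∞) (k : Fin n →₀ ℕ) (w : List (Fin n)) : ℝ≥0∞ :=
  if content w = k then F w else 0

theorem tsum_part (F : List (Fin n) → ℝ≥0∞) (k : Fin n →₀ ℕ) :
    ∑' w, part (fun w => F w ^ 2) k w = ∑' w : {w : List (Fin n) // content w = k}, F w ^ 2 := by
  rw [show (∑' w : {w : List (Fin n) // content w = k}, F w ^ 2)
    = ∑' w : ({w | content w = k} : Set (List (Fin n))), F w ^ 2 from rfl,
    tsum_subtype {w | content w = k} (fun w => F w ^ 2)]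
  refine tsum_congr fun w => ?_
  simp [part, Set.indicator]

theorem conv_eq_sum (F G : List (Fin n) → ℝ≥0∞) (w : List (Fin n)) :
    conv F G w = ∑ p ∈ Finset.HasAntidiagonal.antidiagonal (content w), conv (part F p.1) (part G p.2) w := by
  simp only [conv]
  rw [Finset.sum_comm]
  refine Finset.sum_congr rfl fun i _ => ?_
  rw [Finset.sum_eq_single (content (w.take i), content (w.drop i))]
  · simp [part]
  · rintro ⟨k, l⟩ _ hne
    by_cases h1 : content (w.take i) = k
    · by_cases h2 : content (w.drop i) = l
      · exact absurd (by rw [h1, h2]) hne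
      · simp [part, h2]
    · simp [part, h1]
  · intro h
    exact absurd (Finset.HasAntidiagonal.mem_antidiagonal.2 (by
      rw [← content_append, List.take_append_drop])) h

theorem conv_part_sq (F G : List (Fin n) → ℝ≥0∞) (k l : Fin n →₀ ℕ) (w : List (Fin n)) :
    conv (part F k) (part G l) w ^ 2
      = conv (part (fun w => F w ^ 2) k) (part (fun w => G w ^ 2) l) w := by
  have key : ∀ i ∈ Finset.range (w.length + 1), i ≠ ∑ j, k j → content (w.take i) ≠ k := by
    rintro i hi hne rfl
    rw [sum_content, List.length_take] at hne
    simp at hi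
    omega
  simp only [conv]
  by_cases hk : ∑ j, k j ∈ Finset.range (w.length + 1)
  · rw [Finset.sum_eq_single_of_mem _ hk fun i hi hne => by simp [part, key i hi hne],
      Finset.sum_eq_single_of_mem _ hk fun i hi hne => by simp [part, key i hi hne]]
    simp only [part]
    split_ifs <;> simp [mul_pow]
  · rw [Finset.sum_eq_zero fun i hi => by
        simp [part, key i hi (fun h => hk (h ▸ hi))],
      Finset.sum_eq_zero fun i hi => by
        simp [part, key i hi (fun h => hk (h ▸ hi))]]
    simp

theorem l2_conv_part_le (F G : List (Fin n) → ℝ≥0∞) (k l m : Fin n →₀ ℕ) :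
    l2 (conv (part F k) (part G l)) m ≤ l2 F k * l2 G l := by
  rw [l2, l2, l2, ← ENNReal.mul_rpow_of_nonneg _ _ (by norm_num), ← tsum_part F, ← tsum_part G,
    ← tsum_conv]
  refine ENNReal.rpow_le_rpow ?_ (by norm_num)
  simp only [conv_part_sq]
  exact ENNReal.tsum_comp_le_tsum_of_injective Subtype.val_injective _

theorem l2_mul_le (a b : FreeSeries n) (m : Fin n →₀ ℕ) :
    l2 (fun w => ‖(a * b) w‖ₑ) m
      ≤ ∑ p ∈ Finset.HasAntidiagonal.antidiagonal m, l2 (fun w => ‖a w‖ₑ) p.1 * l2 (fun w => ‖b w‖ₑ) p.2 := by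
  calc l2 (fun w => ‖(a * b) w‖ₑ) m
      ≤ l2 (fun w => ∑ p ∈ Finset.HasAntidiagonal.antidiagonal m,
          conv (part (fun w => ‖a w‖ₑ) p.1) (part (fun w => ‖b w‖ₑ) p.2) w) m := by
        refine l2_mono fun w hw => ?_
        rw [← hw, ← conv_eq_sum]
        exact enorm_mul_le a b w
    _ ≤ _ := (l2_sum_le _ _ m).trans (Finset.sum_le_sum fun p _ => l2_conv_part_le _ _ _ _ _)

end FreeSeries

/-- Cauchy products of `[0, ∞]`-valued families indexed by multi-indices. -/
theorem tsum_antidiagonal {n : ℕ} (f g : (Fin n →₀ ℕ) → ℝ≥0∞) :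
    ∑' m, ∑ p ∈ Finset.HasAntidiagonal.antidiagonal m, f p.1 * g p.2 = (∑' k, f k) * ∑' l, g l := by
  let e : (Σ m : Fin n →₀ ℕ, Finset.HasAntidiagonal.antidiagonal m) ≃ (Fin n →₀ ℕ) × (Fin n →₀ ℕ) :=
    { toFun := fun s => s.2.1
      invFun := fun p => ⟨p.1 + p.2, ⟨p, Finset.HasAntidiagonal.mem_antidiagonal.2 rfl⟩⟩
      left_inv := by
        rintro ⟨m, ⟨⟨k, l⟩, h⟩⟩
        obtain rfl := Finset.HasAntidiagonal.mem_antidiagonal.1 h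
        rfl
      right_inv := fun p => rfl }
  have h1 : ∑' m, ∑ p ∈ Finset.HasAntidiagonal.antidiagonal m, f p.1 * g p.2
      = ∑' s : (Σ m : Fin n →₀ ℕ, Finset.HasAntidiagonal.antidiagonal m), f (e s).1 * g (e s).2 := by
    rw [ENNReal.tsum_sigma']
    refine tsum_congr fun m => ?_
    rw [tsum_fintype]
    exact (Finset.sum_coe_sort _ (fun p : (Fin n →₀ ℕ) × (Fin n →₀ ℕ) => f p.1 * g p.2)).symm
  rw [h1, e.tsum_eq (fun p => f p.1 * g p.2), ENNReal.tsum_prod']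
  simp only [ENNReal.tsum_mul_left, ENNReal.tsum_mul_right]

namespace FreeSeries
variable {n : ℕ}

/-- The norm `‖a‖_ρ = ∑_k (∑_{α of content k} |c_α|²)^{1/2} ρ^{|k|}`. -/
noncomputable def ballNorm (ρ : ℝ) (hρ : 0 < ρ) : ExtSeminorm (FreeSeries n) where
  toFun a := ∑' k : Fin n →₀ ℕ,
    (∑' w : {w : List (Fin n) // content w = k}, ‖a.coeff w‖ₑ ^ 2) ^ (1 / 2 : ℝ)
      * ENNReal.ofReal (ρ ^ ∑ j, k j)
  zero_eq := by
    refine ENNReal.tsum_eq_zero.2 fun k => ?_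
    have : ∀ w, (0 : FreeSeries n).coeff w = 0 := fun _ => rfl
    simp [this]
  add_le a b := by
    rw [← ENNReal.tsum_add]
    refine ENNReal.tsum_le_tsum fun k => ?_
    rw [← add_mul]
    gcongr
    refine le_trans ?_ (l2_add_le (fun w => ‖a w‖ₑ) (fun w => ‖b w‖ₑ) k)
    exact l2_mono (F := fun w => ‖(a + b) w‖ₑ) fun w _ => enorm_add_le (a w) (b w)
  smul_le c a := by
    rw [← ENNReal.tsum_mul_left]
    refine ENNReal.tsum_le_tsum fun k => ?_
    rw [← mul_assoc]
    gcongr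
    refine le_trans ?_ (l2_mul_left ‖c‖ₑ (fun w => ‖a w‖ₑ) k).le
    exact l2_mono (F := fun w => ‖(c • a) w‖ₑ) fun w _ => (enorm_mul c (a w)).le
  mul_le a b := by
    rw [← tsum_antidiagonal]
    refine ENNReal.tsum_le_tsum fun m => ?_
    refine (mul_le_mul_left (l2_mul_le a b m) _).trans ?_
    rw [Finset.sum_mul]
    refine Finset.sum_le_sum fun p hp => ?_
    obtain rfl := Finset.HasAntidiagonal.mem_antidiagonal.1 hp
    rw [mul_mul_mul_comm, ← ENNReal.ofReal_mul (by positivity), ← pow_add,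
      ← Finset.sum_add_distrib]
    exact le_rfl
  one_lt_top := by
    have h1 : ∀ w : List (Fin n), w ≠ [] → (1 : FreeSeries n).coeff w = 0 := fun w hw => if_neg hw
    rw [tsum_eq_single 0]
    · refine ENNReal.mul_lt_top ?_ ENNReal.ofReal_lt_top
      refine ENNReal.rpow_lt_top_of_nonneg (by norm_num) ?_
      rw [tsum_eq_single ⟨[], by ext; simp [content]⟩]
      · simp
      · rintro ⟨w, hw⟩ hne
        have : w ≠ [] := fun h => hne (Subtype.ext h)
        simp [h1 w this]
    · intro k hk
      have : ∀ w : {w : List (Fin n) // content w = k}, (1 : FreeSeries n).coeff w = 0 := by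
        rintro ⟨w, rfl⟩
        refine h1 w ?_
        rintro rfl
        exact hk (by ext; simp [content])
      simp [this]

end FreeSeries

/-- The punctured plane `ℂ^×`. -/
abbrev CStar : Type := {z : ℂ // z ≠ 0}

/-- Formal power series `∑ c_k x^k` in the quantum coordinates `x_1, …, x_n`, where
`x^k = x_1^{k_1} ⋯ x_n^{k_n}` and `x_i x_j = q x_j x_i` for `i < j`. -/
def QSeries (_q : CStar) (n : ℕ) : Type := (Fin n →₀ ℕ) → ℂ

namespace QSeries
variable {q : CStar} {n : ℕ}

noncomputable instance : AddCommGroup (QSeries q n) :=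
  inferInstanceAs (AddCommGroup ((Fin n →₀ ℕ) → ℂ))

noncomputable instance : Module ℂ (QSeries q n) :=
  inferInstanceAs (Module ℂ ((Fin n →₀ ℕ) → ℂ))

/-- The coefficient of `x^k`. -/
def coeff (k : Fin n →₀ ℕ) (a : QSeries q n) : ℂ := a k

open Classical in
/-- The monomial `x^k`. -/
noncomputable def mono (k : Fin n →₀ ℕ) : QSeries q n := fun m => if m = k then 1 else 0

theorem mono_self (k : Fin n →₀ ℕ) : (mono k : QSeries q n) k = 1 := by
  rw [mono, if_pos rfl]

theorem mono_ne {k m : Fin n →₀ ℕ} (h : m ≠ k) : (mono k : QSeries q n) m = 0 := by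
  rw [mono, if_neg h]

/-- The exponent `∑_{i<j} k_j l_i`, for which `x^k x^l = q^{-∑_{i<j} k_j l_i} x^{k+l}`. -/
def cross (k l : Fin n → ℕ) : ℕ := ∑ j, ∑ i, if i < j then k j * l i else 0

theorem cross_add_left (k k' l : Fin n → ℕ) : cross (k + k') l = cross k l + cross k' l := by
  simp only [cross, ← Finset.sum_add_distrib]
  refine Finset.sum_congr rfl fun j _ => Finset.sum_congr rfl fun i _ => ?_
  split_ifs <;> simp [add_mul]

theorem cross_add_right (k l l' : Fin n → ℕ) : cross k (l + l') = cross k l + cross k l' := by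
  simp only [cross, ← Finset.sum_add_distrib]
  refine Finset.sum_congr rfl fun j _ => Finset.sum_congr rfl fun i _ => ?_
  split_ifs <;> simp [mul_add]

theorem cross_zero_left (l : Fin n → ℕ) : cross 0 l = 0 := by simp [cross]
theorem cross_zero_right (k : Fin n → ℕ) : cross k 0 = 0 := by simp [cross]

/-- The product determined by `x^k x^l = q^{-∑_{i<j} k_j l_i} x^{k+l}`. -/
noncomputable instance : Mul (QSeries q n) :=
  ⟨fun a b m => ∑ p ∈ Finset.HasAntidiagonal.antidiagonal m,
    ((q : ℂ)⁻¹) ^ cross p.1 p.2 * (a p.1 * b p.2)⟩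

noncomputable instance : One (QSeries q n) := ⟨mono 0⟩

theorem ext' {a b : QSeries q n} (h : ∀ k, a k = b k) : a = b := funext h
theorem add_apply' (a b : QSeries q n) (k) : (a + b) k = a k + b k := rfl
theorem smul_apply' (c : ℂ) (a : QSeries q n) (k) : (c • a) k = c * a k := rfl
theorem mul_apply' (a b : QSeries q n) (m) :
    (a * b) m = ∑ p ∈ Finset.HasAntidiagonal.antidiagonal m,
      ((q : ℂ)⁻¹) ^ cross p.1 p.2 * (a p.1 * b p.2) := rfl

theorem add_mul' (a b c : QSeries q n) : (a + b) * c = a * c + b * c := by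
  refine ext' fun w => ?_
  simp only [mul_apply', add_apply', add_mul, mul_add, Finset.sum_add_distrib]

theorem mul_add' (a b c : QSeries q n) : a * (b + c) = a * b + a * c := by
  refine ext' fun w => ?_
  simp only [mul_apply', add_apply', mul_add, Finset.sum_add_distrib]

theorem smul_mul' (t : ℂ) (a b : QSeries q n) : (t • a) * b = t • (a * b) := by
  refine ext' fun w => ?_
  simp only [mul_apply', smul_apply', Finset.mul_sum]
  exact Finset.sum_congr rfl fun p _ => by ring

theorem mul_smul' (t : ℂ) (a b : QSeries q n) : a * (t • b) = t • (a * b) := by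
  refine ext' fun w => ?_
  simp only [mul_apply', smul_apply', Finset.mul_sum]
  exact Finset.sum_congr rfl fun p _ => by ring

theorem mul_assoc' (a b c : QSeries q n) : a * b * c = a * (b * c) := by
  refine ext' fun m => ?_
  simp only [mul_apply', Finset.sum_mul, Finset.mul_sum, Finset.sum_sigma']
  refine Finset.sum_nbij' (fun s => ⟨(s.2.1, s.2.2 + s.1.2), (s.2.2, s.1.2)⟩)
    (fun s => ⟨(s.1.1 + s.2.1, s.2.2), (s.1.1, s.2.1)⟩) ?_ ?_ ?_ ?_ ?_
  · rintro ⟨⟨i, j⟩, ⟨k, l⟩⟩ h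
    simp only [Finset.mem_sigma, Finset.HasAntidiagonal.mem_antidiagonal] at h ⊢
    exact ⟨by rw [← h.1, ← h.2, add_assoc], trivial⟩
  · rintro ⟨⟨i, j⟩, ⟨k, l⟩⟩ h
    simp only [Finset.mem_sigma, Finset.HasAntidiagonal.mem_antidiagonal] at h ⊢
    exact ⟨by rw [← h.1, ← h.2, add_assoc], trivial⟩
  · rintro ⟨⟨i, j⟩, ⟨k, l⟩⟩ h
    simp only [Finset.mem_sigma, Finset.HasAntidiagonal.mem_antidiagonal] at h
    obtain ⟨_, rfl⟩ := h
    rfl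
  · rintro ⟨⟨i, j⟩, ⟨k, l⟩⟩ h
    simp only [Finset.mem_sigma, Finset.HasAntidiagonal.mem_antidiagonal] at h
    obtain ⟨_, rfl⟩ := h
    rfl
  · rintro ⟨⟨i, j⟩, ⟨k, l⟩⟩ h
    simp only [Finset.mem_sigma, Finset.HasAntidiagonal.mem_antidiagonal] at h
    obtain ⟨_, rfl⟩ := h
    simp only [Finsupp.coe_add, cross_add_left, cross_add_right, pow_add]
    ring

theorem one_mul' (a : QSeries q n) : 1 * a = a := by
  refine ext' fun m => ?_
  rw [mul_apply', Finset.sum_eq_single (0, m)]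
  · have : (1 : QSeries q n) 0 = 1 := mono_self 0
    simp [this, cross_zero_left]
  · rintro ⟨k, l⟩ h hne
    have hk : k ≠ 0 := by
      rintro rfl
      rw [Finset.HasAntidiagonal.mem_antidiagonal] at h
      exact hne (by rw [← h]; simp)
    have : (1 : QSeries q n) k = 0 := mono_ne hk
    simp [this]
  · intro h
    exact absurd (Finset.HasAntidiagonal.mem_antidiagonal.2 (zero_add m)) h

theorem mul_one' (a : QSeries q n) : a * 1 = a := by
  refine ext' fun m => ?_
  rw [mul_apply', Finset.sum_eq_single (m, 0)]
  · have : (1 : QSeries q n) 0 = 1 := mono_self 0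
    simp [this, cross_zero_right]
  · rintro ⟨k, l⟩ h hne
    have hk : l ≠ 0 := by
      rintro rfl
      rw [Finset.HasAntidiagonal.mem_antidiagonal] at h
      exact hne (by rw [← h]; simp)
    have : (1 : QSeries q n) l = 0 := mono_ne hk
    simp [this]
  · intro h
    exact absurd (Finset.HasAntidiagonal.mem_antidiagonal.2 (add_zero m)) h

noncomputable instance : Ring (QSeries q n) where
  __ := (inferInstance : AddCommGroup (QSeries q n))
  left_distrib := mul_add'
  right_distrib := add_mul'
  zero_mul a := ext' fun w => Finset.sum_eq_zero fun i _ => by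
    change _ * (0 * _) = (0 : ℂ); simp
  mul_zero a := ext' fun w => Finset.sum_eq_zero fun i _ => by
    change _ * (_ * 0) = (0 : ℂ); simp
  mul_assoc := mul_assoc'
  one_mul := one_mul'
  mul_one := mul_one'

noncomputable instance : Algebra ℂ (QSeries q n) := Algebra.ofModule smul_mul' mul_smul'

theorem mono_mul_mono (k l : Fin n →₀ ℕ) :
    (mono k * mono l : QSeries q n) = ((q : ℂ)⁻¹) ^ cross k l • mono (k + l) := by
  refine ext' fun m => ?_
  rw [mul_apply', smul_apply']
  have h0 : ∀ p ∈ Finset.HasAntidiagonal.antidiagonal m, p ≠ (k, l) →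
      ((q : ℂ)⁻¹) ^ cross p.1 p.2 * ((mono k : QSeries q n) p.1 * (mono l : QSeries q n) p.2)
        = 0 := by
    rintro ⟨k', l'⟩ _ hne
    by_cases h1 : k' = k
    · have h2 : l' ≠ l := fun h2 => hne (by rw [h1, h2])
      rw [mono_ne (k := l) h2, mul_zero, mul_zero]
    · rw [mono_ne (k := k) h1, zero_mul, mul_zero]
  by_cases hm : m = k + l
  · rw [Finset.sum_eq_single_of_mem (k, l)
      (Finset.HasAntidiagonal.mem_antidiagonal.2 hm.symm) h0, hm]
    simp only [mono_self, mul_one]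
  · rw [Finset.sum_eq_zero, mono_ne hm, mul_zero]
    intro p hp
    refine h0 p hp ?_
    rintro rfl
    exact hm (Finset.HasAntidiagonal.mem_antidiagonal.1 hp).symm

/-- The coordinate `x_i`. -/
noncomputable def gen (i : Fin n) : QSeries q n := mono (Finsupp.single i 1)

/-- The defining relation `x_i x_j = q x_j x_i` for `i < j`. -/
theorem gen_mul_gen {i j : Fin n} (hij : i < j) :
    (gen i * gen j : QSeries q n) = (q : ℂ) • (gen j * gen i) := by
  have h1 : cross (Finsupp.single i 1 : Fin n →₀ ℕ) (Finsupp.single j 1 : Fin n →₀ ℕ) = 0 := by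
    refine Finset.sum_eq_zero fun j' _ => Finset.sum_eq_zero fun i' _ => ?_
    split_ifs with h
    · by_cases hj : i = j'
      · have : j ≠ i' := by rintro rfl; subst hj; exact absurd h (not_lt.2 hij.le)
        simp [Finsupp.single_apply, this]
      · simp [Finsupp.single_apply, hj]
    · rfl
  have h2 : cross (Finsupp.single j 1 : Fin n →₀ ℕ) (Finsupp.single i 1 : Fin n →₀ ℕ) = 1 := by
    rw [cross, Finset.sum_eq_single j, Finset.sum_eq_single i]
    · simp [hij]
    · intro i' _ hi'
      simp [hi'.symm]
    · simp
    · intro j' _ hj'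
      simp [Finsupp.single_apply, hj'.symm]
    · simp
  rw [gen, gen, mono_mul_mono, mono_mul_mono, h1, h2, smul_smul, add_comm]
  simp [q.2]

/-- The norm `∑_k |c_k| w_k ρ^{|k|}` for a weight `w` that is compatible with the product. -/
noncomputable def weightNorm (q : CStar) (w : (Fin n →₀ ℕ) → ℝ) (hw0 : ∀ k, 0 ≤ w k)
    (hw : ∀ k l : Fin n →₀ ℕ, (‖(q : ℂ)‖⁻¹) ^ cross k l * w (k + l) ≤ w k * w l) (ρ : ℝ) (hρ : 0 < ρ) :
    ExtSeminorm (QSeries q n) where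
  toFun a := ∑' k : Fin n →₀ ℕ, ‖a.coeff k‖ₑ * ENNReal.ofReal (w k * ρ ^ ∑ j, k j)
  zero_eq := by
    refine ENNReal.tsum_eq_zero.2 fun k => ?_
    have : (0 : QSeries q n).coeff k = 0 := rfl
    simp [this]
  add_le a b := by
    rw [← ENNReal.tsum_add]
    refine ENNReal.tsum_le_tsum fun k => ?_
    rw [← add_mul]
    gcongr
    exact enorm_add_le (a k) (b k)
  smul_le c a := by
    rw [← ENNReal.tsum_mul_left]
    refine ENNReal.tsum_le_tsum fun k => ?_
    rw [← mul_assoc]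
    gcongr
    exact (enorm_mul c (a k)).le
  mul_le a b := by
    rw [← tsum_antidiagonal]
    refine ENNReal.tsum_le_tsum fun m => ?_
    have h : ‖(a * b).coeff m‖ₑ ≤ ∑ p ∈ Finset.HasAntidiagonal.antidiagonal m,
        ‖((q : ℂ)⁻¹) ^ cross p.1 p.2 * (a p.1 * b p.2)‖ₑ := enorm_sum_le _ _
    refine (mul_le_mul_left h _).trans ?_
    rw [Finset.sum_mul]
    refine Finset.sum_le_sum fun p hp => ?_
    obtain rfl := Finset.HasAntidiagonal.mem_antidiagonal.1 hp
    have h1 : ‖((q : ℂ)⁻¹) ^ cross p.1 p.2‖ₑ = ENNReal.ofReal ((‖(q : ℂ)‖⁻¹) ^ cross p.1 p.2) := by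
      rw [← ofReal_norm, norm_pow, norm_inv]
    rw [mul_mul_mul_comm, enorm_mul, enorm_mul, h1, mul_comm (ENNReal.ofReal _), mul_assoc,
      ← ENNReal.ofReal_mul (by positivity), ← ENNReal.ofReal_mul (by have := hw0 p.1; positivity)]
    refine mul_le_mul_right (ENNReal.ofReal_le_ofReal ?_) _
    have h2 : ρ ^ ∑ j, (p.1 + p.2) j = ρ ^ (∑ j, p.1 j) * ρ ^ (∑ j, p.2 j) := by
      rw [← pow_add, ← Finset.sum_add_distrib]; rfl
    rw [h2]
    calc _ = ((‖(q : ℂ)‖⁻¹) ^ cross p.1 p.2 * w (p.1 + p.2))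
          * (ρ ^ (∑ j, p.1 j) * ρ ^ (∑ j, p.2 j)) := by ring
      _ ≤ (w p.1 * w p.2) * (ρ ^ (∑ j, p.1 j) * ρ ^ (∑ j, p.2 j)) := by
        exact mul_le_mul_of_nonneg_right (hw p.1 p.2) (by positivity)
      _ = _ := by ring
  one_lt_top := by
    rw [tsum_eq_single 0]
    · exact ENNReal.mul_lt_top (by simp) ENNReal.ofReal_lt_top
    · intro k hk
      have : (1 : QSeries q n).coeff k = 0 := mono_ne (q := q) hk
      simp [this]

/-- The weight of the quantum polydisk: `w_q(k) = 1` if `|q| ≥ 1`, and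
`w_q(k) = |q|^{∑_{i<j} k_i k_j}` if `|q| < 1`. -/
noncomputable def polydiskWeight (q : CStar) (k : Fin n →₀ ℕ) : ℝ :=
  if 1 ≤ ‖(q : ℂ)‖ then 1 else ‖(q : ℂ)‖ ^ ∑ j, ∑ i, if i < j then k i * k j else 0

theorem polydiskWeight_nonneg (q : CStar) (k : Fin n →₀ ℕ) : 0 ≤ polydiskWeight q k := by
  unfold polydiskWeight; split_ifs <;> positivity

theorem polydiskWeight_mul (q : CStar) (k l : Fin n →₀ ℕ) :
    (‖(q : ℂ)‖⁻¹) ^ cross k l * polydiskWeight q (k + l)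
      ≤ polydiskWeight q k * polydiskWeight q l := by
  have hq : 0 < ‖(q : ℂ)‖ := norm_pos_iff.2 q.2
  unfold polydiskWeight
  split_ifs with h
  · simpa using pow_le_one₀ (by positivity) (inv_le_one_of_one_le₀ h)
  · push Not at h
    have e : (∑ j, ∑ i, if i < j then (k + l) i * (k + l) j else 0)
        = (∑ j, ∑ i, if i < j then k i * k j else 0) + (∑ j, ∑ i, if i < j then l i * l j else 0)
          + (∑ j, ∑ i, if i < j then k i * l j else 0) + cross k l := by
      simp only [cross, ← Finset.sum_add_distrib]
      refine Finset.sum_congr rfl fun j _ => Finset.sum_congr rfl fun i _ => ?_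
      split_ifs
      · simp only [Finsupp.add_apply]; ring
      · rfl
    rw [e, pow_add, mul_left_comm, ← mul_pow, inv_mul_cancel₀ hq.ne', one_pow, mul_one, ← pow_add]
    exact pow_le_pow_of_le_one hq.le h.le (Nat.le_add_right _ _)

/-- The `t`-integer `[m]_t = 1 + t + ⋯ + t^{m-1}`. -/
def tNum (t : ℝ) (m : ℕ) : ℝ := ∑ i ∈ Finset.range m, t ^ i

/-- The `t`-factorial `[m]_t! = [1]_t [2]_t ⋯ [m]_t`. -/
def tFact (t : ℝ) (m : ℕ) : ℝ := ∏ i ∈ Finset.range m, tNum t (i + 1)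

theorem tNum_succ_pos {t : ℝ} (ht : 0 < t) (m : ℕ) : 0 < tNum t (m + 1) :=
  Finset.sum_pos (fun i _ => by positivity) (by simp)

theorem tFact_pos {t : ℝ} (ht : 0 < t) (m : ℕ) : 0 < tFact t m :=
  Finset.prod_pos fun i _ => tNum_succ_pos ht i

theorem tFact_succ (t : ℝ) (m : ℕ) : tFact t (m + 1) = tFact t m * tNum t (m + 1) :=
  Finset.prod_range_succ _ _

theorem tNum_add (t : ℝ) (a c : ℕ) : tNum t (a + c) = tNum t a + t ^ a * tNum t c := by
  simp only [tNum, Finset.sum_range_add, pow_add, Finset.mul_sum]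

/-- The `t`-binomial coefficient `[a + c]! / ([a]! [c]!)`. -/
noncomputable def tBinom (t : ℝ) (a c : ℕ) : ℝ := tFact t (a + c) / (tFact t a * tFact t c)

theorem tBinom_pos {t : ℝ} (ht : 0 < t) (a c : ℕ) : 0 < tBinom t a c :=
  div_pos (tFact_pos ht _) (mul_pos (tFact_pos ht _) (tFact_pos ht _))

theorem tBinom_zero_left {t : ℝ} (ht : 0 < t) (c : ℕ) : tBinom t 0 c = 1 := by
  have := (tFact_pos ht c).ne'
  have h0 : tFact t 0 = 1 := by simp [tFact]
  simp [tBinom, h0, this]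

theorem tBinom_zero_right {t : ℝ} (ht : 0 < t) (a : ℕ) : tBinom t a 0 = 1 := by
  have := (tFact_pos ht a).ne'
  have h0 : tFact t 0 = 1 := by simp [tFact]
  simp [tBinom, h0, this]

theorem tBinom_succ {t : ℝ} (ht : 0 < t) (a c : ℕ) :
    tBinom t (a + 1) (c + 1) = tBinom t a (c + 1) + t ^ (a + 1) * tBinom t (a + 1) c := by
  have h1 := (tFact_pos ht a).ne'
  have h2 := (tFact_pos ht c).ne'
  have h3 := (tNum_succ_pos ht a).ne'
  have h4 := (tNum_succ_pos ht c).ne'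
  have e1 : a + 1 + (c + 1) = (a + c + 1) + 1 := by ring
  have e2 : a + (c + 1) = a + c + 1 := by ring
  have e3 : a + 1 + c = a + c + 1 := by ring
  have e4 : tNum t (a + c + 1 + 1) = tNum t (a + 1) + t ^ (a + 1) * tNum t (c + 1) := by
    rw [← tNum_add]; congr 1; ring
  simp only [tBinom, e1, e2, e3, tFact_succ t (a + c + 1), tFact_succ t a, tFact_succ t c, e4]
  field_simp

theorem tBinom_mul_le {t : ℝ} (ht : 0 < t) (a c : ℕ) : ∀ b d : ℕ,
    tBinom t a c * tBinom t b d * t ^ (a * d) ≤ tBinom t (a + b) (c + d)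
  | 0, 0 => by simp [tBinom_zero_left ht]
  | b + 1, 0 => by
    have ih := tBinom_mul_le ht a c b 0
    simp only [tBinom_zero_right ht, mul_zero, pow_zero, mul_one, add_zero] at ih ⊢
    refine ih.trans ?_
    cases c with
    | zero => simp [tBinom_zero_right ht]
    | succ c =>
      rw [← add_assoc, tBinom_succ ht]
      have := tBinom_pos ht (a + b + 1) c
      have : 0 ≤ t ^ (a + b + 1) * tBinom t (a + b + 1) c := by positivity
      linarith
  | 0, d + 1 => by
    have ih := tBinom_mul_le ht a c 0 d
    simp only [tBinom_zero_left ht, mul_one, add_zero] at ih ⊢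
    cases a with
    | zero => simp [tBinom_zero_left ht]
    | succ a =>
      rw [← add_assoc, tBinom_succ ht]
      have h := tBinom_pos ht a (c + d + 1)
      calc tBinom t (a + 1) c * t ^ ((a + 1) * (d + 1))
          = t ^ (a + 1) * (tBinom t (a + 1) c * t ^ ((a + 1) * d)) := by ring
        _ ≤ t ^ (a + 1) * tBinom t (a + 1) (c + d) := by gcongr
        _ ≤ _ := by linarith
  | b + 1, d + 1 => by
    have h1 := tBinom_mul_le ht a c b (d + 1)
    have h2 := tBinom_mul_le ht a c (b + 1) d
    rw [← add_assoc, ← add_assoc, tBinom_succ ht, tBinom_succ ht]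
    rw [← add_assoc] at h1 h2
    calc _ = tBinom t a c * tBinom t b (d + 1) * t ^ (a * (d + 1))
          + t ^ (a + b + 1) * (tBinom t a c * tBinom t (b + 1) d * t ^ (a * d)) := by ring
      _ ≤ _ := by gcongr

/-- `[k]_t! / [|k|]_t!`, where `[k]_t! = [k_1]_t! ⋯ [k_n]_t!`. -/
noncomputable def factRatio (t : ℝ) (k : Fin n → ℕ) : ℝ :=
  (∏ j, tFact t (k j)) / tFact t (∑ j, k j)

theorem factRatio_pos {t : ℝ} (ht : 0 < t) (k : Fin n → ℕ) : 0 < factRatio t k :=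
  div_pos (Finset.prod_pos fun _ _ => tFact_pos ht _) (tFact_pos ht _)

theorem factRatio_mul {t : ℝ} (ht : 0 < t) : ∀ {n : ℕ} (k l : Fin n → ℕ),
    t ^ cross k l * factRatio t (k + l) ≤ factRatio t k * factRatio t l
  | 0, k, l => by simp [factRatio, cross, tFact]
  | n + 1, k, l => by
    have ih := factRatio_mul ht (fun j : Fin n => k j.castSucc) (fun j : Fin n => l j.castSucc)
    have key : ∀ k : Fin (n + 1) → ℕ, factRatio t k * tBinom t (k (Fin.last n))
        (∑ j : Fin n, k j.castSucc) = factRatio t fun j : Fin n => k j.castSucc := by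
      intro k
      have h1 := (tFact_pos ht (∑ j : Fin n, k j.castSucc)).ne'
      have h2 := (tFact_pos ht (k (Fin.last n))).ne'
      have h3 := (tFact_pos ht (k (Fin.last n) + ∑ j : Fin n, k j.castSucc)).ne'
      simp only [factRatio, tBinom, Fin.prod_univ_castSucc, Fin.sum_univ_castSucc]
      rw [add_comm (∑ j : Fin n, k j.castSucc)]
      field_simp
    have hc : cross k l = cross (fun j : Fin n => k j.castSucc) (fun j : Fin n => l j.castSucc)
        + k (Fin.last n) * ∑ j : Fin n, l j.castSucc := by
      simp only [cross, Fin.sum_univ_castSucc]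
      congr 1
      · refine Finset.sum_congr rfl fun j _ => ?_
        simp [not_lt.2 (Fin.castSucc_lt_last j).le]
      · simp [Fin.castSucc_lt_last, Finset.mul_sum]
    have hb := tBinom_mul_le ht (k (Fin.last n)) (∑ j : Fin n, k j.castSucc)
      (l (Fin.last n)) (∑ j : Fin n, l j.castSucc)
    have hkl := key (k + l)
    have hs : ∑ j : Fin n, (k + l) j.castSucc
        = (∑ j : Fin n, k j.castSucc) + ∑ j : Fin n, l j.castSucc := by
      simp [Finset.sum_add_distrib]
    rw [hs] at hkl
    have hB := tBinom_pos ht (k (Fin.last n) + l (Fin.last n))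
      ((∑ j : Fin n, k j.castSucc) + ∑ j : Fin n, l j.castSucc)
    have hk := factRatio_pos ht k
    have hl := factRatio_pos ht l
    refine le_of_mul_le_mul_right ?_ hB
    calc _ = t ^ (k (Fin.last n) * ∑ j : Fin n, l j.castSucc)
          * (t ^ cross (fun j : Fin n => k j.castSucc) (fun j : Fin n => l j.castSucc)
            * factRatio t (fun j : Fin n => (k + l) j.castSucc)) := by
          rw [← hkl, hc, pow_add, Pi.add_apply]; ring
      _ ≤ t ^ (k (Fin.last n) * ∑ j : Fin n, l j.castSucc)
          * (factRatio t (fun j : Fin n => k j.castSucc)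
            * factRatio t (fun j : Fin n => l j.castSucc)) := mul_le_mul_of_nonneg_left ih (by positivity)
      _ = factRatio t k * factRatio t l * (tBinom t (k (Fin.last n)) (∑ j : Fin n, k j.castSucc)
          * tBinom t (l (Fin.last n)) (∑ j : Fin n, l j.castSucc)
          * t ^ (k (Fin.last n) * ∑ j : Fin n, l j.castSucc)) := by
          rw [← key k, ← key l]; ring
      _ ≤ _ := by gcongr

/-- The weight of the quantum ball: the square root of `[k]_t! / [|k|]_t!` with `t = |q|^{-2}`. -/
noncomputable def ballWeight (q : CStar) (k : Fin n →₀ ℕ) : ℝ :=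
  Real.sqrt (factRatio ((‖(q : ℂ)‖ ^ 2)⁻¹) k)

theorem ballWeight_mul (q : CStar) (k l : Fin n →₀ ℕ) :
    (‖(q : ℂ)‖⁻¹) ^ cross k l * ballWeight q (k + l) ≤ ballWeight q k * ballWeight q l := by
  have hq : 0 < ‖(q : ℂ)‖ := norm_pos_iff.2 q.2
  have ht : 0 < (‖(q : ℂ)‖ ^ 2)⁻¹ := by positivity
  have h : (‖(q : ℂ)‖⁻¹) ^ cross k l = Real.sqrt (((‖(q : ℂ)‖ ^ 2)⁻¹) ^ cross k l) := by
    rw [Eq.comm, Real.sqrt_eq_iff_mul_self_eq (by positivity) (by positivity), ← mul_pow]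
    congr 1
    ring
  rw [ballWeight, ballWeight, ballWeight, h, ← Real.sqrt_mul (by positivity),
    ← Real.sqrt_mul (factRatio_pos ht k).le]
  exact Real.sqrt_le_sqrt (factRatio_mul ht k l)

end QSeries

/-- The numbers `ρ ∈ (0, r)`. -/
abbrev Radii (r : ℝ≥0∞) : Type := {ρ : ℝ // 0 < ρ ∧ ENNReal.ofReal ρ < r}

/-- The algebra of holomorphic functions on the quantum polydisk. -/
abbrev QPolydisk (q : CStar) (n : ℕ) (r : ℝ≥0∞) : Type :=
  ExtSeminorm.FiniteAlg fun ρ : Radii r =>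
    QSeries.weightNorm (n := n) q (QSeries.polydiskWeight q) (QSeries.polydiskWeight_nonneg q)
      (QSeries.polydiskWeight_mul q) ρ ρ.2.1

/-- The algebra of holomorphic functions on the quantum ball. -/
abbrev QBall (q : CStar) (n : ℕ) (r : ℝ≥0∞) : Type :=
  ExtSeminorm.FiniteAlg fun ρ : Radii r =>
    QSeries.weightNorm (n := n) q (QSeries.ballWeight q) (fun _ => Real.sqrt_nonneg _)
      (QSeries.ballWeight_mul q) ρ ρ.2.1

/-- The algebra of holomorphic functions on the free polydisk, topologized by the norms
`‖·‖_{ρ,τ}` for `ρ ∈ (0, r)` and `τ ≥ 1`. -/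
abbrev FreePolydisk (n : ℕ) (r : ℝ≥0∞) : Type :=
  ExtSeminorm.FiniteAlg fun i : Radii r × {τ : ℝ // 1 ≤ τ} =>
    FreeSeries.polydiskNorm (n := n) i.1 i.2 i.1.2.1 i.2.2

/-- The algebra of holomorphic functions on the free ball. -/
abbrev FreeBall (n : ℕ) (r : ℝ≥0∞) : Type :=
  ExtSeminorm.FiniteAlg fun ρ : Radii r => FreeSeries.ballNorm (n := n) ρ ρ.2.1

theorem FreeSeries.polydiskNorm_word_lt_top {n : ℕ} (ρ τ : ℝ) (hρ : 0 < ρ) (hτ : 1 ≤ τ)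
    (w : List (Fin n)) : (polydiskNorm ρ τ hρ hτ).toFun (word w) < ⊤ := by
  change ∑' v, ‖(word w).coeff v‖ₑ * ENNReal.ofReal (ρ ^ v.length * τ ^ blocks v) < ⊤
  rw [tsum_eq_single w]
  · exact ENNReal.mul_lt_top (by simp) ENNReal.ofReal_lt_top
  · intro v hv
    have : (word w).coeff v = 0 := if_neg hv
    simp [this]

theorem FreeSeries.ballNorm_word_lt_top {n : ℕ} (ρ : ℝ) (hρ : 0 < ρ)
    (w : List (Fin n)) : (ballNorm ρ hρ).toFun (word w) < ⊤ := by
  have h1 : ∀ v : List (Fin n), v ≠ w → (word w).coeff v = 0 := fun v hv => if_neg hv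
  change ∑' k : Fin n →₀ ℕ,
    (∑' v : {v : List (Fin n) // content v = k}, ‖(word w).coeff v‖ₑ ^ 2) ^ (1 / 2 : ℝ)
      * ENNReal.ofReal (ρ ^ ∑ j, k j) < ⊤
  rw [tsum_eq_single (content w)]
  · refine ENNReal.mul_lt_top ?_ ENNReal.ofReal_lt_top
    refine ENNReal.rpow_lt_top_of_nonneg (by norm_num) ?_
    rw [tsum_eq_single ⟨w, rfl⟩]
    · simp
    · rintro ⟨v, hv⟩ hne
      simp [h1 v fun h => hne (Subtype.ext h)]
  · intro k hk
    have : ∀ v : {v : List (Fin n) // content v = k}, (word w).coeff v = 0 := by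
      rintro ⟨v, rfl⟩
      refine h1 v ?_
      rintro rfl
      exact hk rfl
    simp [this]

/-- The generators `ζ_i` of the algebra of holomorphic functions on the free polydisk. -/
noncomputable def freePolydiskGen (n : ℕ) (r : ℝ≥0∞) (i : Fin n) : FreePolydisk n r :=
  (⟨FreeSeries.word [i], fun _ => FreeSeries.polydiskNorm_word_lt_top _ _ _ _ _⟩ :
    ExtSeminorm.finiteSubalgebra _)

/-- The generators `ζ_i` of the algebra of holomorphic functions on the free ball. -/
noncomputable def freeBallGen (n : ℕ) (r : ℝ≥0∞) (i : Fin n) : FreeBall n r :=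
  (⟨FreeSeries.word [i], fun _ => FreeSeries.ballNorm_word_lt_top _ _ _⟩ :
    ExtSeminorm.finiteSubalgebra _)

/-! ### Fréchet algebras and quotients -/

/-- A Fréchet algebra: a complete metrizable locally convex algebra with jointly continuous
multiplication. -/
structure IsFrechetAlgebra (A : Type) [Ring A] [Algebra ℂ A] [TopologicalSpace A] : Prop where
  isTopologicalRing : IsTopologicalRing A
  continuousSMul : ContinuousSMul ℂ A
  locallyConvex : LocallyConvexSpace ℝ A
  metrizable : TopologicalSpace.MetrizableSpace A
  complete : @CompleteSpace A (IsTopologicalAddGroup.rightUniformSpace A)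

section Quotient
variable {R : Type} [Ring R] [Algebra ℂ R] [TopologicalSpace R] [IsTopologicalRing R]

/-- The closed two-sided ideal generated by a set. -/
def closedIdeal (S : Set R) : Ideal R := (TwoSidedIdeal.span S).asIdeal.closure

instance (S : Set R) : (closedIdeal S).IsTwoSided where
  mul_mem_of_left b ha :=
    map_mem_closure (f := fun x => x * b) (continuous_mul_const b) ha
      fun _ hx => (TwoSidedIdeal.span S).asIdeal.mul_mem_right b hx

/-- The quotient of a topological algebra by the closed two-sided ideal generated by `S`,
with the quotient topology. -/
def QuotAlg (S : Set R) : Type := R ⧸ closedIdeal S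

namespace QuotAlg
variable (S : Set R)

noncomputable instance : Ring (QuotAlg S) := inferInstanceAs (Ring (R ⧸ closedIdeal S))
noncomputable instance : Algebra ℂ (QuotAlg S) := inferInstanceAs (Algebra ℂ (R ⧸ closedIdeal S))

/-- The quotient map. -/
noncomputable def mk : R →ₐ[ℂ] QuotAlg S := Ideal.Quotient.mkₐ ℂ (closedIdeal S)

theorem mk_surjective : Function.Surjective (mk S) := Ideal.Quotient.mk_surjective

noncomputable instance : TopologicalSpace (QuotAlg S) := .coinduced (mk S) inferInstance

theorem isOpenQuotientMap_mk : IsOpenQuotientMap (mk S) :=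
  QuotientAddGroup.isOpenQuotientMap_mk (N := (closedIdeal S).toAddSubgroup)

instance : IsTopologicalRing (QuotAlg S) := by
  have h := isOpenQuotientMap_mk S
  have h2 := (h.prodMap h).isQuotientMap
  have ha : ContinuousAdd (QuotAlg S) := ⟨by
    refine h2.continuous_iff.2 ?_
    have : (fun p : QuotAlg S × QuotAlg S => p.1 + p.2) ∘ Prod.map (mk S) (mk S)
        = fun p : R × R => mk S (p.1 + p.2) := by ext p; simp
    rw [this]
    exact h.continuous.comp continuous_add⟩
  have hm : ContinuousMul (QuotAlg S) := ⟨by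
    refine h2.continuous_iff.2 ?_
    have : (fun p : QuotAlg S × QuotAlg S => p.1 * p.2) ∘ Prod.map (mk S) (mk S)
        = fun p : R × R => mk S (p.1 * p.2) := by ext p; simp
    rw [this]
    exact h.continuous.comp continuous_mul⟩
  have hn : ContinuousNeg (QuotAlg S) := ⟨by
    refine h.isQuotientMap.continuous_iff.2 ?_
    have : (fun p : QuotAlg S => -p) ∘ (mk S) = fun p : R => mk S (-p) := by ext p; simp
    rw [this]
    exact h.continuous.comp continuous_neg⟩
  exact { ha, hm, hn with }

/-- The quotient seminorm `‖u‖ = inf {s(a) : a ↦ u}`. -/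
noncomputable def seminorm (s : Seminorm ℂ R) : Seminorm ℂ (QuotAlg S) :=
  have hbdd : ∀ u, BddBelow (s '' {a | mk S a = u}) := fun u =>
    ⟨0, by rintro _ ⟨a, _, rfl⟩; exact apply_nonneg s a⟩
  have hlt : ∀ u (ε : ℝ), 0 < ε → ∃ a, mk S a = u ∧ s a < sInf (s '' {a | mk S a = u}) + ε := by
    intro u ε hε
    obtain ⟨a, ha⟩ := mk_surjective S u
    obtain ⟨_, ⟨b, hb, rfl⟩, h⟩ := exists_lt_of_csInf_lt
      (s := s '' {a | mk S a = u}) ⟨_, a, ha, rfl⟩ (lt_add_of_pos_right _ hε)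
    exact ⟨b, hb, h⟩
  Seminorm.ofSMulLE (fun u => sInf (s '' {a | mk S a = u}))
    (le_antisymm (csInf_le (hbdd 0) ⟨0, map_zero _, map_zero s⟩)
      (le_csInf ⟨_, 0, map_zero (mk S), rfl⟩ (by rintro _ ⟨a, _, rfl⟩; exact apply_nonneg s a)))
    (fun u v => by
      refine le_of_forall_pos_le_add fun ε hε => ?_
      obtain ⟨a, ha, ha'⟩ := hlt u (ε / 2) (half_pos hε)
      obtain ⟨b, hb, hb'⟩ := hlt v (ε / 2) (half_pos hε)
      have h1 := csInf_le (hbdd (u + v)) ⟨a + b, by simp [ha, hb], rfl⟩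
      have h2 := map_add_le_add s a b
      linarith)
    (fun c u => by
      have : ∀ ε : ℝ, 0 < ε → sInf (s '' {a | mk S a = c • u})
          ≤ ‖c‖ * (sInf (s '' {a | mk S a = u}) + ε) := by
        intro ε hε
        obtain ⟨a, ha, ha'⟩ := hlt u ε hε
        have h1 := csInf_le (hbdd (c • u)) ⟨c • a, by simp [ha], rfl⟩
        rw [map_smul_eq_mul] at h1
        exact h1.trans (mul_le_mul_of_nonneg_left ha'.le (norm_nonneg c))
      have ht : Filter.Tendsto
          (fun ε : ℝ => ‖c‖ * (sInf (s '' {a | mk S a = u}) + ε)) (nhdsWithin 0 (Set.Ioi 0))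
          (nhds (‖c‖ * (sInf (s '' {a | mk S a = u}) + 0))) :=
        (Continuous.tendsto (by fun_prop) 0).mono_left nhdsWithin_le_nhds
      rw [add_zero] at ht
      exact ge_of_tendsto ht (Filter.mem_of_superset self_mem_nhdsWithin this))

theorem seminorm_apply (s : Seminorm ℂ R) (u : QuotAlg S) :
    seminorm S s u = sInf (s '' {a | mk S a = u}) := rfl

end QuotAlg
end Quotient

/-! ### Algebras of holomorphic functions on the punctured plane -/

section Holomorphic
variable (A : Type) [Ring A] [Algebra ℂ A] [TopologicalSpace A] [IsTopologicalRing A]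
  [ContinuousSMul ℂ A]

/-- `f` has complex derivative `d` at the point `z` of the punctured plane. -/
def HasDerivOn {A : Type} [Ring A] [Algebra ℂ A] [TopologicalSpace A] (f : CStar → A) (d : A)
    (z : CStar) : Prop :=
  Filter.Tendsto (fun w : CStar => ((w : ℂ) - z)⁻¹ • (f w - f z)) (nhdsWithin z {z}ᶜ) (nhds d)

instance : LocallyCompactSpace CStar :=
  (isOpen_compl_singleton (x := (0 : ℂ))).isOpenEmbedding_subtypeVal.locallyCompactSpace

/-- The subalgebra of holomorphic functions among the continuous functions `ℂ^× → A`. -/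
noncomputable def holSubalgebra : Subalgebra ℂ C(CStar, A) where
  carrier := {f | ∀ z, ∃ d, HasDerivOn f d z}
  add_mem' {f g} hf hg z := by
    obtain ⟨d, hd⟩ := hf z
    obtain ⟨e, he⟩ := hg z
    refine ⟨d + e, (hd.add he).congr fun w => ?_⟩
    rw [← smul_add]; congr 1
    simp only [ContinuousMap.add_apply]; abel
  mul_mem' {f g} hf hg z := by
    obtain ⟨d, hd⟩ := hf z
    obtain ⟨e, he⟩ := hg z
    have hc : Filter.Tendsto f (nhdsWithin z {z}ᶜ) (nhds (f z)) :=
      (f.continuous.tendsto z).mono_left nhdsWithin_le_nhds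
    refine ⟨d * g z + f z * e, ((hd.mul_const (g z)).add (hc.mul he)).congr fun w => ?_⟩
    rw [smul_mul_assoc, mul_smul_comm, ← smul_add]; congr 1
    simp only [ContinuousMap.mul_apply]; noncomm_ring
  algebraMap_mem' c z := by
    refine ⟨0, tendsto_const_nhds.congr fun w => ?_⟩
    simp [Algebra.algebraMap_eq_smul_one]

/-- The algebra `O(ℂ^×, A)` of holomorphic `A`-valued functions, with the topology of uniform
convergence on compact sets (the compact-open topology). -/
abbrev Hol : Type := holSubalgebra A

instance : IsTopologicalRing (Hol A) where
  continuous_neg := Continuous.subtype_mk (continuous_neg.comp continuous_subtype_val) _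

variable {A}

theorem hasDerivOn_const (a : A) (z : CStar) : HasDerivOn (fun _ => a) 0 z := by
  have h : (fun w : CStar => ((w : ℂ) - z)⁻¹ • (a - a)) = fun _ => (0 : A) := by
    funext w
    rw [sub_self, smul_zero]
  rw [HasDerivOn, h]
  exact tendsto_const_nhds

/-- The constant function. -/
noncomputable def Hol.const (a : A) : Hol A :=
  ⟨ContinuousMap.const _ a, fun z => ⟨0, hasDerivOn_const a z⟩⟩

/-- The coordinate `z` in `O(ℂ^×)`. -/
noncomputable def Hol.coord : Hol ℂ :=
  ⟨⟨fun z => (z : ℂ), continuous_subtype_val⟩, fun z => ⟨1, tendsto_const_nhds.congr' (by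
    filter_upwards [self_mem_nhdsWithin] with w hw
    have : (w : ℂ) - z ≠ 0 := sub_ne_zero.2 fun h => hw (Subtype.ext h)
    simp [this])⟩⟩

variable (A) in
/-- The canonical homomorphism `O(ℂ^×) → O(ℂ^×, A)`, which sends `f` to `z ↦ f(z) 1`. -/
noncomputable def Hol.scalar : Hol ℂ →ₐ[ℂ] Hol A where
  toFun f := ⟨⟨fun z => (f : C(CStar, ℂ)) z • (1 : A), by fun_prop⟩, fun z => by
    obtain ⟨d, hd⟩ := f.2 z
    refine ⟨d • (1 : A), (hd.smul_const (1 : A)).congr fun w => ?_⟩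
    simp [← sub_smul, smul_smul]⟩
  map_one' := by ext z; simp
  map_mul' f g := by
    ext z
    change ((f : C(CStar, ℂ)) z * (g : C(CStar, ℂ)) z) • (1 : A)
      = ((f : C(CStar, ℂ)) z • (1 : A)) * ((g : C(CStar, ℂ)) z • (1 : A))
    rw [smul_mul_assoc, one_mul, smul_smul]
  map_zero' := by ext z; simp
  map_add' f g := by ext z; simp [add_smul]
  commutes' c := by
    ext z; simp [Algebra.algebraMap_eq_smul_one]

/-- The relations `x_i x_j - z x_j x_i` for `i < j` in `O(ℂ^×, A)`. -/
def qRelations {n : ℕ} (x : Fin n → A) : Set (Hol A) :=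
  {a | ∃ i j, i < j ∧ a = Hol.const (x i) * Hol.const (x j)
    - Hol.scalar A Hol.coord * (Hol.const (x j) * Hol.const (x i))}

/-- The deformation algebra: the quotient of `O(ℂ^×, A)` by the closed two-sided ideal generated
by the elements `x_i x_j - z x_j x_i` for `i < j`. -/
abbrev DefAlg {n : ℕ} (x : Fin n → A) : Type := QuotAlg (qRelations x)

/-- The canonical homomorphism from `O(ℂ^×)` to the deformation algebra. -/
noncomputable def defScalar {n : ℕ} (x : Fin n → A) : Hol ℂ →ₐ[ℂ] DefAlg x :=
  (QuotAlg.mk (qRelations x)).comp (Hol.scalar A)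

end Holomorphic

/-- `φ` makes `R` a Fréchet `O(ℂ^×)`-algebra: `R` is a Fréchet algebra, and `φ` is a continuous
homomorphism from `O(ℂ^×)` to the center of `R`. -/
structure IsFrechetHolAlgebra {R : Type} [Ring R] [Algebra ℂ R] [TopologicalSpace R]
    (φ : Hol ℂ →ₐ[ℂ] R) : Prop where
  isFrechetAlgebra : IsFrechetAlgebra R
  continuous : Continuous φ
  central : ∀ f, φ f ∈ Subalgebra.center ℂ R

/-! ### Bundles -/

/-- The total space `E` of a family of sets over `X`. -/
@[ext] structure TotalSp {X : Type} (Fib : X → Type) : Type where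
  /-- The projection `p : E → X`. -/
  base : X
  /-- The point of the fiber. -/
  val : Fib base

/-- The fibered square `E ×_X E`. -/
@[ext] structure FibSq {X : Type} (Fib : X → Type) : Type where
  /-- The common base point. -/
  base : X
  /-- The first component. -/
  fst : Fib base
  /-- The second component. -/
  snd : Fib base

/-- The inclusion of `E ×_X E` into `E × E`. -/
def FibSq.toProd {X : Type} {Fib : X → Type} (u : FibSq Fib) : TotalSp Fib × TotalSp Fib :=
  (⟨u.base, u.fst⟩, ⟨u.base, u.snd⟩)

/-- A family of complex algebras over `X`, with a topology on its total space and with a family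
of seminorms on its total space, which stands for the equivalence class that it represents. -/
structure AlgFamily (X : Type) where
  /-- The fibers. -/
  Fib : X → Type
  [ring : ∀ x, Ring (Fib x)]
  [algebra : ∀ x, Algebra ℂ (Fib x)]
  /-- The topology of the total space. -/
  [topology : TopologicalSpace (TotalSp Fib)]
  /-- The index set of the family of seminorms. -/
  Λ : Type
  /-- The seminorms. -/
  norm : Λ → ∀ x, Seminorm ℂ (Fib x)

namespace AlgFamily
attribute [instance] AlgFamily.ring AlgFamily.algebra AlgFamily.topology

variable {X : Type} [TopologicalSpace X] (E : AlgFamily X)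

/-- The topology on a fiber, as a subspace of the total space. -/
instance (x : X) : TopologicalSpace (E.Fib x) :=
  .induced (fun u : E.Fib x => (⟨x, u⟩ : TotalSp E.Fib)) inferInstance

/-- `E ×_X E` is a subspace of `E × E`. -/
instance : TopologicalSpace (FibSq E.Fib) := .induced FibSq.toProd inferInstance

/-- A prebundle of topological vector spaces. -/
structure IsPrebundle : Prop where
  continuous_base : Continuous (TotalSp.base : TotalSp E.Fib → X)
  isOpenMap_base : IsOpenMap (TotalSp.base : TotalSp E.Fib → X)
  continuous_zero : Continuous fun x : X => (⟨x, 0⟩ : TotalSp E.Fib)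
  continuous_add : Continuous fun u : FibSq E.Fib => (⟨u.base, u.fst + u.snd⟩ : TotalSp E.Fib)
  continuous_smul :
    Continuous fun u : ℂ × TotalSp E.Fib => (⟨u.2.base, u.1 • u.2.val⟩ : TotalSp E.Fib)

/-- A directed family of seminorms. -/
def IsDirectedFamily : Prop :=
  ∀ l m : E.Λ, ∃ (C : ℝ) (k : E.Λ), 0 < C ∧
    ∀ x (u : E.Fib x), E.norm l x u ≤ C * E.norm k x u ∧ E.norm m x u ≤ C * E.norm k x u

/-- The set `{u : p(u) ∈ U, ‖u‖_l < ε}`. -/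
def tube (l : E.Λ) (ε : ℝ) (U : Set X) : Set (TotalSp E.Fib) :=
  {u | u.base ∈ U ∧ E.norm l u.base u.val < ε}

/-- An admissible family of seminorms: for each `x` the sets `{u : p(u) ∈ U, ‖u‖_l < ε}`, where
`U` is an open neighborhood of `x`, form a base of open neighborhoods of the zero of `E_x`. -/
def IsAdmissible : Prop :=
  ∀ x : X,
    (∀ l ε U, 0 < ε → IsOpen U → x ∈ U → IsOpen (E.tube l ε U)) ∧
    (nhds (⟨x, 0⟩ : TotalSp E.Fib)).HasBasis
      (fun i : E.Λ × ℝ × Set X => 0 < i.2.1 ∧ IsOpen i.2.2 ∧ x ∈ i.2.2)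
      (fun i => E.tube i.1 i.2.1 i.2.2)

/-- A locally convex bundle. -/
structure IsLocallyConvexBundle : Prop extends E.IsPrebundle where
  directed : E.IsDirectedFamily
  admissible : E.IsAdmissible

/-- A locally convex algebra bundle. -/
structure IsLocallyConvexAlgebraBundle : Prop extends E.IsLocallyConvexBundle where
  continuous_mul : Continuous fun u : FibSq E.Fib => (⟨u.base, u.fst * u.snd⟩ : TotalSp E.Fib)

/-- A Fréchet algebra bundle. -/
structure IsFrechetAlgebraBundle : Prop extends E.IsLocallyConvexAlgebraBundle where
  isFrechetAlgebra : ∀ x, IsFrechetAlgebra (E.Fib x)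

end AlgFamily

section CanonicalBundle
variable {R : Type} [Ring R] [Algebra ℂ R] [TopologicalSpace R] [IsTopologicalRing R]
  (φ : Hol ℂ →ₐ[ℂ] R)

/-- The image in `R` of the ideal `M_q = {f : f(q) = 0}` of `O(ℂ^×)`. -/
def vanishing (q : CStar) : Set R := φ '' {f | (f : C(CStar, ℂ)) q = 0}

/-- The fiber `R_q` of a Fréchet `O(ℂ^×)`-algebra `R` over `q`: the quotient of `R` by the closure
of `M_q R`, which is the closed two-sided ideal generated by `M_q`. -/
abbrev AlgFiber (q : CStar) : Type := QuotAlg (vanishing φ q)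

/-- The bundle of the fibers of a Fréchet `O(ℂ^×)`-algebra `R`. The seminorms are the fiberwise
quotients of the continuous seminorms on `R`. The topology is generated by the tubes
`{u : p(u) ∈ V, ‖u - a_{p(u)}‖_s < ε}` around the sections `q ↦ a_q`, where `a ∈ R`. -/
noncomputable def canonicalBundle : AlgFamily CStar where
  Fib := AlgFiber φ
  topology := TopologicalSpace.generateFrom
    {W | ∃ (s : Seminorm ℂ R) (a : R) (V : Set CStar) (ε : ℝ), Continuous s ∧ IsOpen V ∧
      W = {u | u.base ∈ V ∧
        QuotAlg.seminorm (vanishing φ u.base) s (u.val - QuotAlg.mk _ a) < ε}}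
  Λ := {s : Seminorm ℂ R // Continuous s}
  norm s q := QuotAlg.seminorm (vanishing φ q) s

end CanonicalBundle

/-!
All the algebras in question carry a topology defined by an increasing sequence of submultiplicative
seminorms (`IsDefiningSeq`). This description passes to quotients by closed ideals and from `A` to
the algebra of holomorphic functions on `ℂ^×` with values in `A`, and so does completeness. For
holomorphic functions, differentiability is tested in the Banach completion of each defining
seminorm, where the classical theorem on locally uniform limits applies. Hence the deformation
algebras are Fréchet algebras.

The bundle. For every `a` in a Fréchet algebra `R` over the holomorphic functions on `ℂ^×` and every
continuous seminorm `s`, the function `q' ↦ ‖a_{q'}‖_s` is upper semicontinuous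
(`CanonicalBundle.eventually_fiberNorm_lt`): if `a` is close to zero over `q`, then it is the sum of
a small element and an element `d` of the ideal generated by the functions vanishing at `q`, and the
norm of `d_{q'}` tends to zero as `q'` tends to `q`. It follows that the tubes around one section
`a` form neighborhood bases at the points `a_q`, which gives the continuity of all operations
(`CanonicalBundle.isFrechetAlgebraBundle`).

The fibers. A holomorphic function `f` which vanishes at `q` is divisible by `z - q`, so that in the
fiber over `q` every `f` coincides with the constant `f(q)`: the fiber is a quotient of the algebra
of free series by the relations `ζ_i ζ_j = q ζ_j ζ_i`. The homomorphism `π` from free series to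
quantum series sends a word `ζ_w` to `q^{-inv w} x^k`, where `inv w` is the number of inversions and
`k` is the content of `w`. If `π` is bounded and has a bounded linear section `σ` of the form
`x^k ↦ ∑ s_w ζ_w`, the sum being over the words of content `k`, then `π` induces the required
isomorphism (`fiberEquivOfSection`, `FreeSeries.IsCoefficientFamily.nonempty_fib_equiv`): permuting
the letters of a word multiplies its image in the fiber by a power of `q`, hence `a` and `σ (π a)`
have the same image in the fiber if `a` is a polynomial, and polynomials are dense.

For the polydisk, `σ` sends `x^k` to a multiple of a single ordered word, with ascending letters if
`|q| ≥ 1` and descending letters if `|q| < 1`; such a word has at most `n` blocks. For the ball, the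
coefficients `s_w` of the words of content `k` form the vector of minimal `ℓ²` norm for which `σ` is
a section. Its norm is computed by MacMahon's theorem that `∑ t^{inv w}`, over the words of content
`k`, is the `t`-multinomial coefficient (`FreeSeries.sum_pow_inversions`), here with `t = |q|^{-2}`,
and the boundedness of `π` is the Cauchy–Schwarz inequality.
-/

open Filter Topology UniformConvergence

/-! ### Algebras topologized by a sequence of submultiplicative seminorms -/

/-- The topology of `R` is defined by the increasing sequence `p` of submultiplicative seminorms:
the open `p k`-balls around zero form a base of neighborhoods of zero. -/
structure IsDefiningSeq {R : Type} [Ring R] [Algebra ℂ R] [TopologicalSpace R]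
    (p : ℕ → Seminorm ℂ R) : Prop where
  mono : Monotone p
  mul_le : ∀ k a b, p k (a * b) ≤ p k a * p k b
  hasBasis : (𝓝 (0 : R)).HasBasis (fun i : ℕ × ℝ => 0 < i.2) (fun i => {a | p i.1 a < i.2})

namespace IsDefiningSeq

theorem exists_finset_sup_le {E : Type} [AddCommGroup E] [Module ℂ E] {p : ℕ → Seminorm ℂ E}
    (hp : Monotone p) (s : Finset ℕ) : ∃ k, s.sup p ≤ p k := by
  obtain ⟨k, hk⟩ := s.exists_le
  exact ⟨k, Finset.sup_le fun i hi => hp (hk i hi)⟩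

section
variable {R : Type} [Ring R] [Algebra ℂ R] [TopologicalSpace R] {p : ℕ → Seminorm ℂ R}

/-- A continuous seminorm is bounded by a multiple of a seminorm of the defining sequence. -/
theorem exists_le (h : IsDefiningSeq p) {s : Seminorm ℂ R} (hs : Continuous s) :
    ∃ (C : ℝ) (k : ℕ), 0 < C ∧ ∀ a, s a ≤ C * p k a := by
  have h1 : {a | s a < 1} ∈ 𝓝 (0 : R) :=
    (isOpen_lt hs continuous_const).mem_nhds (by simp)
  obtain ⟨⟨k, ε⟩, hε, hk⟩ := h.hasBasis.mem_iff.1 h1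
  refine ⟨2 / ε, k, by positivity, fun a => le_of_forall_pos_le_add fun δ hδ => ?_⟩
  -- rescale `a` into the ball of radius `ε`
  have hpos : 0 < p k a + δ * ε / 2 := by positivity
  have hc : 0 < ε / 2 / (p k a + δ * ε / 2) := by positivity
  have hmem : ((ε / 2 / (p k a + δ * ε / 2) : ℝ) : ℂ) • a ∈ {a | p k a < ε} := by
    have h2 : p k a ≤ p k a + δ * ε / 2 := by linarith [show 0 < δ * ε / 2 by positivity]
    simp only [Set.mem_ofPred_eq, map_smul_eq_mul, Complex.norm_real, Real.norm_of_nonneg hc.le]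
    calc ε / 2 / (p k a + δ * ε / 2) * p k a
        ≤ ε / 2 / (p k a + δ * ε / 2) * (p k a + δ * ε / 2) := by gcongr
      _ = ε / 2 := by field_simp
      _ < ε := by linarith
  have h3 : s (((ε / 2 / (p k a + δ * ε / 2) : ℝ) : ℂ) • a) < 1 := hk hmem
  rw [map_smul_eq_mul, Complex.norm_real, Real.norm_of_nonneg hc.le, div_mul_eq_mul_div,
    div_lt_one hpos] at h3
  calc s a = 2 / ε * (ε / 2 * s a) := by field_simp
    _ ≤ 2 / ε * (p k a + δ * ε / 2) := by gcongr
    _ = 2 / ε * p k a + δ := by field_simp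

end

variable {R : Type} [Ring R] [Algebra ℂ R] [TopologicalSpace R] [IsTopologicalRing R]
  {p : ℕ → Seminorm ℂ R}

theorem withSeminorms (h : IsDefiningSeq p) : WithSeminorms (𝕜 := ℂ) (E := R) (ι := ℕ) p := by
  refine SeminormFamily.withSeminorms_of_hasBasis _ (h.hasBasis.to_hasBasis ?_ ?_)
  · rintro ⟨k, ε⟩ hε
    refine ⟨_, SeminormFamily.basisSets_singleton_mem p k hε, ?_⟩
    intro a ha
    simpa [Seminorm.mem_ball_zero] using ha
  · intro U hU
    obtain ⟨s, ε, hε, rfl⟩ := (SeminormFamily.basisSets_iff p).1 hU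
    obtain ⟨k, hk⟩ := exists_finset_sup_le h.mono s
    exact ⟨(k, ε), hε, fun a ha => by
      simpa [Seminorm.mem_ball_zero] using (hk a).trans_lt ha⟩

theorem continuous_seminorm (h : IsDefiningSeq p) (k : ℕ) : Continuous (p k) :=
  h.withSeminorms.continuous_seminorm k

theorem nhds_hasBasis (h : IsDefiningSeq p) (x : R) :
    (𝓝 x).HasBasis (fun i : ℕ × ℝ => 0 < i.2) (fun i => {a | p i.1 (a - x) < i.2}) := by
  have h1 := h.hasBasis.comap (fun a => a - x)
  have h2 : comap (fun a => a - x) (𝓝 (0 : R)) = 𝓝 x := by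
    simpa using ((Homeomorph.subRight x).isInducing.nhds_eq_comap x).symm
  rwa [h2] at h1

theorem tendsto_iff (h : IsDefiningSeq p) {β : Type*} {F : Filter β} {u : β → R} {x : R} :
    Tendsto u F (𝓝 x) ↔ ∀ k, Tendsto (fun b => p k (u b - x)) F (𝓝 0) := by
  rw [(h.nhds_hasBasis x).tendsto_right_iff]
  constructor
  · intro H k
    refine (tendsto_order.2 ⟨fun c hc => Eventually.of_forall fun b =>
      hc.trans_le (apply_nonneg _ _), fun c hc => ?_⟩)
    exact H (k, c) hc
  · rintro H ⟨k, ε⟩ hε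
    exact (H k).eventually_lt_const hε

theorem firstCountable (h : IsDefiningSeq p) : FirstCountableTopology R :=
  h.withSeminorms.firstCountableTopology

theorem isFrechetAlgebra (h : IsDefiningSeq p) [T2Space R]
    (hc : @CompleteSpace R (IsTopologicalAddGroup.rightUniformSpace R)) : IsFrechetAlgebra R where
  isTopologicalRing := inferInstance
  continuousSMul := h.withSeminorms.continuousSMul
  locallyConvex := h.withSeminorms.toLocallyConvexSpace
  metrizable := by
    have := h.firstCountable
    let _ := IsTopologicalAddGroup.rightUniformSpace R
    have : IsUniformAddGroup R := isUniformAddGroup_of_addCommGroup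
    have := IsUniformAddGroup.uniformity_countably_generated (α := R)
    exact UniformSpace.metrizableSpace
  complete := hc

end IsDefiningSeq

/-! ### Quotients by closed two-sided ideals -/

namespace QuotAlg
variable {R : Type} [Ring R] [Algebra ℂ R] [TopologicalSpace R] [IsTopologicalRing R] (S : Set R)

theorem continuous_mk : Continuous (mk S) := (isOpenQuotientMap_mk S).continuous

theorem mk_eq_zero_iff (a : R) : mk S a = 0 ↔ a ∈ closedIdeal S :=
  Ideal.Quotient.eq_zero_iff_mem

theorem mk_eq_zero {a : R} (ha : a ∈ S) : mk S a = 0 :=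
  (mk_eq_zero_iff S a).2 (subset_closure (TwoSidedIdeal.subset_span ha))

theorem seminorm_mk_le (s : Seminorm ℂ R) (a : R) : seminorm S s (mk S a) ≤ s a :=
  csInf_le ⟨0, by rintro _ ⟨a, _, rfl⟩; exact apply_nonneg s a⟩ ⟨a, rfl, rfl⟩

theorem seminorm_lt_iff (s : Seminorm ℂ R) (u : QuotAlg S) (c : ℝ) :
    seminorm S s u < c ↔ ∃ a, mk S a = u ∧ s a < c := by
  constructor
  · intro h
    obtain ⟨a, ha⟩ := mk_surjective S u
    obtain ⟨_, ⟨b, hb, rfl⟩, h⟩ :=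
      exists_lt_of_csInf_lt (s := s '' {a | mk S a = u}) ⟨_, a, ha, rfl⟩ h
    exact ⟨b, hb, h⟩
  · rintro ⟨a, rfl, h⟩
    exact (seminorm_mk_le S s a).trans_lt h

theorem seminorm_mono {s t : Seminorm ℂ R} (h : s ≤ t) : seminorm S s ≤ seminorm S t := by
  intro u
  refine le_of_forall_gt fun c hc => ?_
  obtain ⟨a, ha, hc⟩ := (seminorm_lt_iff S t u c).1 hc
  exact (seminorm_lt_iff S s u c).2 ⟨a, ha, (h a).trans_lt hc⟩

/-- Quotient seminorms inherit an estimate of products. -/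
theorem seminorm_mul_le {s t : Seminorm ℂ R} (h : ∀ a b, s (a * b) ≤ t a * t b)
    (u v : QuotAlg S) : seminorm S s (u * v) ≤ seminorm S t u * seminorm S t v := by
  have h1 : ∀ ε : ℝ, 0 < ε →
      seminorm S s (u * v) ≤ (seminorm S t u + ε) * (seminorm S t v + ε) := by
    intro ε hε
    obtain ⟨a, rfl, hau⟩ := (seminorm_lt_iff S t u _).1 (lt_add_of_pos_right _ hε)
    obtain ⟨b, rfl, hbv⟩ := (seminorm_lt_iff S t v _).1 (lt_add_of_pos_right _ hε)
    rw [← map_mul]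
    refine (seminorm_mk_le S s _).trans ((h a b).trans ?_)
    exact mul_le_mul hau.le hbv.le (apply_nonneg _ _) ((apply_nonneg _ _).trans hau.le)
  have ht : Tendsto (fun ε : ℝ => (seminorm S t u + ε) * (seminorm S t v + ε)) (𝓝[>] 0)
      (𝓝 ((seminorm S t u + 0) * (seminorm S t v + 0))) :=
    (Continuous.tendsto (by fun_prop) 0).mono_left nhdsWithin_le_nhds
  rw [add_zero, add_zero] at ht
  exact ge_of_tendsto ht (mem_of_superset self_mem_nhdsWithin h1)

theorem isDefiningSeq {p : ℕ → Seminorm ℂ R} (hp : IsDefiningSeq p) :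
    IsDefiningSeq fun k => seminorm S (p k) where
  mono k l hkl := seminorm_mono S (hp.mono hkl)
  mul_le k := seminorm_mul_le S (hp.mul_le k)
  hasBasis := by
    have h2 : 𝓝 (0 : QuotAlg S) = map (mk S) (𝓝 0) := by
      rw [← map_zero (mk S)]
      exact ((isOpenQuotientMap_mk S).map_nhds_eq 0).symm
    rw [h2]
    refine (hp.hasBasis.map (mk S)).congr (fun _ => Iff.rfl) ?_
    rintro ⟨k, ε⟩ hε
    ext u
    simp only [Set.mem_image, Set.mem_ofPred_eq]
    rw [seminorm_lt_iff]
    exact exists_congr fun a => and_comm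

instance : T2Space (QuotAlg S) := by
  have hc : IsClosed ((closedIdeal S).toAddSubgroup : Set R) := isClosed_closure
  have : T3Space (R ⧸ (closedIdeal S).toAddSubgroup) := QuotientAddGroup.instT3Space _
  exact (inferInstance : T2Space (R ⧸ (closedIdeal S).toAddSubgroup))

theorem completeSpace {p : ℕ → Seminorm ℂ R} (hp : IsDefiningSeq p)
    (hc : @CompleteSpace R (IsTopologicalAddGroup.rightUniformSpace R)) :
    @CompleteSpace (QuotAlg S) (IsTopologicalAddGroup.rightUniformSpace (QuotAlg S)) := by
  have := hp.firstCountable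
  exact QuotientAddGroup.completeSpace_right' R (closedIdeal S).toAddSubgroup

/-- The universal property of the quotient: a continuous homomorphism which vanishes on `S` vanishes
on the closed ideal generated by `S`, because points of its target are closed. -/
noncomputable def lift {B : Type} [Ring B] [Algebra ℂ B] [TopologicalSpace B] [T1Space B]
    (f : R →A[ℂ] B) (hf : ∀ a ∈ S, f a = 0) : QuotAlg S →A[ℂ] B :=
  have hker : ∀ a ∈ closedIdeal S, (f : R →ₐ[ℂ] B) a = 0 := by
    intro a ha
    have h0 : ∀ d ∈ TwoSidedIdeal.span S, f d = 0 := fun d hd =>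
      TwoSidedIdeal.span_induction (p := fun d _ => f d = 0) hf (map_zero f)
        (fun x y _ _ hx hy => by rw [map_add, hx, hy, add_zero])
        (fun x _ hx => by rw [map_neg, hx, neg_zero])
        (fun a x _ hx => by rw [map_mul, hx, mul_zero])
        (fun a x _ hx => by rw [map_mul, hx, zero_mul]) hd
    exact closure_minimal (t := f ⁻¹' {0}) (fun d hd => h0 d hd)
      (isClosed_singleton.preimage f.cont) ha
  { Ideal.Quotient.liftₐ (closedIdeal S) (f : R →ₐ[ℂ] B) hker with
    cont := (isOpenQuotientMap_mk S).isQuotientMap.continuous_iff.2 f.cont }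

end QuotAlg

/-! ### The bundle of fibers -/

namespace CanonicalBundle
variable {R : Type} [Ring R] [Algebra ℂ R] [TopologicalSpace R] [IsTopologicalRing R]
  {φ : Hol ℂ →ₐ[ℂ] R} {p : ℕ → Seminorm ℂ R}

/-- The norm of the value at `q'` of the section defined by `a`. -/
noncomputable def fiberNorm (φ : Hol ℂ →ₐ[ℂ] R) (s : Seminorm ℂ R) (a : R) (q' : CStar) : ℝ :=
  QuotAlg.seminorm (vanishing φ q') s (QuotAlg.mk _ a)

theorem fiberNorm_nonneg (s : Seminorm ℂ R) (a : R) (q' : CStar) : 0 ≤ fiberNorm φ s a q' :=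
  apply_nonneg _ _

theorem fiberNorm_le (s : Seminorm ℂ R) (a : R) (q' : CStar) : fiberNorm φ s a q' ≤ s a :=
  QuotAlg.seminorm_mk_le _ s a

theorem fiberNorm_add_le (s : Seminorm ℂ R) (a b : R) (q' : CStar) :
    fiberNorm φ s (a + b) q' ≤ fiberNorm φ s a q' + fiberNorm φ s b q' := by
  unfold fiberNorm
  rw [map_add]
  exact map_add_le_add _ _ _

theorem fiberNorm_neg (s : Seminorm ℂ R) (a : R) (q' : CStar) :
    fiberNorm φ s (-a) q' = fiberNorm φ s a q' := by
  unfold fiberNorm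
  rw [map_neg, map_neg_eq_map]

theorem fiberNorm_mul_le (hp : IsDefiningSeq p) (k : ℕ) (a b : R) (q' : CStar) :
    fiberNorm φ (p k) (a * b) q' ≤ fiberNorm φ (p k) a q' * fiberNorm φ (p k) b q' := by
  unfold fiberNorm
  rw [map_mul]
  exact QuotAlg.seminorm_mul_le _ (hp.mul_le k) _ _

theorem fiberNorm_smul (s : Seminorm ℂ R) (c : ℂ) (a : R) (q' : CStar) :
    fiberNorm φ s (c • a) q' = ‖c‖ * fiberNorm φ s a q' := by
  unfold fiberNorm
  rw [map_smul, map_smul_eq_mul]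

theorem fiberNorm_le_mul {s t : Seminorm ℂ R} {C : ℝ} (hC : 0 < C) (h : ∀ a, s a ≤ C * t a)
    (a : R) (q' : CStar) : fiberNorm φ s a q' ≤ C * fiberNorm φ t a q' := by
  refine le_of_forall_gt fun e he => ?_
  rw [mul_comm, ← lt_div_iff₀ hC] at he
  obtain ⟨b, hb, hbe⟩ := (QuotAlg.seminorm_lt_iff _ t _ _).1 he
  refine (QuotAlg.seminorm_lt_iff _ s _ e).2 ⟨b, hb, (h b).trans_lt ?_⟩
  rwa [lt_div_iff₀ hC, mul_comm] at hbe

/-- At `q'`, the value of `φ f` is the scalar `f q'`. -/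
theorem fiberNorm_scalar_le (s : Seminorm ℂ R) (f : Hol ℂ) (q' : CStar) :
    fiberNorm φ s (φ f) q' ≤ ‖(f : C(CStar, ℂ)) q'‖ * s 1 := by
  have h : QuotAlg.mk (vanishing φ q') (φ f)
      = QuotAlg.mk (vanishing φ q') ((f : C(CStar, ℂ)) q' • 1) := by
    rw [← sub_eq_zero, ← map_sub]
    refine QuotAlg.mk_eq_zero _ ⟨f - algebraMap ℂ _ ((f : C(CStar, ℂ)) q'), ?_, ?_⟩
    · simp
    · exact (map_sub φ f _).trans (by rw [AlgHom.commutes, Algebra.algebraMap_eq_smul_one])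
  unfold fiberNorm
  rw [h, ← map_smul_eq_mul s]
  exact QuotAlg.seminorm_mk_le _ _ _

/-- Elements of the ideal generated by the functions that vanish at `q` have small values
near `q`. -/
theorem tendsto_fiberNorm_of_mem_span (hp : IsDefiningSeq p) {q : CStar} {d : R}
    (hd : d ∈ TwoSidedIdeal.span (vanishing φ q)) (k : ℕ) :
    Tendsto (fiberNorm φ (p k) d) (𝓝 q) (𝓝 0) := by
  have hsq : ∀ {f : CStar → ℝ} {d : R}, Tendsto f (𝓝 q) (𝓝 0) →
      (∀ q', fiberNorm φ (p k) d q' ≤ f q') → Tendsto (fiberNorm φ (p k) d) (𝓝 q) (𝓝 0) :=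
    fun hf h => squeeze_zero (fun _ => fiberNorm_nonneg _ _ _) h hf
  refine TwoSidedIdeal.span_induction
    (p := fun d _ => Tendsto (fiberNorm φ (p k) d) (𝓝 q) (𝓝 0)) ?_ ?_ ?_ ?_ ?_ ?_ hd
  · rintro _ ⟨f, hf, rfl⟩
    refine hsq ?_ (fiberNorm_scalar_le (p k) f)
    have h : Continuous fun q' => ‖(f : C(CStar, ℂ)) q'‖ * p k 1 := by fun_prop
    have h2 := h.tendsto q
    rwa [show (f : C(CStar, ℂ)) q = 0 from hf, norm_zero, zero_mul] at h2
  · exact hsq tendsto_const_nhds fun q' => (fiberNorm_le _ _ _).trans_eq (map_zero _)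
  · intro x y _ _ hx hy
    have h := hx.add hy
    rw [add_zero] at h
    exact hsq h (fiberNorm_add_le _ x y)
  · intro x _ hx
    exact hsq hx fun q' => (fiberNorm_neg _ x q').le
  · intro a x _ hx
    have h := hx.const_mul (p k a)
    rw [mul_zero] at h
    refine hsq h fun q' => (fiberNorm_mul_le hp k a x q').trans ?_
    exact mul_le_mul_of_nonneg_right (fiberNorm_le _ _ _) (apply_nonneg _ _)
  · intro b x _ hx
    have h := hx.mul_const (p k b)
    rw [zero_mul] at h
    refine hsq h fun q' => (fiberNorm_mul_le hp k x b q').trans ?_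
    exact mul_le_mul_of_nonneg_left (fiberNorm_le _ _ _) (apply_nonneg _ _)

/-- The norm of a section is upper semicontinuous. -/
theorem eventually_fiberNorm_lt (hp : IsDefiningSeq p) {s : Seminorm ℂ R} (hs : Continuous s)
    {a : R} {q : CStar} {c : ℝ} (h : fiberNorm φ s a q < c) :
    ∀ᶠ q' in 𝓝 q, fiberNorm φ s a q' < c := by
  obtain ⟨b, hb, hbc⟩ := (QuotAlg.seminorm_lt_iff _ s _ c).1 h
  have hmem : b - a ∈ closedIdeal (vanishing φ q) := by
    rw [← QuotAlg.mk_eq_zero_iff, map_sub, hb, sub_self]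
  have hopen : IsOpen {d : R | s (a + d) < c} :=
    isOpen_lt (hs.comp (continuous_const.add continuous_id)) continuous_const
  -- `b - a` lies only in the closure of the ideal; replace it by an element `d` of the ideal itself
  obtain ⟨d, hdc, hd⟩ := mem_closure_iff.1 hmem _ hopen (by simpa using hbc)
  obtain ⟨C, k, hC, hle⟩ := hp.exists_le hs
  have ht : Tendsto (fun q' => s (a + d) + C * fiberNorm φ (p k) d q') (𝓝 q)
      (𝓝 (s (a + d) + C * 0)) :=
    ((tendsto_fiberNorm_of_mem_span hp hd k).const_mul C).const_add _
  rw [mul_zero, add_zero] at ht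
  filter_upwards [ht.eventually_lt_const (show s (a + d) < c from hdc)] with q' hq'
  refine lt_of_le_of_lt ?_ hq'
  calc fiberNorm φ s a q' = fiberNorm φ s (a + d + -d) q' := by rw [add_neg_cancel_right]
    _ ≤ fiberNorm φ s (a + d) q' + fiberNorm φ s (-d) q' := fiberNorm_add_le _ _ _ _
    _ ≤ _ := by
      rw [fiberNorm_neg]
      exact add_le_add (fiberNorm_le _ _ _) (fiberNorm_le_mul hC hle _ _)

/-- The total space of the bundle. -/
abbrev Tot (φ : Hol ℂ →ₐ[ℂ] R) : Type := TotalSp (canonicalBundle φ).Fib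

/-- The value of a point of the total space, as an element of the fiber algebra. -/
abbrev fiberVal (u : Tot φ) : AlgFiber φ u.base := u.val

/-- The value at `q` of the section defined by `a`. -/
noncomputable def sec (φ : Hol ℂ →ₐ[ℂ] R) (a : R) (q : CStar) : Tot φ :=
  ⟨q, QuotAlg.mk (vanishing φ q) a⟩

/-- The tube of radius `ε` around the section defined by `a`, over `V`. -/
def secTube (φ : Hol ℂ →ₐ[ℂ] R) (s : Seminorm ℂ R) (a : R) (V : Set CStar) (ε : ℝ) : Set (Tot φ) :=
  {u | u.base ∈ V ∧ QuotAlg.seminorm (vanishing φ u.base) s (fiberVal u - QuotAlg.mk _ a) < ε}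

theorem exists_eq_sec (u : Tot φ) : ∃ a q, u = sec φ a q := by
  obtain ⟨q, v⟩ := u
  obtain ⟨a, rfl⟩ := QuotAlg.mk_surjective (vanishing φ q) v
  exact ⟨a, q, rfl⟩

theorem sec_mem_secTube_iff {s : Seminorm ℂ R} {a b : R} {V : Set CStar} {ε : ℝ} {q : CStar} :
    sec φ b q ∈ secTube φ s a V ε ↔ q ∈ V ∧ fiberNorm φ s (b - a) q < ε := by
  unfold fiberNorm
  rw [map_sub]
  rfl

theorem isOpen_secTube {s : Seminorm ℂ R} (hs : Continuous s) (a : R) {V : Set CStar}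
    (hV : IsOpen V) (ε : ℝ) : IsOpen (secTube φ s a V ε) :=
  TopologicalSpace.isOpen_generateFrom_of_mem ⟨s, a, V, ε, hs, hV, rfl⟩

/-- The tubes around a section form a base of neighborhoods of each of its values. -/
theorem nhds_sec_hasBasis (hp : IsDefiningSeq p) (a : R) (q : CStar) :
    (𝓝 (sec φ a q)).HasBasis
      (fun i : ℕ × ℝ × Set CStar => 0 < i.2.1 ∧ IsOpen i.2.2 ∧ q ∈ i.2.2)
      (fun i => secTube φ (p i.1) a i.2.2 i.2.1) := by
  refine ⟨fun W => ⟨fun hW => ?_, ?_⟩⟩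
  · have hsub : ∀ W : Set (Tot φ), sec φ a q ∈ W → IsOpen W → ∃ i : ℕ × ℝ × Set CStar,
        (0 < i.2.1 ∧ IsOpen i.2.2 ∧ q ∈ i.2.2) ∧ secTube φ (p i.1) a i.2.2 i.2.1 ⊆ W := by
      intro W hmem hW
      induction hW with
      | basic W h =>
        obtain ⟨s, b, V, ε, hs, hV, rfl⟩ := h
        have hmem' := sec_mem_secTube_iff.1 hmem
        obtain ⟨δ, hδ, hδε⟩ := exists_between hmem'.2
        obtain ⟨V', hV', hV'o, hqV'⟩ := eventually_nhds_iff.1 (eventually_fiberNorm_lt hp hs hδ)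
        obtain ⟨C, k, hC, hle⟩ := hp.exists_le hs
        refine ⟨(k, (ε - δ) / C, V ∩ V'), ⟨div_pos (sub_pos.2 hδε) hC, hV.inter hV'o,
          hmem'.1, hqV'⟩, ?_⟩
        intro u hu
        obtain ⟨c, q', rfl⟩ := exists_eq_sec u
        have hu' := sec_mem_secTube_iff.1 hu
        refine sec_mem_secTube_iff.2 ⟨hu'.1.1, ?_⟩
        have h1 := hV' _ hu'.1.2
        have h2 : fiberNorm φ s (c - a) q' < ε - δ := by
          refine (fiberNorm_le_mul hC hle _ _).trans_lt ?_
          rw [mul_comm, ← lt_div_iff₀ hC]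
          exact hu'.2
        calc _ = fiberNorm φ s ((c - a) + (a - b)) q' := by rw [sub_add_sub_cancel]
          _ ≤ _ := fiberNorm_add_le _ _ _ _
          _ < (ε - δ) + δ := add_lt_add h2 h1
          _ = ε := by ring
      | univ => exact ⟨(0, 1, Set.univ), ⟨one_pos, isOpen_univ, trivial⟩, Set.subset_univ _⟩
      | inter W₁ W₂ _ _ ih₁ ih₂ =>
        obtain ⟨⟨k, ε, V⟩, ⟨hε, hV, hq⟩, h⟩ := ih₁ hmem.1
        obtain ⟨⟨k', ε', V'⟩, ⟨hε', hV', hq'⟩, h'⟩ := ih₂ hmem.2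
        refine ⟨(max k k', min ε ε', V ∩ V'), ⟨lt_min hε hε', hV.inter hV', hq, hq'⟩, ?_⟩
        intro u hu
        have hu1 : u.base ∈ V ∩ V' := hu.1
        have hu2 := hu.2
        exact ⟨h ⟨hu1.1, (QuotAlg.seminorm_mono _ (hp.mono (le_max_left k k')) _).trans_lt
            (hu2.trans_le (min_le_left _ _))⟩,
          h' ⟨hu1.2, (QuotAlg.seminorm_mono _ (hp.mono (le_max_right k k')) _).trans_lt
            (hu2.trans_le (min_le_right _ _))⟩⟩
      | sUnion T _ ih =>
        obtain ⟨W, hWT, hmem⟩ := hmem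
        obtain ⟨i, hi, h⟩ := ih W hWT hmem
        exact ⟨i, hi, h.trans (Set.subset_sUnion_of_mem hWT)⟩
    obtain ⟨W', hW', hW'o, hmem⟩ := mem_nhds_iff.1 hW
    obtain ⟨i, hi, h⟩ := hsub W' hmem hW'o
    exact ⟨i, hi, h.trans hW'⟩
  · rintro ⟨⟨k, ε, V⟩, ⟨hε, hV, hq⟩, h⟩
    refine mem_of_superset ((isOpen_secTube (hp.continuous_seminorm k) a hV ε).mem_nhds ?_) h
    exact sec_mem_secTube_iff.2
      ⟨hq, by rw [sub_self]; exact (fiberNorm_le _ _ _).trans_lt (by simpa using hε)⟩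

theorem eventually_mem_secTube (hp : IsDefiningSeq p) (a : R) (q : CStar) (k : ℕ) {ε : ℝ}
    (hε : 0 < ε) {V : Set CStar} (hV : IsOpen V) (hq : q ∈ V) :
    ∀ᶠ u in 𝓝 (sec φ a q), u ∈ secTube φ (p k) a V ε :=
  (nhds_sec_hasBasis hp a q).mem_of_mem (i := (k, ε, V)) ⟨hε, hV, hq⟩

theorem continuous_base : Continuous (TotalSp.base : Tot φ → CStar) := by
  refine continuous_def.2 fun V hV => isOpen_iff_mem_nhds.2 fun u hu => ?_
  refine mem_of_superset ((isOpen_secTube (φ := φ) (s := 0) continuous_zero 0 hV 1).mem_nhds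
    ⟨hu, ?_⟩) fun v hv => hv.1
  obtain ⟨a, q, rfl⟩ := exists_eq_sec u
  have h := sec_mem_secTube_iff (φ := φ) (s := 0) (a := 0) (b := a) (V := V) (ε := 1) (q := q)
  exact (h.2 ⟨hu, (fiberNorm_le _ _ _).trans_lt (by simp)⟩).2

theorem continuous_sec (hp : IsDefiningSeq p) (a : R) : Continuous (sec φ a) := by
  refine continuous_iff_continuousAt.2 fun q => (nhds_sec_hasBasis hp a q).tendsto_right_iff.2 ?_
  rintro ⟨k, ε, V⟩ ⟨hε, hV, hq⟩
  filter_upwards [hV.mem_nhds hq] with q' hq'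
  exact sec_mem_secTube_iff.2 ⟨hq', by
    rw [sub_self]; exact (fiberNorm_le _ _ _).trans_lt (by simpa using hε)⟩

/-- The projection is open, because there is a continuous section through each point. -/
theorem isOpenMap_base (hp : IsDefiningSeq p) : IsOpenMap (TotalSp.base : Tot φ → CStar) := by
  refine isOpenMap_iff_nhds_le.2 fun u => ?_
  obtain ⟨a, q, rfl⟩ := exists_eq_sec u
  intro W hW
  exact (continuous_sec hp a).continuousAt.preimage_mem_nhds hW

theorem exists_eq_fibSq (u : FibSq (canonicalBundle φ).Fib) :
    ∃ a b q, u = ⟨q, QuotAlg.mk (vanishing φ q) a, QuotAlg.mk (vanishing φ q) b⟩ := by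
  obtain ⟨q, v, w⟩ := u
  obtain ⟨a, rfl⟩ := QuotAlg.mk_surjective (vanishing φ q) v
  obtain ⟨b, rfl⟩ := QuotAlg.mk_surjective (vanishing φ q) w
  exact ⟨a, b, q, rfl⟩

/-- A fiberwise binary operation which lifts to an operation `g` on `R` is continuous if `g` is
continuous at each pair `(a, b)` for the fiber norms, locally uniformly in the fiber. -/
theorem continuous_of_lift (hp : IsDefiningSeq p) (g : R → R → R)
    (F : FibSq (canonicalBundle φ).Fib → Tot φ)
    (hF : ∀ a b q, F ⟨q, QuotAlg.mk (vanishing φ q) a, QuotAlg.mk (vanishing φ q) b⟩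
      = sec φ (g a b) q)
    (hg : ∀ a b k, ∀ ε : ℝ, 0 < ε → ∃ δ : ℝ, 0 < δ ∧ ∀ c d q, fiberNorm φ (p k) (c - a) q < δ →
      fiberNorm φ (p k) (d - b) q < δ → fiberNorm φ (p k) (g c d - g a b) q < ε) :
    Continuous F := by
  refine continuous_iff_continuousAt.2 fun u => ?_
  obtain ⟨a, b, q, rfl⟩ := exists_eq_fibSq u
  rw [ContinuousAt, hF, (nhds_sec_hasBasis hp (g a b) q).tendsto_right_iff]
  rintro ⟨k, ε, V⟩ ⟨hε, hV, hq⟩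
  obtain ⟨δ, hδ, H⟩ := hg a b k ε hε
  have hc : Continuous (FibSq.toProd (Fib := (canonicalBundle φ).Fib)) := continuous_induced_dom
  have h1 := (hc.fst.tendsto
    ⟨q, QuotAlg.mk (vanishing φ q) a, QuotAlg.mk (vanishing φ q) b⟩).eventually
    (eventually_mem_secTube (φ := φ) hp a q k hδ hV hq)
  have h2 := (hc.snd.tendsto
    ⟨q, QuotAlg.mk (vanishing φ q) a, QuotAlg.mk (vanishing φ q) b⟩).eventually
    (eventually_mem_secTube (φ := φ) hp b q k hδ hV hq)
  filter_upwards [h1, h2] with v hv1 hv2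
  obtain ⟨c, d, q', rfl⟩ := exists_eq_fibSq v
  rw [hF]
  have hv1' := sec_mem_secTube_iff.1 hv1
  have hv2' := sec_mem_secTube_iff.1 hv2
  exact sec_mem_secTube_iff.2 ⟨hv1'.1, H c d q' hv1'.2 hv2'.2⟩

theorem continuous_add (hp : IsDefiningSeq p) :
    Continuous fun u : FibSq (canonicalBundle φ).Fib => (⟨u.base, u.fst + u.snd⟩ : Tot φ) := by
  refine continuous_of_lift hp (fun a b => a + b) _ (fun a b q => ?_) fun a b k ε hε =>
    ⟨ε / 2, half_pos hε, fun c d q h1 h2 => ?_⟩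
  · exact congrArg (TotalSp.mk q) (map_add (QuotAlg.mk (vanishing φ q)) a b).symm
  · have h := fiberNorm_add_le (φ := φ) (p k) (c - a) (d - b) q
    rw [show c - a + (d - b) = c + d - (a + b) by abel] at h
    linarith

theorem continuous_mul (hp : IsDefiningSeq p) :
    Continuous fun u : FibSq (canonicalBundle φ).Fib => (⟨u.base, u.fst * u.snd⟩ : Tot φ) := by
  refine continuous_of_lift hp (fun a b => a * b) _ (fun a b q => ?_) fun a b k ε hε => ?_
  · exact congrArg (TotalSp.mk q) (map_mul (QuotAlg.mk (vanishing φ q)) a b).symm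
  · have hA : 0 ≤ p k a := apply_nonneg _ _
    have hB : 0 ≤ p k b := apply_nonneg _ _
    have hM : 0 < 1 + p k a + p k b := by positivity
    refine ⟨min 1 (ε / (1 + p k a + p k b)), by positivity, fun c d q h1 h2 => ?_⟩
    have e : c * d - a * b = (c - a) * (d - b) + (c - a) * b + a * (d - b) := by noncomm_ring
    have n1 := fiberNorm_nonneg (φ := φ) (p k) (c - a) q
    have n2 := fiberNorm_nonneg (φ := φ) (p k) (d - b) q
    have l1 := fiberNorm_le (φ := φ) (p k) a q
    have l2 := fiberNorm_le (φ := φ) (p k) b q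
    rw [e]
    set δ := min 1 (ε / (1 + p k a + p k b)) with hδ
    have hδ1 : δ ≤ 1 := min_le_left _ _
    have hδ2 : δ ≤ ε / (1 + p k a + p k b) := min_le_right _ _
    calc _ ≤ fiberNorm φ (p k) (c - a) q * fiberNorm φ (p k) (d - b) q
          + fiberNorm φ (p k) (c - a) q * fiberNorm φ (p k) b q
          + fiberNorm φ (p k) a q * fiberNorm φ (p k) (d - b) q :=
        (fiberNorm_add_le _ _ _ _).trans (add_le_add ((fiberNorm_add_le _ _ _ _).trans
          (add_le_add (fiberNorm_mul_le hp _ _ _ _) (fiberNorm_mul_le hp _ _ _ _)))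
          (fiberNorm_mul_le hp _ _ _ _))
      _ ≤ fiberNorm φ (p k) (c - a) q * 1 + fiberNorm φ (p k) (c - a) q * p k b
          + p k a * fiberNorm φ (p k) (d - b) q := by
        gcongr
        exact h2.le.trans hδ1
      _ < δ * 1 + δ * p k b + p k a * δ := by
        have := mul_le_mul_of_nonneg_right h1.le hB
        have := mul_le_mul_of_nonneg_left h2.le hA
        linarith
      _ = δ * (1 + p k a + p k b) := by ring
      _ ≤ ε := (le_div_iff₀ hM).1 hδ2

theorem continuous_smul (hp : IsDefiningSeq p) :
    Continuous fun u : ℂ × Tot φ => (⟨u.2.base, u.1 • u.2.val⟩ : Tot φ) := by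
  have hsec : ∀ t a q, (⟨(sec φ a q).base, t • (sec φ a q).val⟩ : Tot φ) = sec φ (t • a) q :=
    fun t a q => congrArg (TotalSp.mk q) (map_smul (QuotAlg.mk (vanishing φ q)) t a).symm
  refine continuous_iff_continuousAt.2 fun ⟨t, u⟩ => ?_
  obtain ⟨a, q, rfl⟩ := exists_eq_sec u
  rw [ContinuousAt, hsec, (nhds_sec_hasBasis hp (t • a) q).tendsto_right_iff]
  rintro ⟨k, ε, V⟩ ⟨hε, hV, hq⟩
  have hε' : 0 < ε / (2 * (‖t‖ + 1)) := by positivity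
  have h1 := (continuous_snd.tendsto (t, sec φ a q)).eventually
    (eventually_mem_secTube (φ := φ) hp a q k hε' hV hq)
  have h2 : ∀ᶠ v : ℂ × Tot φ in 𝓝 (t, sec φ a q), ‖v.1‖ < ‖t‖ + 1 :=
    continuous_fst.norm.continuousAt.eventually_lt_const (lt_add_one ‖t‖)
  have h3 : ∀ᶠ v : ℂ × Tot φ in 𝓝 (t, sec φ a q), ‖v.1 - t‖ * p k a < ε / 2 := by
    have : Continuous fun v : ℂ × Tot φ => ‖v.1 - t‖ * p k a := by fun_prop
    exact this.continuousAt.eventually_lt_const (by simpa using half_pos hε)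
  filter_upwards [h1, h2, h3] with ⟨t', v⟩ hv h2 h3
  obtain ⟨c, q', rfl⟩ := exists_eq_sec v
  have hv' := sec_mem_secTube_iff.1 hv
  rw [hsec]
  refine sec_mem_secTube_iff.2 ⟨hv'.1, ?_⟩
  have e : t' • c - t • a = t' • (c - a) + (t' - t) • a := by
    rw [smul_sub, sub_smul]; abel
  have n1 := fiberNorm_nonneg (φ := φ) (p k) (c - a) q'
  have l1 := fiberNorm_le (φ := φ) (p k) a q'
  change fiberNorm φ (p k) (t' • c - t • a) q' < ε
  rw [e]
  calc _ ≤ ‖t'‖ * fiberNorm φ (p k) (c - a) q' + ‖t' - t‖ * fiberNorm φ (p k) a q' := by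
        rw [← fiberNorm_smul, ← fiberNorm_smul]; exact fiberNorm_add_le _ _ _ _
    _ ≤ (‖t‖ + 1) * (ε / (2 * (‖t‖ + 1))) + ‖t' - t‖ * p k a :=
      add_le_add (mul_le_mul h2.le hv'.2.le n1 (by positivity)) (by gcongr)
    _ < (‖t‖ + 1) * (ε / (2 * (‖t‖ + 1))) + ε / 2 := by
      gcongr
    _ = ε := by field_simp; ring

/-- The topology on a fiber of the bundle is the quotient topology. -/
theorem topology_fib_eq (hp : IsDefiningSeq p) (q : CStar) :
    (inferInstance : TopologicalSpace ((canonicalBundle φ).Fib q))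
      = (inferInstance : TopologicalSpace (AlgFiber φ q)) := by
  refine TopologicalSpace.ext_nhds fun u => ?_
  obtain ⟨a, rfl⟩ := QuotAlg.mk_surjective (vanishing φ q) u
  have h1 := (QuotAlg.isDefiningSeq (vanishing φ q) hp).nhds_hasBasis (QuotAlg.mk _ a)
  have h2 := (nhds_sec_hasBasis (φ := φ) hp a q).comap
    (fun v : (canonicalBundle φ).Fib q => (⟨q, v⟩ : Tot φ))
  have h3 := nhds_induced (fun v : (canonicalBundle φ).Fib q => (⟨q, v⟩ : Tot φ))
    (QuotAlg.mk (vanishing φ q) a)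
  refine h3.trans (h2.ext h1 ?_ ?_)
  · rintro ⟨k, ε, V⟩ ⟨hε, hV, hq⟩
    exact ⟨(k, ε), hε, fun v hv => ⟨hq, hv⟩⟩
  · rintro ⟨k, ε⟩ hε
    exact ⟨(k, ε, Set.univ), ⟨hε, isOpen_univ, trivial⟩, fun v hv => hv.2⟩

theorem isAdmissible (hp : IsDefiningSeq p) : (canonicalBundle φ).IsAdmissible := by
  have ht : ∀ l ε V, (canonicalBundle φ).tube l ε V = secTube φ l.1 0 V ε := by
    intro l ε V
    ext u
    obtain ⟨a, q, rfl⟩ := exists_eq_sec u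
    rw [sec_mem_secTube_iff, sub_zero]
    rfl
  have h0 : ∀ q, (⟨q, 0⟩ : Tot φ) = sec φ 0 q :=
    fun q => congrArg (TotalSp.mk q) (map_zero (QuotAlg.mk (vanishing φ q))).symm
  refine fun q => ⟨fun l ε V _ hV _ => ?_, ?_⟩
  · rw [ht]
    exact isOpen_secTube l.2 0 hV ε
  · rw [h0]
    refine (nhds_sec_hasBasis hp 0 q).to_hasBasis ?_ ?_
    · rintro ⟨k, ε, V⟩ h
      exact ⟨(⟨p k, hp.continuous_seminorm k⟩, ε, V), h, (ht _ _ _).le⟩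
    · rintro ⟨l, ε, V⟩ ⟨hε, hV, hq⟩
      have h1 : secTube φ l.1 0 V ε ∈ 𝓝 (sec φ 0 q) :=
        (isOpen_secTube l.2 0 hV ε).mem_nhds (sec_mem_secTube_iff.2 ⟨hq, by
          rw [sub_zero]
          exact (fiberNorm_le _ _ _).trans_lt (by simpa using hε)⟩)
      obtain ⟨i, hi, h⟩ := (nhds_sec_hasBasis hp 0 q).mem_iff.1 h1
      exact ⟨i, hi, h.trans (ht _ _ _).ge⟩

theorem isDirectedFamily : (canonicalBundle φ).IsDirectedFamily := by
  rintro ⟨l, hl⟩ ⟨m, hm⟩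
  refine ⟨1, ⟨l + m, hl.add hm⟩, one_pos, fun q u => ?_⟩
  refine ⟨le_of_le_of_eq ?_ (one_mul _).symm, le_of_le_of_eq ?_ (one_mul _).symm⟩
  exacts [QuotAlg.seminorm_mono (vanishing φ q)
      (fun a => le_add_of_nonneg_right (apply_nonneg m a)) u,
    QuotAlg.seminorm_mono (vanishing φ q) (fun a => le_add_of_nonneg_left (apply_nonneg l a)) u]

/-- The fibers of a Fréchet algebra defined by submultiplicative seminorms form a Fréchet algebra
bundle. -/
theorem isFrechetAlgebraBundle (hp : IsDefiningSeq p)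
    (hc : @CompleteSpace R (IsTopologicalAddGroup.rightUniformSpace R)) :
    (canonicalBundle φ).IsFrechetAlgebraBundle where
  continuous_base := continuous_base
  isOpenMap_base := isOpenMap_base hp
  continuous_zero := by
    refine (continuous_sec hp (0 : R)).congr fun q => ?_
    exact congrArg (TotalSp.mk q) (map_zero (QuotAlg.mk (vanishing φ q)))
  continuous_add := continuous_add hp
  continuous_smul := continuous_smul hp
  directed := isDirectedFamily
  admissible := isAdmissible hp
  continuous_mul := continuous_mul hp
  isFrechetAlgebra q := by
    have h : IsFrechetAlgebra (AlgFiber φ q) :=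
      (QuotAlg.isDefiningSeq _ hp).isFrechetAlgebra (QuotAlg.completeSpace _ hp hc)
    exact @Eq.subst _ (fun T => @IsFrechetAlgebra (AlgFiber φ q) _ _ T) _ _
      (topology_fib_eq hp q).symm h

/-- An isomorphism from the quotient algebra is an isomorphism from the fiber of the bundle. -/
noncomputable def fibEquiv (hp : IsDefiningSeq p) {q : CStar} {B : Type} [Ring B] [Algebra ℂ B]
    [TopologicalSpace B] (e : AlgFiber φ q ≃A[ℂ] B) : (canonicalBundle φ).Fib q ≃A[ℂ] B where
  toAlgEquiv := e.toAlgEquiv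
  continuous_toFun := @Eq.subst _ (fun T => @Continuous (AlgFiber φ q) B T _ e) _ _
    (topology_fib_eq hp q).symm e.continuous_toFun
  continuous_invFun := @Eq.subst _ (fun T => @Continuous B (AlgFiber φ q) _ T e.symm) _ _
    (topology_fib_eq hp q).symm e.continuous_invFun

end CanonicalBundle

/-! ### Completeness in terms of the seminorms -/

namespace IsDefiningSeq
variable {R : Type} [Ring R] [Algebra ℂ R] [TopologicalSpace R] [IsTopologicalRing R]
  {p : ℕ → Seminorm ℂ R}

theorem uniformity_hasBasis (h : IsDefiningSeq p) :
    (@uniformity R (IsTopologicalAddGroup.rightUniformSpace R)).HasBasis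
      (fun i : ℕ × ℝ => 0 < i.2) (fun i => {a | p i.1 (a.2 - a.1) < i.2}) := by
  have h1 := h.hasBasis.comap (fun a : R × R => a.2 - a.1)
  have h2 : @uniformity R (IsTopologicalAddGroup.rightUniformSpace R)
      = comap (fun a : R × R => a.2 - a.1) (𝓝 0) := by
    simp only [sub_eq_add_neg]
    rfl
  rwa [h2]

theorem exists_tendsto (h : IsDefiningSeq p)
    (hc : @CompleteSpace R (IsTopologicalAddGroup.rightUniformSpace R)) {β : Type*} {F : Filter β}
    [F.NeBot] {u : β → R}
    (hu : ∀ k, ∀ ε : ℝ, 0 < ε → ∀ᶠ b in F ×ˢ F, p k (u b.2 - u b.1) < ε) :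
    ∃ x, Tendsto u F (𝓝 x) := by
  let _ := IsTopologicalAddGroup.rightUniformSpace R
  refine cauchy_map_iff_exists_tendsto.1 (cauchy_map_iff.2 ⟨inferInstance, ?_⟩)
  exact h.uniformity_hasBasis.tendsto_right_iff.2 fun i hi => hu i.1 i.2 hi

/-- Since the topology has a countable base at zero, completeness may be tested on sequences. -/
theorem completeSpace_of_seq (h : IsDefiningSeq p)
    (hu : ∀ u : ℕ → R, (∀ k, ∀ ε : ℝ, 0 < ε → ∃ N, ∀ l ≥ N, ∀ m ≥ N, p k (u l - u m) < ε) →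
      ∃ x, Tendsto u atTop (𝓝 x)) :
    @CompleteSpace R (IsTopologicalAddGroup.rightUniformSpace R) := by
  have := h.firstCountable
  let _ := IsTopologicalAddGroup.rightUniformSpace R
  have : IsUniformAddGroup R := isUniformAddGroup_of_addCommGroup
  have := IsUniformAddGroup.uniformity_countably_generated (α := R)
  refine UniformSpace.complete_of_cauchySeq_tendsto fun u hcs => hu u fun k ε hε => ?_
  obtain ⟨N, hN⟩ := h.uniformity_hasBasis.cauchySeq_iff.1 hcs (k, ε) hε
  exact ⟨N, fun l hl m hm => hN m hm l hl⟩

end IsDefiningSeq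

/-! ### The Banach space of a seminorm -/

section Banach
variable {E : Type} [AddCommGroup E] [Module ℂ E]

/-- The vector space `E` with the topology of a single seminorm. -/
def SeminormSpace (_s : Seminorm ℂ E) : Type := E

noncomputable instance (s : Seminorm ℂ E) : SeminormedAddCommGroup (SeminormSpace s) :=
  AddGroupSeminorm.toSeminormedAddCommGroup (E := E) s.toAddGroupSeminorm

noncomputable instance (s : Seminorm ℂ E) : NormedSpace ℂ (SeminormSpace s) where
  __ := (inferInstance : Module ℂ E)
  norm_smul_le c a := (map_smul_eq_mul s c a).le

/-- The Hausdorff completion of `E` with respect to a seminorm. -/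
abbrev BanachOf (s : Seminorm ℂ E) : Type := UniformSpace.Completion (SeminormSpace s)

/-- The canonical map to the completion. -/
noncomputable def toBanach (s : Seminorm ℂ E) : E →ₗ[ℂ] BanachOf s :=
  (UniformSpace.Completion.toComplₗᵢ (𝕜 := ℂ) (E := SeminormSpace s)).toLinearMap

theorem norm_toBanach (s : Seminorm ℂ E) (a : E) : ‖toBanach s a‖ = s a :=
  UniformSpace.Completion.norm_coe (E := SeminormSpace s) a

end Banach

/-! ### Holomorphic functions with values in a Fréchet algebra -/

namespace Hol

section Extension
variable {B : Type} [NormedAddCommGroup B]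

open Classical in
/-- The extension by zero of a function on the punctured plane. -/
noncomputable def extend (g : CStar → B) (w : ℂ) : B := if h : w ≠ 0 then g ⟨w, h⟩ else 0

theorem extend_coe (g : CStar → B) (w : CStar) : extend g w = g w := by
  rw [extend, dif_pos w.2]

theorem isOpenEmbedding_coe : IsOpenEmbedding (Subtype.val : CStar → ℂ) :=
  (isOpen_compl_singleton (x := (0 : ℂ))).isOpenEmbedding_subtypeVal

theorem map_coe_nhdsNE (z : CStar) : map Subtype.val (𝓝[≠] z) = 𝓝[≠] (z : ℂ) := by
  have h : ({z}ᶜ : Set CStar) = Subtype.val ⁻¹' {(z : ℂ)}ᶜ := by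
    ext w; simp [Subtype.ext_iff]
  rw [h, nhdsWithin, ← comap_principal, Filter.push_pull, isOpenEmbedding_coe.map_nhds_eq,
    nhdsWithin]

instance (z : CStar) : (𝓝[≠] z).NeBot := by
  rw [← Filter.map_neBot_iff (Subtype.val : CStar → ℂ), map_coe_nhdsNE]
  infer_instance

/-- Complex derivatives of the extension by zero are limits of difference quotients on `ℂ^×`. -/
theorem hasDerivAt_extend_iff [NormedSpace ℂ B] (g : CStar → B) (d : B) (z : CStar) :
    HasDerivAt (extend g) d z
      ↔ Tendsto (fun w : CStar => ((w : ℂ) - z)⁻¹ • (g w - g z)) (𝓝[≠] z) (𝓝 d) := by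
  rw [hasDerivAt_iff_tendsto_slope, ← map_coe_nhdsNE, tendsto_map'_iff]
  refine tendsto_congr fun w => ?_
  simp only [Function.comp, slope, vsub_eq_sub, extend_coe]

end Extension

section
variable {A : Type} [Ring A] [Algebra ℂ A] [TopologicalSpace A] [IsTopologicalRing A]
  {p : ℕ → Seminorm ℂ A}

theorem differentiableAt_toBanach (hp : IsDefiningSeq p) {f : CStar → A} {d : A} {z : CStar}
    (h : HasDerivOn f d z) (k : ℕ) :
    DifferentiableAt ℂ (extend fun w => toBanach (p k) (f w)) z := by
  refine HasDerivAt.differentiableAt (f' := toBanach (p k) d) ?_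
  rw [hasDerivAt_extend_iff, tendsto_iff_norm_sub_tendsto_zero]
  refine (hp.tendsto_iff.1 h k).congr fun w => ?_
  rw [← norm_toBanach, map_sub, map_smul, map_sub]

/-- A function into a Fréchet algebra is differentiable if its images in the Banach spaces of the
seminorms are: the difference quotients form a Cauchy filter. -/
theorem exists_hasDerivOn (hp : IsDefiningSeq p)
    (hc : @CompleteSpace A (IsTopologicalAddGroup.rightUniformSpace A)) {f : CStar → A} {z : CStar}
    (h : ∀ k, DifferentiableAt ℂ (extend fun w => toBanach (p k) (f w)) z) :
    ∃ d, HasDerivOn f d z := by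
  refine hp.exists_tendsto hc fun k ε hε => ?_
  have h1 := ((hasDerivAt_extend_iff _ _ _).1 (h k).hasDerivAt).cauchy_map
  have h2 := (cauchy_map_iff.1 h1).2.eventually (Metric.dist_mem_uniformity hε)
  filter_upwards [h2] with b hb
  rw [dist_comm, dist_eq_norm] at hb
  rwa [← norm_toBanach, map_sub, map_smul, map_smul, map_sub, map_sub]

/-- Holomorphy of a function into a Fréchet algebra is holomorphy of its images in the Banach spaces
of the defining seminorms. -/
theorem mem_holSubalgebra_iff (hp : IsDefiningSeq p)
    (hc : @CompleteSpace A (IsTopologicalAddGroup.rightUniformSpace A)) {f : C(CStar, A)} :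
    f ∈ holSubalgebra A
      ↔ ∀ k, DifferentiableOn ℂ (extend fun w => toBanach (p k) (f w)) {0}ᶜ := by
  constructor
  · intro h k z hz
    obtain ⟨d, hd⟩ := h ⟨z, hz⟩
    exact (differentiableAt_toBanach hp hd k).differentiableWithinAt
  · intro h z
    exact exists_hasDerivOn hp hc fun k =>
      (h k).differentiableAt (isOpen_compl_singleton.mem_nhds z.2)

/-- Locally uniform limits of holomorphic functions are holomorphic. -/
theorem isClosed_holSubalgebra (hp : IsDefiningSeq p)
    (hc : @CompleteSpace A (IsTopologicalAddGroup.rightUniformSpace A)) :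
    IsClosed (holSubalgebra A : Set C(CStar, A)) := by
  let _ := IsTopologicalAddGroup.rightUniformSpace A
  refine isClosed_of_closure_subset fun f hf => ?_
  have : (𝓝[(holSubalgebra A : Set C(CStar, A))] f).NeBot := mem_closure_iff_nhdsWithin_neBot.1 hf
  have ht : Tendsto (fun g : C(CStar, A) => g) (𝓝[(holSubalgebra A : Set C(CStar, A))] f) (𝓝 f) :=
    nhdsWithin_le_nhds
  rw [ContinuousMap.tendsto_iff_tendstoLocallyUniformly] at ht
  refine (mem_holSubalgebra_iff hp hc).2 fun k => ?_
  have h1 : TendstoLocallyUniformlyOn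
      (fun (g : C(CStar, A)) => extend fun w => toBanach (p k) (g w))
      (extend fun w => toBanach (p k) (f w)) (𝓝[(holSubalgebra A : Set C(CStar, A))] f) {0}ᶜ := by
    refine Metric.tendstoLocallyUniformlyOn_iff.2 fun ε hε z hz => ?_
    obtain ⟨t, ht, h⟩ := ht {a | p k (a.2 - a.1) < ε}
      (hp.uniformity_hasBasis.mem_of_mem (i := (k, ε)) hε) ⟨z, hz⟩
    refine ⟨Subtype.val '' t, mem_nhdsWithin_of_mem_nhds
      (isOpenEmbedding_coe.isOpenMap.image_mem_nhds ht), ?_⟩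
    filter_upwards [h] with g hg
    rintro _ ⟨w, hw, rfl⟩
    rw [extend_coe, extend_coe, dist_comm, dist_eq_norm, ← map_sub, norm_toBanach]
    exact hg w hw
  refine h1.differentiableOn ?_ isOpen_compl_singleton
  filter_upwards [self_mem_nhdsWithin] with g hg
  exact (mem_holSubalgebra_iff hp hc).1 hg k

/-- Holomorphic functions form a closed subspace of the complete space of continuous functions. -/
theorem completeSpace (hp : IsDefiningSeq p)
    (hc : @CompleteSpace A (IsTopologicalAddGroup.rightUniformSpace A)) :
    @CompleteSpace (Hol A) (IsTopologicalAddGroup.rightUniformSpace (Hol A)) := by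
  let _ := IsTopologicalAddGroup.rightUniformSpace A
  have : IsUniformAddGroup A := isUniformAddGroup_of_addCommGroup
  have h1 : CompleteSpace (Hol A) := (isClosed_holSubalgebra hp hc).completeSpace_coe
  let j : Hol A →+ (CStar →ᵤ[{K : Set CStar | IsCompact K}] A) :=
    { toFun := fun f => ContinuousMap.toUniformOnFunIsCompact f.1
      map_zero' := rfl
      map_add' := fun _ _ => rfl }
  have h2 : IsUniformInducing j :=
    ContinuousMap.isUniformEmbedding_toUniformOnFunIsCompact.isUniformInducing.comp
      isUniformEmbedding_subtype_val.isUniformInducing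
  have h3 : IsUniformAddGroup (Hol A) := h2.isUniformAddGroup j
  have h4 := IsUniformAddGroup.rightUniformSpace_eq (G := Hol A)
  rw [← h4] at h1
  exact h1

/-- The seminorm `sup_{z ∈ K} s (f z)`. -/
noncomputable def supSeminorm {s : Seminorm ℂ A} (hs : Continuous s) {K : Set CStar}
    (hK : IsCompact K) : Seminorm ℂ (Hol A) :=
  have hb : ∀ f : Hol A, BddAbove (Set.range fun z : K => s (f.1 z)) := fun f => by
    have := (hK.image (hs.comp f.1.continuous)).bddAbove
    rwa [Set.image_eq_range] at this
  Seminorm.ofSMulLE (fun f => ⨆ z : K, s (f.1 z))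
    (by simp)
    (fun f g => Real.iSup_le (fun z => (map_add_le_add s _ _).trans
      (add_le_add (le_ciSup (hb f) z) (le_ciSup (hb g) z)))
      (add_nonneg (Real.iSup_nonneg fun _ => apply_nonneg _ _)
        (Real.iSup_nonneg fun _ => apply_nonneg _ _)))
    (fun c f => Real.iSup_le (fun z => (map_smul_eq_mul s c _).le.trans
      (mul_le_mul_of_nonneg_left (le_ciSup (hb f) z) (norm_nonneg c)))
      (mul_nonneg (norm_nonneg c) (Real.iSup_nonneg fun _ => apply_nonneg _ _)))

theorem le_supSeminorm {s : Seminorm ℂ A} (hs : Continuous s) {K : Set CStar} (hK : IsCompact K)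
    (f : Hol A) {z : CStar} (hz : z ∈ K) : s (f.1 z) ≤ supSeminorm hs hK f := by
  have := (hK.image (hs.comp f.1.continuous)).bddAbove
  rw [Set.image_eq_range] at this
  exact le_ciSup this (⟨z, hz⟩ : K)

theorem supSeminorm_le {s : Seminorm ℂ A} (hs : Continuous s) {K : Set CStar} (hK : IsCompact K)
    (f : Hol A) {c : ℝ} (hc : 0 ≤ c) (h : ∀ z ∈ K, s (f.1 z) ≤ c) : supSeminorm hs hK f ≤ c :=
  Real.iSup_le (fun z => h z z.2) hc

/-- The topology of uniform convergence on compact sets is defined by the suprema over an exhaustion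
by compact sets. -/
theorem isDefiningSeq (hp : IsDefiningSeq p) (K : CompactExhaustion CStar) :
    IsDefiningSeq fun k => supSeminorm (hp.continuous_seminorm k) (K.isCompact k) where
  mono k l hkl f := supSeminorm_le _ _ _ (apply_nonneg _ _) fun z hz =>
    (hp.mono hkl _).trans (le_supSeminorm _ _ f (K.subset hkl hz))
  mul_le k f g := supSeminorm_le _ _ _ (mul_nonneg (apply_nonneg _ _) (apply_nonneg _ _))
    fun z hz => (hp.mul_le k _ _).trans (mul_le_mul (le_supSeminorm _ _ f hz)
      (le_supSeminorm _ _ g hz) (apply_nonneg _ _) (apply_nonneg _ _))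
  hasBasis := by
    let _ := IsTopologicalAddGroup.rightUniformSpace A
    have h1 := nhds_basis_uniformity' (K.hasBasis_compactConvergenceUniformity
      hp.uniformity_hasBasis) (x := (0 : C(CStar, A)))
    have h2 := h1.comap (Subtype.val : Hol A → C(CStar, A))
    rw [show comap (Subtype.val : Hol A → C(CStar, A)) (𝓝 0) = 𝓝 0 from
      (nhds_induced Subtype.val (0 : Hol A)).symm] at h2
    refine h2.to_hasBasis ?_ ?_
    · rintro ⟨l, k, ε⟩ hε
      refine ⟨(max l k, ε), hε, fun f hf z hz => ?_⟩
      have h3 := (hp.mono (le_max_right l k) _).trans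
        (le_supSeminorm (hp.continuous_seminorm (max l k)) (K.isCompact _) f
          (K.subset (le_max_left l k) hz))
      have h4 : p k (f.1 z - 0) < ε := by
        rw [sub_zero]
        exact h3.trans_lt hf
      exact h4
    · rintro ⟨k, ε⟩ hε
      refine ⟨(k, k, ε / 2), half_pos hε, fun f hf => ?_⟩
      refine lt_of_le_of_lt (supSeminorm_le _ _ _ (half_pos hε).le fun z hz => ?_)
        (half_lt_self hε)
      have h4 : p k (f.1 z - 0) < ε / 2 := hf z hz
      rw [sub_zero] at h4
      exact h4.le

variable [ContinuousSMul ℂ A]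

/-- Evaluation at a point. -/
noncomputable def eval (q : CStar) : Hol A →A[ℂ] A where
  toFun f := f.1 q
  map_one' := rfl
  map_mul' _ _ := rfl
  map_zero' := rfl
  map_add' _ _ := rfl
  commutes' _ := rfl
  cont := (continuous_eval_const q).comp continuous_subtype_val

theorem continuous_const : Continuous (Hol.const : A → Hol A) :=
  (ContinuousMap.continuous_const').subtype_mk _

theorem continuous_scalar : Continuous (Hol.scalar A) := by
  refine Continuous.subtype_mk ?_ _
  exact (ContinuousMap.continuous_postcomp (⟨fun c : ℂ => c • (1 : A), by fun_prop⟩ : C(ℂ, A))).comp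
    continuous_subtype_val

theorem scalar_mul_comm (f : Hol ℂ) (g : Hol A) : Hol.scalar A f * g = g * Hol.scalar A f := by
  refine Subtype.ext (ContinuousMap.ext fun z => ?_)
  change (f.1 z • (1 : A)) * g.1 z = g.1 z * (f.1 z • (1 : A))
  rw [smul_mul_assoc, mul_smul_comm, one_mul, mul_one]

/-- A holomorphic function that vanishes at `q` is divisible by `z - q`. The quotient is holomorphic
because its image in each Banach space is a difference quotient of a holomorphic function, whose
singularity at `q` is removable. -/
theorem exists_eq_scalar_mul (hp : IsDefiningSeq p)
    (hc : @CompleteSpace A (IsTopologicalAddGroup.rightUniformSpace A)) {f : Hol A} {q : CStar}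
    (hf : f.1 q = 0) :
    ∃ g : Hol A, f = Hol.scalar A (Hol.coord - algebraMap ℂ _ (q : ℂ)) * g := by
  classical
  obtain ⟨d, hd⟩ := f.2 q
  let g : CStar → A := fun w => if w = q then d else ((w : ℂ) - q)⁻¹ • f.1 w
  have hgq : g q = d := if_pos rfl
  have hgw : ∀ w, w ≠ q → g w = ((w : ℂ) - q)⁻¹ • f.1 w := fun w hw => if_neg hw
  have hg : Continuous g := by
    refine continuous_iff_continuousAt.2 fun z => ?_
    by_cases hz : z = q
    · subst hz
      refine continuousAt_iff_punctured_nhds.2 ?_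
      rw [hgq]
      refine hd.congr' ?_
      filter_upwards [self_mem_nhdsWithin] with w hw
      rw [hgw w hw, hf, sub_zero]
    · have h1 : ContinuousAt (fun w : CStar => ((w : ℂ) - q)⁻¹ • f.1 w) z := by
        have h2 : (z : ℂ) - q ≠ 0 := sub_ne_zero.2 fun h => hz (Subtype.ext h)
        exact ((continuous_subtype_val.sub _root_.continuous_const).continuousAt.inv₀ h2).smul
          f.1.continuous.continuousAt
      refine h1.congr ?_
      filter_upwards [isOpen_compl_singleton.mem_nhds hz] with w hw
      rw [hgw w hw]
  have hmem : (⟨g, hg⟩ : C(CStar, A)) ∈ holSubalgebra A := by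
    refine (mem_holSubalgebra_iff hp hc).2 fun k => ?_
    have h1 := (mem_holSubalgebra_iff hp hc).1 f.2 k
    rw [← Complex.differentiableOn_dslope (isOpen_compl_singleton.mem_nhds q.2)] at h1
    refine h1.congr fun z hz => ?_
    by_cases hzq : z = q
    · subst hzq
      have h2 : HasDerivAt (extend fun w => toBanach (p k) (f.1 w)) (toBanach (p k) d) q := by
        rw [hasDerivAt_extend_iff, tendsto_iff_norm_sub_tendsto_zero]
        refine (hp.tendsto_iff.1 hd k).congr fun w => ?_
        rw [← norm_toBanach, map_sub, map_smul, map_sub]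
      rw [extend_coe, dslope_same, h2.deriv]
      exact congrArg _ hgq
    · have h3 : (⟨z, hz⟩ : CStar) ≠ q := fun h => hzq (congrArg Subtype.val h)
      have h4 := extend_coe (fun w => toBanach (p k) (f.1 w)) ⟨z, hz⟩
      have h5 := extend_coe (fun w => toBanach (p k) (g w)) ⟨z, hz⟩
      rw [dslope_of_ne _ hzq, slope, vsub_eq_sub, h4, extend_coe, hf, map_zero, sub_zero]
      refine h5.trans ?_
      rw [hgw _ h3, map_smul]
  refine ⟨⟨⟨g, hg⟩, hmem⟩, Subtype.ext (ContinuousMap.ext fun w => ?_)⟩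
  change f.1 w = (((w : ℂ) - q) • (1 : A)) * g w
  rw [smul_mul_assoc, one_mul]
  by_cases hw : w = q
  · rw [hw, hf, sub_self, zero_smul]
  · rw [hgw w hw, smul_smul, mul_inv_cancel₀ (sub_ne_zero.2 fun h => hw (Subtype.ext h)), one_smul]

end
end Hol

/-! ### The deformation algebra and its fibers -/

section Deformation
variable {A : Type} [Ring A] [Algebra ℂ A] [TopologicalSpace A] [IsTopologicalRing A]
  [ContinuousSMul ℂ A] {p : ℕ → Seminorm ℂ A} {n : ℕ} (x : Fin n → A)

theorem exists_isDefiningSeq_defAlg (hp : IsDefiningSeq p) :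
    ∃ P : ℕ → Seminorm ℂ (DefAlg x), IsDefiningSeq P :=
  ⟨_, QuotAlg.isDefiningSeq _ (Hol.isDefiningSeq hp (CompactExhaustion.choice CStar))⟩

theorem completeSpace_defAlg (hp : IsDefiningSeq p)
    (hc : @CompleteSpace A (IsTopologicalAddGroup.rightUniformSpace A)) :
    @CompleteSpace (DefAlg x) (IsTopologicalAddGroup.rightUniformSpace (DefAlg x)) :=
  QuotAlg.completeSpace _ (Hol.isDefiningSeq hp (CompactExhaustion.choice CStar))
    (Hol.completeSpace hp hc)

theorem isFrechetHolAlgebra_defScalar (hp : IsDefiningSeq p)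
    (hc : @CompleteSpace A (IsTopologicalAddGroup.rightUniformSpace A)) :
    IsFrechetHolAlgebra (defScalar x) where
  isFrechetAlgebra :=
    let ⟨_, hP⟩ := exists_isDefiningSeq_defAlg x hp
    hP.isFrechetAlgebra (completeSpace_defAlg x hp hc)
  continuous := (QuotAlg.continuous_mk _).comp Hol.continuous_scalar
  central f := by
    refine Subalgebra.mem_center_iff.2 fun u => ?_
    obtain ⟨g, rfl⟩ := QuotAlg.mk_surjective _ u
    change QuotAlg.mk _ g * QuotAlg.mk _ (Hol.scalar A f)
      = QuotAlg.mk _ (Hol.scalar A f) * QuotAlg.mk _ g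
    rw [← map_mul, ← map_mul, Hol.scalar_mul_comm]

/-- The quotient map from holomorphic functions to the fiber of the deformation algebra. -/
noncomputable def holToFiber (q : CStar) : Hol A →ₐ[ℂ] AlgFiber (defScalar x) q :=
  (QuotAlg.mk (vanishing (defScalar x) q)).comp (QuotAlg.mk (qRelations x))

theorem continuous_holToFiber (q : CStar) : Continuous (holToFiber x q) :=
  (QuotAlg.continuous_mk _).comp (QuotAlg.continuous_mk _)

theorem holToFiber_surjective (q : CStar) : Function.Surjective (holToFiber x q) :=
  (QuotAlg.mk_surjective _).comp (QuotAlg.mk_surjective _)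

theorem holToFiber_scalar (q : CStar) {f : Hol ℂ} (hf : f.1 q = 0) :
    holToFiber x q (Hol.scalar A f) = 0 :=
  QuotAlg.mk_eq_zero _ ⟨f, hf, rfl⟩

theorem holToFiber_scalar_coord (q : CStar) :
    holToFiber x q (Hol.scalar A Hol.coord) = algebraMap ℂ _ (q : ℂ) := by
  have h := holToFiber_scalar x q (f := Hol.coord - algebraMap ℂ _ (q : ℂ)) (sub_self (q : ℂ))
  have h1 : Hol.scalar A (Hol.coord - algebraMap ℂ _ (q : ℂ))
      = Hol.scalar A Hol.coord - algebraMap ℂ _ (q : ℂ) :=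
    (map_sub (Hol.scalar A) _ _).trans (by rw [AlgHom.commutes])
  rw [h1, map_sub, AlgHom.commutes] at h
  exact sub_eq_zero.1 h

/-- The map from constant functions to the fiber of the deformation algebra. -/
noncomputable def constToFiber (q : CStar) : A →A[ℂ] AlgFiber (defScalar x) q where
  toFun a := holToFiber x q (Hol.const a)
  map_one' := map_one (holToFiber x q)
  map_mul' a b := map_mul (holToFiber x q) (Hol.const a) (Hol.const b)
  map_zero' := map_zero (holToFiber x q)
  map_add' a b := map_add (holToFiber x q) (Hol.const a) (Hol.const b)
  commutes' c := (holToFiber x q).commutes c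
  cont := (continuous_holToFiber x q).comp Hol.continuous_const

theorem constToFiber_relation (q : CStar) {i j : Fin n} (hij : i < j) :
    constToFiber x q (x i) * constToFiber x q (x j)
      = (q : ℂ) • (constToFiber x q (x j) * constToFiber x q (x i)) := by
  have h : holToFiber x q (Hol.const (x i) * Hol.const (x j)
      - Hol.scalar A Hol.coord * (Hol.const (x j) * Hol.const (x i))) = 0 := by
    have h1 := QuotAlg.mk_eq_zero (qRelations x) ⟨i, j, hij, rfl⟩
    change QuotAlg.mk _ (QuotAlg.mk _ _) = 0
    rw [h1, map_zero]
  rw [map_sub, map_mul, map_mul (holToFiber x q) (Hol.scalar A Hol.coord), map_mul,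
    holToFiber_scalar_coord, sub_eq_zero, ← Algebra.smul_def] at h
  exact h

/-- In the fiber over `q`, a function is equal to its value at `q`. -/
theorem holToFiber_eq (hp : IsDefiningSeq p)
    (hc : @CompleteSpace A (IsTopologicalAddGroup.rightUniformSpace A)) (q : CStar) (f : Hol A) :
    holToFiber x q f = constToFiber x q (f.1 q) := by
  have h0 : (f - Hol.const (f.1 q)).1 q = 0 := sub_self (f.1 q)
  obtain ⟨g, hg⟩ := Hol.exists_eq_scalar_mul hp hc h0
  have h : holToFiber x q (f - Hol.const (f.1 q)) = 0 := by
    rw [hg, map_mul, holToFiber_scalar x q (sub_self (q : ℂ)), zero_mul]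
  rw [map_sub, sub_eq_zero] at h
  exact h

/-- Let `π : A → B` realize the relations `x_i x_j = q x_j x_i` and have a continuous section `σ`
such that every continuous homomorphism which realizes these relations identifies `a` with
`σ (π a)`. Then the fiber of the deformation algebra over `q` is `B`. -/
noncomputable def fiberEquivOfSection (hp : IsDefiningSeq p)
    (hc : @CompleteSpace A (IsTopologicalAddGroup.rightUniformSpace A)) (q : CStar)
    {B : Type} [Ring B] [Algebra ℂ B] [TopologicalSpace B] [T1Space B] (π : A →A[ℂ] B) (σ : B → A)
    (hπ : ∀ i j, i < j → π (x i) * π (x j) = (q : ℂ) • (π (x j) * π (x i)))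
    (hσ : Continuous σ) (hπσ : ∀ b, π (σ b) = b)
    (huniv : ∀ (G : Type) [Ring G] [Algebra ℂ G] [TopologicalSpace G] [T2Space G] (Θ : A →A[ℂ] G),
      (∀ i j, i < j → Θ (x i) * Θ (x j) = (q : ℂ) • (Θ (x j) * Θ (x i))) →
      ∀ a, Θ (σ (π a)) = Θ a) :
    AlgFiber (defScalar x) q ≃A[ℂ] B :=
  have h1 : ∀ a ∈ qRelations x, π.comp (Hol.eval q) a = 0 := by
    rintro _ ⟨i, j, hij, rfl⟩
    change π (x i * x j - ((q : ℂ) • (1 : A)) * (x j * x i)) = 0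
    rw [smul_mul_assoc, one_mul, map_sub, map_smul, map_mul, map_mul, hπ i j hij, sub_self]
  have h2 : ∀ a ∈ vanishing (defScalar x) q,
      QuotAlg.lift (qRelations x) (π.comp (Hol.eval q)) h1 a = 0 := by
    rintro _ ⟨f, hf, rfl⟩
    change π ((f.1 q) • (1 : A)) = 0
    rw [show f.1 q = 0 from hf, zero_smul, map_zero]
  let Φ := QuotAlg.lift _ _ h2
  have hΦ : ∀ f, Φ (holToFiber x q f) = π (f.1 q) := fun _ => rfl
  { Φ with
    invFun := fun b => constToFiber x q (σ b)
    left_inv := fun u => by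
      obtain ⟨f, rfl⟩ := holToFiber_surjective x q u
      rw [holToFiber_eq x hp hc]
      exact huniv _ (constToFiber x q) (fun i j hij => constToFiber_relation x q hij) (f.1 q)
    right_inv := fun b => hπσ b
    continuous_toFun := Φ.cont
    continuous_invFun := (constToFiber x q).cont.comp hσ }

end Deformation

/-! ### Algebras defined by extended seminorms -/

namespace ExtSeminorm
variable {A : Type} [Ring A] [Algebra ℂ A] {ι : Type} (N : ι → ExtSeminorm A)

/-- An element of the ambient algebra at which all the seminorms are finite. -/
def toFinite (a : A) (ha : ∀ i, (N i).toFun a < ⊤) : FiniteAlg N :=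
  (⟨a, ha⟩ : finiteSubalgebra N)

theorem incl_toFinite (a : A) (ha : ∀ i, (N i).toFun a < ⊤) : incl N (toFinite N a ha) = a := rfl

theorem incl_injective : Function.Injective (incl N) := Subtype.val_injective

/-- The restriction of `N i` to the algebra of elements at which all the seminorms are finite. -/
noncomputable def normAt (i : ι) : Seminorm ℂ (FiniteAlg N) :=
  Seminorm.ofSMulLE (ringSeminorm N i) (map_zero _) (map_add_le_add _) fun c a => by
    have h := ENNReal.toReal_mono (ENNReal.mul_lt_top (by simp) (incl_lt_top N i a)).ne
      ((N i).smul_le c (incl N a))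
    rw [ENNReal.toReal_mul, toReal_enorm] at h
    change ((N i).toFun (incl N (c • a))).toReal ≤ _
    rw [map_smul]
    exact h

theorem normAt_apply (i : ι) (a : FiniteAlg N) : normAt N i a = ((N i).toFun (incl N a)).toReal :=
  rfl

theorem normAt_mul_le (i : ι) (a b : FiniteAlg N) :
    normAt N i (a * b) ≤ normAt N i a * normAt N i b :=
  map_mul_le_mul (ringSeminorm N i) a b

theorem tendsto_nhds_iff {β : Type*} {F : Filter β} {u : β → FiniteAlg N} {a : FiniteAlg N} :
    Tendsto u F (𝓝 a) ↔ ∀ i, Tendsto (fun b => normAt N i (u b - a)) F (𝓝 0) := by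
  have h : 𝓝 a = ⨅ i, @nhds _ (topologyAt N i) a := nhds_iInf
  rw [h, tendsto_iInf]
  refine forall_congr' fun i => ?_
  let := (ringSeminorm N i).toSeminormedRing
  exact tendsto_iff_norm_sub_tendsto_zero

theorem continuous_normAt (i : ι) : Continuous (normAt N i) := by
  refine continuous_iff_continuousAt.2 fun a => tendsto_iff_norm_sub_tendsto_zero.2 ?_
  refine squeeze_zero (fun _ => norm_nonneg _) (fun b => ?_) ((tendsto_nhds_iff N).1 tendsto_id i)
  exact abs_sub_map_le_sub _ _ _

theorem t2Space_of_separating (h : ∀ a : A, (∀ i, (N i).toFun a = 0) → a = 0) :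
    T2Space (FiniteAlg N) := by
  have h1 : IsClosed ({0} : Set (FiniteAlg N)) := by
    have h2 : ({0} : Set (FiniteAlg N)) = ⋂ i, {a | normAt N i a = 0} := by
      ext a
      simp only [Set.mem_singleton_iff, Set.mem_iInter]
      refine ⟨fun ha i => ha ▸ map_zero _, fun ha => incl_injective N ?_⟩
      rw [map_zero]
      exact h _ fun i =>
        ((ENNReal.toReal_eq_zero_iff _).1 (ha i)).resolve_right (incl_lt_top N i a).ne
    rw [h2]
    exact isClosed_iInter fun i => isClosed_eq (continuous_normAt N i) continuous_const
  have := IsTopologicalAddGroup.t1Space (FiniteAlg N) h1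
  infer_instance

/-- A linear map of the ambient algebras which is bounded for the extended seminorms. -/
def IsBoundedFor {A' : Type} [Ring A'] [Algebra ℂ A'] {ι' : Type} (N' : ι' → ExtSeminorm A')
    (L : A →ₗ[ℂ] A') : Prop :=
  ∀ j, ∃ (i : ι) (C : ℝ≥0∞), C ≠ ⊤ ∧ ∀ a, (N' j).toFun (L a) ≤ C * (N i).toFun a

variable {N} {A' : Type} [Ring A'] [Algebra ℂ A'] {ι' : Type} {N' : ι' → ExtSeminorm A'}

/-- The restriction of a bounded linear map. -/
noncomputable def mapFinite (L : A →ₗ[ℂ] A') (hL : IsBoundedFor N N' L) :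
    FiniteAlg N →ₗ[ℂ] FiniteAlg N' where
  toFun a := toFinite N' (L (incl N a)) fun j => by
    obtain ⟨i, C, hC, h⟩ := hL j
    exact (h _).trans_lt (ENNReal.mul_lt_top hC.lt_top (incl_lt_top N i a))
  map_add' a b := incl_injective N' (by
    simp only [map_add, incl_toFinite])
  map_smul' c a := incl_injective N' (by
    simp only [map_smul, incl_toFinite, RingHom.id_apply])

theorem incl_mapFinite (L : A →ₗ[ℂ] A') (hL : IsBoundedFor N N' L) (a : FiniteAlg N) :
    incl N' (mapFinite L hL a) = L (incl N a) := rfl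

theorem continuous_mapFinite (L : A →ₗ[ℂ] A') (hL : IsBoundedFor N N' L) :
    Continuous (mapFinite L hL) := by
  refine continuous_iff_continuousAt.2 fun a => (tendsto_nhds_iff N').2 fun j => ?_
  obtain ⟨i, C, hC, h⟩ := hL j
  have h1 :=
    ((tendsto_nhds_iff N).1 (tendsto_id (α := FiniteAlg N) (x := 𝓝 a)) i).const_mul C.toReal
  rw [mul_zero] at h1
  refine squeeze_zero (fun _ => apply_nonneg _ _) (fun b => ?_) h1
  rw [← map_sub, normAt_apply, normAt_apply, ← ENNReal.toReal_mul, incl_mapFinite]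
  exact ENNReal.toReal_mono (ENNReal.mul_lt_top hC.lt_top (incl_lt_top N i _)).ne (h _)

end ExtSeminorm

/-! ### Completeness and density of polynomials for algebras of free series -/

namespace FreeSeries
open ExtSeminorm
variable {n : ℕ}

open Classical in
/-- The part of a series supported on a finite set of words. -/
noncomputable def truncate (T : Finset (List (Fin n))) (a : FreeSeries n) : FreeSeries n :=
  fun w => if w ∈ T then a w else 0

theorem truncate_eq_sum (T : Finset (List (Fin n))) (a : FreeSeries n) :
    truncate T a = ∑ w ∈ T, a w • word w := by
  classical
  have h : ∀ v, (∑ w ∈ T, a w • word w : FreeSeries n) v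
      = ∑ w ∈ T, (a w • word w : FreeSeries n) v :=
    fun v => Finset.sum_apply (M := fun _ : List (Fin n) => ℂ) v T fun w => a w • word w
  refine ext' fun v => ?_
  rw [h, truncate]
  simp only [smul_apply', word, mul_ite, mul_one, mul_zero]
  exact (Finset.sum_ite_eq T v a).symm

/-- The properties of a family of norms on free series which make it define a Fréchet algebra in
which the polynomials are dense; `e` is a cofinal sequence of indices. The norms dominate the
coefficients, and they are lower semicontinuous for coefficientwise convergence. -/
structure IsCoefficientFamily {ι : Type} (N : ι → ExtSeminorm (FreeSeries n)) (e : ℕ → ι) :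
    Prop where
  mono : ∀ k l, k ≤ l → ∀ a, (N (e k)).toFun a ≤ (N (e l)).toFun a
  cofinal : ∀ i, ∃ k, ∀ a, (N i).toFun a ≤ (N (e k)).toFun a
  enorm_le : ∀ w, ∃ (k : ℕ) (C : ℝ≥0∞), C ≠ ⊤ ∧ ∀ a : FreeSeries n, ‖a w‖ₑ ≤ C * (N (e k)).toFun a
  le_of_tendsto : ∀ i (u : ℕ → FreeSeries n) (a : FreeSeries n) (c : ℝ≥0∞),
    (∀ w, Tendsto (fun m => u m w) atTop (𝓝 (a w))) → (∀ᶠ m in atTop, (N i).toFun (u m) ≤ c) →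
    (N i).toFun a ≤ c
  tendsto_truncate : ∀ i a, (N i).toFun a < ⊤ →
    Tendsto (fun T => (N i).toFun (truncate T a - a)) atTop (𝓝 0)

namespace IsCoefficientFamily
variable {ι : Type} {N : ι → ExtSeminorm (FreeSeries n)} {e : ℕ → ι}

theorem t2Space (h : IsCoefficientFamily N e) : T2Space (FiniteAlg N) := by
  refine t2Space_of_separating N fun a ha => ext' fun w => ?_
  obtain ⟨k, C, -, hk⟩ := h.enorm_le w
  have := hk a
  rw [ha, mul_zero, nonpos_iff_eq_zero, enorm_eq_zero] at this
  exact this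

theorem isDefiningSeq (h : IsCoefficientFamily N e) : IsDefiningSeq fun k => normAt N (e k) where
  mono k l hkl a := ENNReal.toReal_mono (incl_lt_top N _ a).ne (h.mono k l hkl _)
  mul_le k := normAt_mul_le N (e k)
  hasBasis := by
    have h1 : 𝓝 (0 : FiniteAlg N) = ⨅ k, comap (normAt N (e k)) (𝓝 0) := by
      have h2 : 𝓝 (0 : FiniteAlg N) = ⨅ i, comap (normAt N i) (𝓝 0) := by
        have h3 : 𝓝 (0 : FiniteAlg N) = ⨅ i, @nhds _ (topologyAt N i) 0 := nhds_iInf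
        rw [h3]
        refine iInf_congr fun i => ?_
        let := (ringSeminorm N i).toSeminormedRing
        exact (comap_norm_nhds_zero (E := FiniteAlg N)).symm
      refine h2.trans (le_antisymm (le_iInf fun k => iInf_le _ _) (le_iInf fun i => ?_))
      obtain ⟨k, hk⟩ := h.cofinal i
      refine (iInf_le _ k).trans (tendsto_iff_comap.1 ?_)
      refine squeeze_zero (fun _ => apply_nonneg _ _) (fun a => ?_) tendsto_comap
      exact ENNReal.toReal_mono (incl_lt_top N _ a).ne (hk _)
    have h4 : ∀ k, (comap (normAt N (e k)) (𝓝 0)).HasBasis (fun ε : ℝ => 0 < ε)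
        fun ε => {a | normAt N (e k) a < ε} := by
      intro k
      refine ((Metric.nhds_basis_ball (α := ℝ) (x := 0)).comap
        (normAt N (e k))).congr (fun _ => Iff.rfl) ?_
      intro ε _
      ext a
      simp [abs_of_nonneg (apply_nonneg (normAt N (e k)) a)]
    rw [h1]
    refine hasBasis_iInf_of_directed _ _ h4 ?_
    refine directed_of_isDirected_le fun k l hkl => tendsto_iff_comap.1 ?_
    refine squeeze_zero (fun _ => apply_nonneg _ _) (fun a => ?_) tendsto_comap
    exact ENNReal.toReal_mono (incl_lt_top N _ a).ne (h.mono k l hkl _)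

/-- A Cauchy sequence converges to its coefficientwise limit. -/
theorem completeSpace (h : IsCoefficientFamily N e) :
    @CompleteSpace (FiniteAlg N) (IsTopologicalAddGroup.rightUniformSpace (FiniteAlg N)) := by
  refine h.isDefiningSeq.completeSpace_of_seq fun u hu => ?_
  have hu' : ∀ k, ∀ ε : ℝ, 0 < ε → ∃ M, ∀ l ≥ M, ∀ m ≥ M,
      (N (e k)).toFun (incl N (u l) - incl N (u m)) ≤ ENNReal.ofReal ε := by
    intro k ε hε
    obtain ⟨M, hM⟩ := hu k ε hε
    refine ⟨M, fun l hl m hm => ?_⟩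
    rw [← map_sub, ← ENNReal.ofReal_toReal (incl_lt_top N _ (u l - u m)).ne]
    exact ENNReal.ofReal_le_ofReal (hM l hl m hm).le
  have hlim : ∀ w, ∃ c, Tendsto (fun m => incl N (u m) w) atTop (𝓝 c) := by
    intro w
    obtain ⟨k, C, hC, hk⟩ := h.enorm_le w
    refine cauchySeq_tendsto_of_complete (Metric.cauchySeq_iff.2 fun ε hε => ?_)
    obtain ⟨M, hM⟩ := hu' k (ε / (C.toReal + 1)) (by positivity)
    refine ⟨M, fun l hl m hm => ?_⟩
    have h1 : ‖incl N (u l) w - incl N (u m) w‖ₑ ≤ C * ENNReal.ofReal (ε / (C.toReal + 1)) :=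
      (hk (incl N (u l) - incl N (u m))).trans (mul_le_mul_right (hM l hl m hm) C)
    have h2 := ENNReal.toReal_mono (ENNReal.mul_ne_top hC ENNReal.ofReal_ne_top) h1
    rw [toReal_enorm, ENNReal.toReal_mul, ENNReal.toReal_ofReal (by positivity)] at h2
    rw [dist_eq_norm]
    refine h2.trans_lt ?_
    rw [mul_div_assoc', div_lt_iff₀ (by positivity)]
    nlinarith
  obtain ⟨a, ha⟩ : ∃ a : FreeSeries n, ∀ w, Tendsto (fun m => incl N (u m) w) atTop (𝓝 (a w)) :=
    ⟨fun w => (hlim w).choose, fun w => (hlim w).choose_spec⟩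
  have hle : ∀ k, ∀ ε : ℝ, 0 < ε → ∃ M, ∀ m ≥ M,
      (N (e k)).toFun (incl N (u m) - a) ≤ ENNReal.ofReal ε := by
    intro k ε hε
    obtain ⟨M, hM⟩ := hu' k ε hε
    refine ⟨M, fun m hm => h.le_of_tendsto _ (fun l => incl N (u m) - incl N (u l)) _ _
      (fun w => tendsto_const_nhds.sub (ha w)) ?_⟩
    filter_upwards [eventually_ge_atTop M] with l hl
    exact hM m hm l hl
  have hfin : ∀ i, (N i).toFun a < ⊤ := by
    intro i
    obtain ⟨k, hk⟩ := h.cofinal i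
    obtain ⟨M, hM⟩ := hle k 1 one_pos
    have h1 : a = incl N (u M) + -(incl N (u M) - a) := by abel
    refine (hk a).trans_lt ?_
    rw [h1]
    refine ((N (e k)).add_le _ _).trans_lt (ENNReal.add_lt_top.2 ⟨incl_lt_top N _ _, ?_⟩)
    exact (((N (e k)).neg_le _).trans (hM M le_rfl)).trans_lt ENNReal.ofReal_lt_top
  refine ⟨toFinite N a hfin, h.isDefiningSeq.tendsto_iff.2 fun k => ?_⟩
  refine Metric.tendsto_atTop.2 fun ε hε => ?_
  obtain ⟨M, hM⟩ := hle k (ε / 2) (half_pos hε)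
  refine ⟨M, fun m hm => ?_⟩
  rw [Real.dist_0_eq_abs, abs_of_nonneg (apply_nonneg _ _), normAt_apply, map_sub, incl_toFinite]
  refine lt_of_le_of_lt (ENNReal.toReal_mono ENNReal.ofReal_ne_top (hM m hm)) ?_
  rw [ENNReal.toReal_ofReal (half_pos hε).le]
  exact half_lt_self hε

/-- Continuous linear maps which agree on words are equal. -/
theorem eq_of_forall_word (h : IsCoefficientFamily N e) {G : Type} [AddCommGroup G] [Module ℂ G]
    [TopologicalSpace G] [T2Space G] {f g : FiniteAlg N →ₗ[ℂ] G} (hf : Continuous f)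
    (hg : Continuous g) (hfin : ∀ w i, (N i).toFun (word w) < ⊤)
    (hw : ∀ w, f (toFinite N (word w) (hfin w)) = g (toFinite N (word w) (hfin w)))
    (a : FiniteAlg N) : f a = g a := by
  let P : Finset (List (Fin n)) → FiniteAlg N := fun T =>
    ∑ w ∈ T, incl N a w • toFinite N (word w) (hfin w)
  have hP : ∀ T, incl N (P T) = truncate T (incl N a) := by
    intro T
    rw [truncate_eq_sum, map_sum]
    exact Finset.sum_congr rfl fun w _ => map_smul (incl N) _ _
  have ht : Tendsto P atTop (𝓝 a) := by
    refine (tendsto_nhds_iff N).2 fun i => ?_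
    have h1 := (ENNReal.tendsto_toReal ENNReal.zero_ne_top).comp
      (h.tendsto_truncate i (incl N a) (incl_lt_top N i a))
    refine h1.congr fun T => ?_
    rw [Function.comp, normAt_apply, map_sub, hP]
  refine tendsto_nhds_unique ((hf.tendsto a).comp ht) (((hg.tendsto a).comp ht).congr fun T => ?_)
  simp only [Function.comp, P, map_sum, map_smul, hw]

end IsCoefficientFamily
end FreeSeries

/-! ### Inversions of words -/

namespace FreeSeries
open QSeries (cross)
variable {n : ℕ}

theorem word_cons (i : Fin n) (w : List (Fin n)) :
    (word (i :: w) : FreeSeries n) = word [i] * word w := by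
  refine ext' fun v => ?_
  have h0 : (word [i] : FreeSeries n) [] = 0 := if_neg (by simp)
  cases v with
  | nil => rw [mul_nil, h0, zero_mul]; exact if_neg (by simp)
  | cons y v =>
    rw [mul_cons, h0, zero_mul, zero_add]
    by_cases hy : y = i
    · have h1 : shift y (word [i] : FreeSeries n) = 1 := by
        refine ext' fun u => ?_
        change (if y :: u = [i] then (1 : ℂ) else 0) = if u = [] then 1 else 0
        simp [hy]
      rw [h1, one_mul]
      change (if y :: v = i :: w then (1 : ℂ) else 0) = if v = w then 1 else 0
      simp [hy]
    · have h1 : shift y (word [i] : FreeSeries n) = 0 := by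
        refine ext' fun u => ?_
        change (if y :: u = [i] then (1 : ℂ) else 0) = 0
        simp [hy]
      rw [h1, zero_mul]
      change (if y :: v = i :: w then (1 : ℂ) else 0) = 0
      simp [hy]

theorem content_cons (x : Fin n) (w : List (Fin n)) : content (x :: w) = content [x] + content w :=
  content_append [x] w

theorem content_singleton (x : Fin n) : content [x] = Finsupp.single x 1 := by
  ext j
  simp [content, Finsupp.single_apply, List.count_singleton]

theorem content_nil : content ([] : List (Fin n)) = 0 := by
  ext j; simp [content]

theorem content_eq_iff_perm {u v : List (Fin n)} : content u = content v ↔ u.Perm v := by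
  rw [List.perm_iff_count, DFunLike.ext_iff]
  simp [content]

theorem finite_content_eq (k : Fin n →₀ ℕ) : {w : List (Fin n) | content w = k}.Finite := by
  refine (List.finite_length_eq (Fin n) (∑ j, k j)).subset fun w hw => ?_
  rw [Set.mem_ofPred_eq] at hw
  rw [Set.mem_ofPred_eq, ← hw, sum_content]

/-- The words of a given content. -/
noncomputable def words (k : Fin n →₀ ℕ) : Finset (List (Fin n)) := (finite_content_eq k).toFinset

theorem mem_words {k : Fin n →₀ ℕ} {w : List (Fin n)} : w ∈ words k ↔ content w = k := by
  simp [words]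

/-- The number of inversions of a word, that is, of pairs of positions at which a larger letter
precedes a smaller one. -/
noncomputable def inversions : List (Fin n) → ℕ
  | [] => 0
  | x :: w => cross (content [x]) (content w) + inversions w

theorem inversions_append (u v : List (Fin n)) :
    inversions (u ++ v) = inversions u + inversions v + cross (content u) (content v) := by
  induction u with
  | nil => simp [inversions, content_nil, QSeries.cross_zero_left]
  | cons x u ih =>
    rw [List.cons_append, inversions, inversions, ih, content_append, content_cons x u,
      Finsupp.coe_add, Finsupp.coe_add, QSeries.cross_add_right, QSeries.cross_add_left]
    ring

theorem inversions_singleton (x : Fin n) : inversions [x] = 0 := by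
  simp [inversions, content_nil, QSeries.cross_zero_right]

theorem cross_single (x : Fin n) (k : Fin n → ℕ) :
    cross (content [x]) k = ∑ i, if i < x then k i else 0 := by
  rw [cross, Finset.sum_eq_single x]
  · simp [content_singleton]
  · intro j _ hj
    simp [content_singleton, hj.symm]
  · simp

theorem cross_single_single (x y : Fin n) :
    cross (content [x]) (content [y]) = if y < x then 1 else 0 := by
  rw [cross_single, Finset.sum_eq_single y]
  · simp [content_singleton]
  · intro j _ hj
    simp [content_singleton, hj.symm]
  · simp

/-- If `X_i X_j = q X_j X_i` for `i < j`, then reordering a product of the `X_i` multiplies it by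
the power of `q` which is determined by the change of the number of inversions. -/
theorem smul_prod_eq_of_perm {G : Type} [Ring G] [Algebra ℂ G] {q : ℂ} {X : Fin n → G}
    (hX : ∀ i j, i < j → X i * X j = q • (X j * X i)) {u v : List (Fin n)} (h : u.Perm v) :
    q ^ inversions u • (u.map X).prod = q ^ inversions v • (v.map X).prod := by
  induction h with
  | nil => rfl
  | @cons x u v huv ih =>
    rw [inversions, inversions, content_eq_iff_perm.2 huv, List.map_cons, List.map_cons,
      List.prod_cons, List.prod_cons, pow_add, pow_add, mul_smul, mul_smul, ← mul_smul_comm, ih,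
      mul_smul_comm]
  | swap x y w =>
    have h1 : ∀ x y : Fin n, inversions (x :: y :: w) = (if y < x then 1 else 0)
        + (cross (content [x]) (content w) + cross (content [y]) (content w) + inversions w) := by
      intro x y
      rw [inversions, inversions, content_cons y w, Finsupp.coe_add, QSeries.cross_add_right,
        cross_single_single]
      ring
    have h2 : q ^ (if x < y then 1 else 0) • (X y * X x)
        = q ^ (if y < x then 1 else 0) • (X x * X y) := by
      rcases lt_trichotomy x y with hxy | rfl | hxy
      · simp [hxy, hxy.not_gt, hX x y hxy]
      · rfl
      · simp [hxy, hxy.not_gt, hX y x hxy]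
    simp only [List.map_cons, List.prod_cons, ← mul_assoc]
    rw [h1 y x, h1 x y, add_comm (cross (content [y]) _)]
    generalize cross (content [x]) (content w) + cross (content [y]) (content w) + inversions w = m
    rw [pow_add, pow_add, mul_comm _ (q ^ m), mul_comm _ (q ^ m), mul_smul, mul_smul,
      ← smul_mul_assoc, h2, smul_mul_assoc]
  | trans _ _ h1 h2 => exact h1.trans h2

/-! ### The homomorphism from free series to quantum series and its sections -/

variable (q : CStar)

/-- The linear map which sends a word `w` to `q^{-inv w} x^k`, where `k` is the content of `w`. -/
noncomputable def toQuantumLinear : FreeSeries n →ₗ[ℂ] QSeries q n where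
  toFun a := fun k => ∑ w ∈ words k, ((q : ℂ)⁻¹) ^ inversions w * a w
  map_add' a b := QSeries.ext' fun k => by
    refine Eq.trans ?_ (Finset.sum_add_distrib (s := words k))
    exact Finset.sum_congr rfl fun w _ => mul_add _ _ _
  map_smul' c a := QSeries.ext' fun k => by
    refine Eq.trans ?_ (Finset.mul_sum (words k) _ c).symm
    exact Finset.sum_congr rfl fun w _ => mul_left_comm _ _ _

theorem toQuantumLinear_apply (a : FreeSeries n) (k : Fin n →₀ ℕ) :
    toQuantumLinear q a k = ∑ w ∈ words k, ((q : ℂ)⁻¹) ^ inversions w * a w := rfl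

theorem toQuantumLinear_word (w : List (Fin n)) :
    toQuantumLinear q (word w) = ((q : ℂ)⁻¹) ^ inversions w • QSeries.mono (content w) := by
  refine QSeries.ext' fun k => ?_
  rw [toQuantumLinear_apply, QSeries.smul_apply']
  by_cases hk : k = content w
  · subst hk
    rw [QSeries.mono_self, Finset.sum_eq_single_of_mem w (mem_words.2 rfl)]
    · simp [word]
    · intro v _ hv
      simp [word, hv]
  · rw [QSeries.mono_ne hk, mul_zero]
    refine Finset.sum_eq_zero fun v hv => ?_
    have : v ≠ w := by
      rintro rfl
      exact hk (mem_words.1 hv).symm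
    simp [word, this]

/-- Multiplicativity amounts to `inv (uv) = inv u + inv v` plus the number of pairs of a letter of
`u` and a smaller letter of `v`, which is the exponent in the product of monomials. -/
theorem toQuantumLinear_mul (a b : FreeSeries n) :
    toQuantumLinear q (a * b) = toQuantumLinear q a * toQuantumLinear q b := by
  refine QSeries.ext' fun m => ?_
  rw [QSeries.mul_apply', toQuantumLinear_apply]
  have hr : ∀ p : (Fin n →₀ ℕ) × (Fin n →₀ ℕ),
      ((q : ℂ)⁻¹) ^ cross p.1 p.2 * (toQuantumLinear q a p.1 * toQuantumLinear q b p.2)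
        = ∑ s ∈ words p.1 ×ˢ words p.2, ((q : ℂ)⁻¹) ^ cross p.1 p.2
          * ((((q : ℂ)⁻¹) ^ inversions s.1 * a s.1) * (((q : ℂ)⁻¹) ^ inversions s.2 * b s.2)) := by
    intro p
    rw [toQuantumLinear_apply, toQuantumLinear_apply, Finset.sum_mul_sum, ← Finset.sum_product',
      Finset.mul_sum]
  simp only [hr, mul_apply', Finset.mul_sum, Finset.sum_sigma']
  refine Finset.sum_nbij'
    (fun s => ⟨(content (s.1.take s.2), content (s.1.drop s.2)), (s.1.take s.2, s.1.drop s.2)⟩)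
    (fun s => ⟨s.2.1 ++ s.2.2, s.2.1.length⟩) ?_ ?_ ?_ ?_ ?_
  · rintro ⟨w, i⟩ h
    simp only [Finset.mem_sigma, mem_words] at h
    simp only [Finset.mem_sigma, Finset.HasAntidiagonal.mem_antidiagonal, Finset.mem_product,
      mem_words, and_self, and_true]
    rw [← content_append, List.take_append_drop, h.1]
  · rintro ⟨⟨k, l⟩, u, v⟩ h
    simp only [Finset.mem_sigma, Finset.HasAntidiagonal.mem_antidiagonal, Finset.mem_product,
      mem_words] at h
    simp only [Finset.mem_sigma, mem_words, Finset.mem_range, List.length_append]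
    exact ⟨by rw [content_append, h.2.1, h.2.2, h.1], by omega⟩
  · rintro ⟨w, i⟩ h
    simp only [Finset.mem_sigma, Finset.mem_range] at h
    simp only [List.take_append_drop, List.length_take]
    rw [min_eq_left (by omega)]
  · rintro ⟨⟨k, l⟩, u, v⟩ h
    simp only [Finset.mem_sigma, Finset.HasAntidiagonal.mem_antidiagonal, Finset.mem_product,
      mem_words] at h
    obtain ⟨-, rfl, rfl⟩ := h
    simp
  · rintro ⟨w, i⟩ -
    have h := inversions_append (w.take i) (w.drop i)
    rw [List.take_append_drop] at h
    simp only [h, pow_add]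
    ring

/-- The homomorphism from free series to quantum series which sends `ζ_i` to `x_i`. -/
noncomputable def toQuantum : FreeSeries n →ₐ[ℂ] QSeries q n :=
  AlgHom.ofLinearMap (toQuantumLinear q)
    (by
      have h := toQuantumLinear_word q ([] : List (Fin n))
      rw [content_nil, inversions, pow_zero, one_smul] at h
      exact h)
    (toQuantumLinear_mul q)

theorem toQuantum_apply (a : FreeSeries n) (k : Fin n →₀ ℕ) :
    toQuantum q a k = ∑ w ∈ words k, ((q : ℂ)⁻¹) ^ inversions w * a w := rfl

theorem toQuantum_word (w : List (Fin n)) :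
    toQuantum q (word w) = ((q : ℂ)⁻¹) ^ inversions w • QSeries.mono (content w) :=
  toQuantumLinear_word q w

theorem toQuantum_gen (i : Fin n) : toQuantum q (word [i]) = QSeries.gen i := by
  rw [toQuantum_word, inversions_singleton, pow_zero, one_smul, content_singleton, QSeries.gen]

/-- The linear map which sends `x^k` to the sum of the `s_w ζ_w` over all words `w` of
content `k`. -/
noncomputable def spread (s : List (Fin n) → ℂ) : QSeries q n →ₗ[ℂ] FreeSeries n where
  toFun c := fun w => c (content w) * s w
  map_add' c d := ext' fun w => add_mul (c (content w)) (d (content w)) (s w)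
  map_smul' t c := ext' fun w => mul_assoc t (c (content w)) (s w)

theorem spread_apply (s : List (Fin n) → ℂ) (c : QSeries q n) (w : List (Fin n)) :
    spread q s c w = c (content w) * s w := rfl

theorem toQuantum_spread {s : List (Fin n) → ℂ}
    (hs : ∀ k : Fin n →₀ ℕ, ∑ w ∈ words k, ((q : ℂ)⁻¹) ^ inversions w * s w = 1) (c : QSeries q n) :
    toQuantum q (spread q s c) = c := by
  refine QSeries.ext' fun k => ?_
  rw [toQuantum_apply]
  calc _ = ∑ w ∈ words k, c k * (((q : ℂ)⁻¹) ^ inversions w * s w) := by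
        refine Finset.sum_congr rfl fun w hw => ?_
        rw [spread_apply, mem_words.1 hw]; ring
    _ = c k := by rw [← Finset.mul_sum, hs, mul_one]

theorem spread_mono (s : List (Fin n) → ℂ) (k : Fin n →₀ ℕ) :
    spread q s (QSeries.mono k) = ∑ w ∈ words k, s w • word w := by
  have h : ∀ v, (∑ w ∈ words k, s w • word w : FreeSeries n) v
      = ∑ w ∈ words k, (s w • word w : FreeSeries n) v :=
    fun v => Finset.sum_apply (M := fun _ : List (Fin n) => ℂ) v _ fun w => s w • word w
  refine ext' fun v => ?_
  rw [h, spread_apply]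
  simp only [smul_apply', word, mul_ite, mul_one, mul_zero]
  refine Eq.trans ?_ (Finset.sum_ite_eq (words k) v s).symm
  simp only [QSeries.mono, mem_words, ite_mul, one_mul, zero_mul]

end FreeSeries

namespace FreeSeries
open ExtSeminorm
variable {n : ℕ} {ι ι' : Type} {N : ι → ExtSeminorm (FreeSeries n)} {e : ℕ → ι} {q : CStar}
  {N' : ι' → ExtSeminorm (QSeries q n)}

/-- If the homomorphism to quantum series and a linear section of it are bounded, then the fiber
over `q` of the deformation algebra is the corresponding algebra of quantum series. -/
theorem IsCoefficientFamily.nonempty_fib_equiv (h : IsCoefficientFamily N e)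
    (hfin : ∀ w i, (N i).toFun (word w) < ⊤) (hT2 : T2Space (FiniteAlg N'))
    (hπ : IsBoundedFor N N' (toQuantumLinear q)) {s : List (Fin n) → ℂ}
    (hs : ∀ k : Fin n →₀ ℕ, ∑ w ∈ words k, ((q : ℂ)⁻¹) ^ inversions w * s w = 1)
    (hσ : IsBoundedFor N' N (spread q s)) :
    Nonempty ((canonicalBundle (defScalar fun i => toFinite N (word [i]) (hfin [i]))).Fib q
      ≃A[ℂ] FiniteAlg N') := by
  have := h.t2Space
  let W : List (Fin n) → FiniteAlg N := fun w => toFinite N (word w) (hfin w)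
  let x : Fin n → FiniteAlg N := fun i => W [i]
  let π₀ := mapFinite (toQuantumLinear q) hπ
  let σ := mapFinite (spread q s) hσ
  let π : FiniteAlg N →A[ℂ] FiniteAlg N' :=
    { AlgHom.ofLinearMap π₀
        (incl_injective N' (map_one (toQuantum q)))
        (fun a b => incl_injective N' (map_mul (toQuantum q) (incl N a) (incl N b))) with
      cont := continuous_mapFinite _ hπ }
  have hinclπ : ∀ a, incl N' (π a) = toQuantum q (incl N a) := fun _ => rfl
  obtain ⟨P, hP⟩ := exists_isDefiningSeq_defAlg x h.isDefiningSeq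
  refine ⟨CanonicalBundle.fibEquiv hP
    (fiberEquivOfSection x h.isDefiningSeq h.completeSpace q π σ ?_ ?_ ?_ ?_)⟩
  · intro i j hij
    refine incl_injective N' ?_
    rw [map_mul, map_smul, map_mul, hinclπ, hinclπ]
    change toQuantum q (word [i]) * toQuantum q (word [j])
      = (q : ℂ) • (toQuantum q (word [j]) * toQuantum q (word [i]))
    rw [toQuantum_gen, toQuantum_gen, QSeries.gen_mul_gen hij]
  · exact continuous_mapFinite _ hσ
  · exact fun b => incl_injective N' (toQuantum_spread q hs (incl N' b))
  · intro G _ _ _ _ Θ hΘ a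
    have hW : ∀ w, Θ (W w) = (w.map fun i => Θ (x i)).prod := by
      intro w
      induction w with
      | nil => exact map_one Θ
      | cons i w ih =>
        have h1 : W (i :: w) = x i * W w := by
          refine incl_injective N ?_
          rw [map_mul]
          exact word_cons i w
        rw [h1, map_mul, ih, List.map_cons, List.prod_cons]
    refine h.eq_of_forall_word (f := Θ.toLinearMap ∘ₗ σ ∘ₗ π₀) (g := Θ.toLinearMap)
      ?_ Θ.cont hfin ?_ a
    · exact Θ.cont.comp ((continuous_mapFinite _ hσ).comp (continuous_mapFinite _ hπ))
    · intro w
      have h2 : σ (π₀ (W w))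
          = ((q : ℂ)⁻¹) ^ inversions w • ∑ v ∈ words (content w), s v • W v := by
        refine incl_injective N ?_
        rw [map_smul, map_sum]
        change spread q s (toQuantumLinear q (word w)) = _
        rw [toQuantumLinear_word, map_smul, spread_mono]
        rfl
      have h3 : ∀ v ∈ words (content w), s v • Θ (W v)
          = (q : ℂ) ^ inversions w • ((((q : ℂ)⁻¹) ^ inversions v * s v) • Θ (W w)) := by
        intro v hv
        have h4 := smul_prod_eq_of_perm hΘ (content_eq_iff_perm.1 (mem_words.1 hv))
        rw [← hW, ← hW] at h4
        rw [smul_comm, ← h4, smul_smul, mul_right_comm, ← mul_pow, inv_mul_cancel₀ q.2, one_pow,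
          one_mul]
      change Θ (σ (π₀ (W w))) = Θ (W w)
      rw [h2, map_smul, map_sum]
      simp only [map_smul]
      rw [Finset.sum_congr rfl h3, ← Finset.smul_sum, ← Finset.sum_smul, hs, one_smul, smul_smul,
        ← mul_pow, inv_mul_cancel₀ q.2, one_pow, one_smul]

end FreeSeries

/-! ### The polydisk -/

theorem Radii.exists_cofinal_seq {r : ℝ≥0∞} (hr : 0 < r) :
    ∃ e : ℕ → Radii r, (∀ k l, k ≤ l → (e k : ℝ) ≤ e l) ∧ ∀ ρ : Radii r, ∃ k, (ρ : ℝ) ≤ e k := by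
  obtain ⟨u, hu, hmem, hlim⟩ := exists_seq_strictMono_tendsto' hr
  have htop : ∀ k, u k ≠ ⊤ := fun k => (hmem k).2.ne_top
  refine ⟨fun k => ⟨(u k).toReal, ENNReal.toReal_pos (hmem k).1.ne' (htop k), by
    rw [ENNReal.ofReal_toReal (htop k)]; exact (hmem k).2⟩, fun k l hkl =>
      ENNReal.toReal_mono (htop l) (hu.monotone hkl), fun ρ => ?_⟩
  obtain ⟨k, hk⟩ := (hlim.eventually (lt_mem_nhds ρ.2.2)).exists
  exact ⟨k, (ENNReal.ofReal_le_iff_le_toReal (htop k)).1 hk.le⟩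

namespace QSeries
variable {q : CStar} {n : ℕ}

theorem t2Space_of_weight_pos {r : ℝ≥0∞} (hr : 0 < r) {w : (Fin n →₀ ℕ) → ℝ} (hw0 : ∀ k, 0 ≤ w k)
    (hw : ∀ k l : Fin n →₀ ℕ, (‖(q : ℂ)‖⁻¹) ^ cross k l * w (k + l) ≤ w k * w l)
    (hpos : ∀ k, 0 < w k) :
    T2Space (ExtSeminorm.FiniteAlg fun ρ : Radii r => weightNorm q w hw0 hw ρ ρ.2.1) := by
  refine ExtSeminorm.t2Space_of_separating _ fun a ha => ext' fun k => ?_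
  obtain ⟨e, -, -⟩ := Radii.exists_cofinal_seq hr
  have h1 := ENNReal.tsum_eq_zero.1 (ha (e 0)) k
  have h2 : 0 < w k * (e 0 : ℝ) ^ ∑ j, k j := mul_pos (hpos k) (pow_pos (e 0).2.1 _)
  rw [mul_eq_zero, enorm_eq_zero, ENNReal.ofReal_eq_zero] at h1
  exact h1.resolve_right h2.not_ge

end QSeries

namespace FreeSeries
open ExtSeminorm
open QSeries (cross)
variable {n : ℕ}

/-- Summation over words may be done content by content. -/
theorem tsum_sum_words (F : List (Fin n) → ℝ≥0∞) : ∑' k, ∑ w ∈ words k, F w = ∑' w, F w := by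
  rw [← ENNReal.tsum_fiberwise F content]
  refine tsum_congr fun k => ?_
  rw [← Finset.tsum_subtype' (words k) F]
  have h : (words k : Set (List (Fin n))) = content ⁻¹' {k} := by
    ext w
    simp [mem_words]
  rw [h]

/-- Sums of terms which depend continuously on the coefficients are lower semicontinuous. -/
theorem tsum_le_of_tendsto {J : Type} {φ : J → FreeSeries n → ℝ≥0∞} {u : ℕ → FreeSeries n}
    {a : FreeSeries n} {c : ℝ≥0∞} (hφ : ∀ j, Tendsto (fun m => φ j (u m)) atTop (𝓝 (φ j a)))
    (h : ∀ᶠ m in atTop, ∑' j, φ j (u m) ≤ c) : ∑' j, φ j a ≤ c := by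
  rw [ENNReal.tsum_eq_iSup_sum]
  refine iSup_le fun T => ?_
  refine _root_.le_of_tendsto (tendsto_finsetSum T fun j _ => hφ j) ?_
  filter_upwards [h] with m hm
  exact (ENNReal.sum_le_tsum T).trans hm

theorem le_inv_mul {x c y : ℝ≥0∞} (hc0 : c ≠ 0) (hc : c ≠ ⊤) (h : x * c ≤ y) : x ≤ c⁻¹ * y := by
  rw [mul_comm, ← div_eq_mul_inv]
  exact (ENNReal.le_div_iff_mul_le (Or.inl hc0) (Or.inl hc)).2 h

theorem truncate_sub_apply_of_mem {T : Finset (List (Fin n))} (a : FreeSeries n) {w : List (Fin n)}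
    (hw : w ∈ T) : (truncate T a - a) w = 0 := by
  change (if w ∈ T then a w else 0) - a w = 0
  rw [if_pos hw, sub_self]

theorem enorm_truncate_sub_le (T : Finset (List (Fin n))) (a : FreeSeries n) (w : List (Fin n)) :
    ‖(truncate T a - a) w‖ₑ ≤ ‖a w‖ₑ := by
  by_cases hw : w ∈ T
  · rw [truncate_sub_apply_of_mem a hw, enorm_zero]
    exact zero_le
  · change ‖(if w ∈ T then a w else 0) - a w‖ₑ ≤ _
    rw [if_neg hw, zero_sub, enorm_neg]

theorem polydiskNorm_apply {ρ τ : ℝ} (hρ : 0 < ρ) (hτ : 1 ≤ τ) (a : FreeSeries n) :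
    (polydiskNorm ρ τ hρ hτ).toFun a
      = ∑' w, ‖a w‖ₑ * ENNReal.ofReal (ρ ^ w.length * τ ^ blocks w) := rfl

theorem polydiskNorm_mono {ρ τ ρ' τ' : ℝ} (hρ : 0 < ρ) (hτ : 1 ≤ τ) (hρ' : 0 < ρ') (hτ' : 1 ≤ τ')
    (h : ρ ≤ ρ') (h' : τ ≤ τ') (a : FreeSeries n) :
    (polydiskNorm ρ τ hρ hτ).toFun a ≤ (polydiskNorm ρ' τ' hρ' hτ').toFun a := by
  rw [polydiskNorm_apply, polydiskNorm_apply]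
  refine ENNReal.tsum_le_tsum fun w => ?_
  gcongr

theorem exists_isCoefficientFamily_polydisk {r : ℝ≥0∞} (hr : 0 < r) :
    ∃ e, IsCoefficientFamily (fun i : Radii r × {τ : ℝ // 1 ≤ τ} =>
      polydiskNorm (n := n) i.1 i.2 i.1.2.1 i.2.2) e := by
  obtain ⟨e, hmono, hcof⟩ := Radii.exists_cofinal_seq hr
  refine ⟨fun k => (e k, ⟨k + 1, by simp⟩), ?_, ?_, ?_, ?_, ?_⟩
  · intro k l hkl a
    exact polydiskNorm_mono _ _ _ _ (hmono k l hkl) (by simpa using hkl) a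
  · rintro ⟨ρ, τ⟩
    obtain ⟨k, hk⟩ := hcof ρ
    obtain ⟨l, hl⟩ := exists_nat_ge (τ : ℝ)
    refine ⟨max k l, polydiskNorm_mono _ _ _ _ (hk.trans (hmono _ _ (le_max_left k l))) ?_⟩
    have : (l : ℝ) ≤ (max k l : ℕ) := by exact_mod_cast le_max_right k l
    change (τ : ℝ) ≤ (max k l : ℕ) + 1
    linarith
  · intro w
    have hpos : 0 < (e 0 : ℝ) ^ w.length * (((0 : ℕ) : ℝ) + 1) ^ blocks w := by
      have := (e 0).2.1
      positivity
    refine ⟨0, (ENNReal.ofReal _)⁻¹, ?_, fun a => le_inv_mul ?_ ENNReal.ofReal_ne_top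
      (ENNReal.le_tsum (f := fun w => ‖a w‖ₑ * ENNReal.ofReal
        ((e 0 : ℝ) ^ w.length * (((0 : ℕ) : ℝ) + 1) ^ blocks w)) w)⟩
    · simpa using hpos
    · simpa using hpos
  · rintro ⟨ρ, τ⟩ u a c hu hc
    exact tsum_le_of_tendsto
      (φ := fun w a => ‖a w‖ₑ * ENNReal.ofReal ((ρ : ℝ) ^ w.length * (τ : ℝ) ^ blocks w))
      (fun w => ENNReal.Tendsto.mul_const (hu w).enorm (Or.inr ENNReal.ofReal_ne_top)) hc
  · rintro ⟨ρ, τ⟩ a ha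
    refine tendsto_of_tendsto_of_tendsto_of_le_of_le tendsto_const_nhds
      (ENNReal.tendsto_tsum_compl_atTop_zero ha.ne) (fun _ => zero_le) fun T => ?_
    have h : ∑' w : {w // w ∉ T},
        ‖a w‖ₑ * ENNReal.ofReal ((ρ : ℝ) ^ w.1.length * (τ : ℝ) ^ blocks w.1)
        = ∑' w, ({w | w ∉ T} : Set _).indicator
          (fun w => ‖a w‖ₑ * ENNReal.ofReal ((ρ : ℝ) ^ w.length * (τ : ℝ) ^ blocks w)) w :=
      tsum_subtype {w | w ∉ T}
        fun w => ‖a w‖ₑ * ENNReal.ofReal ((ρ : ℝ) ^ w.length * (τ : ℝ) ^ blocks w)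
    refine le_of_le_of_eq ?_ h.symm
    rw [polydiskNorm_apply]
    refine ENNReal.tsum_le_tsum fun w => ?_
    by_cases hw : w ∈ T
    · rw [truncate_sub_apply_of_mem a hw, enorm_zero, zero_mul]
      exact zero_le
    · rw [Set.indicator_of_mem (show w ∈ {w | w ∉ T} from hw)]
      gcongr
      exact enorm_truncate_sub_le T a w

/-- The word `1^{k_1} ⋯ n^{k_n}`. -/
def ascending (k : Fin n →₀ ℕ) : List (Fin n) :=
  (List.finRange n).flatMap fun i => List.replicate (k i) i

theorem content_ascending (k : Fin n →₀ ℕ) : content (ascending k) = k := by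
  ext j
  simp only [content, ascending, Finsupp.equivFunOnFinite_symm_apply_apply, List.count_flatMap]
  rw [← Fin.sum_univ_def]
  simp [List.count_replicate]

theorem content_reverse (w : List (Fin n)) : content w.reverse = content w :=
  content_eq_iff_perm.2 w.reverse_perm

theorem inversions_eq_zero {w : List (Fin n)} (h : w.Pairwise (· ≤ ·)) : inversions w = 0 := by
  induction w with
  | nil => rfl
  | cons x w ih =>
    rw [List.pairwise_cons] at h
    rw [inversions, ih h.2, cross_single, Finset.sum_eq_zero]
    intro i _
    split_ifs with hi
    · simp only [content, Finsupp.equivFunOnFinite_symm_apply_apply]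
      exact List.count_eq_zero.2 fun hmem => (h.1 i hmem).not_gt hi
    · rfl

theorem inversions_ascending (k : Fin n →₀ ℕ) : inversions (ascending k) = 0 := by
  refine inversions_eq_zero (List.pairwise_flatMap.2 ⟨fun i _ => ?_, ?_⟩)
  · exact List.pairwise_replicate.2 (Or.inr le_rfl)
  · refine (List.pairwise_lt_finRange n).imp fun {i j} hij x hx y hy => ?_
    rw [List.eq_of_mem_replicate hx, List.eq_of_mem_replicate hy]
    exact hij.le

/-- Each pair of different letters is inverted either in `w` or in the reversal of `w`. -/
theorem inversions_add_inversions_reverse (w : List (Fin n)) :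
    inversions w + inversions w.reverse = cross (content w) (content w) := by
  induction w with
  | nil => simp [inversions, content_nil, QSeries.cross_zero_left]
  | cons x w ih =>
    have h : cross (content [x]) (content [x]) = 0 := by simp [cross_single_single]
    rw [List.reverse_cons, inversions_append, inversions_singleton, content_reverse, inversions,
      content_cons x w, Finsupp.coe_add, QSeries.cross_add_right, QSeries.cross_add_left,
      QSeries.cross_add_left, h, ← ih]
    ring

theorem blocks_replicate_le (m : ℕ) (x : Fin n) : blocks (List.replicate m x) ≤ 1 := by
  induction m with
  | zero => simp [blocks]
  | succ m ih =>
    cases m with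
    | zero => simp [blocks]
    | succ m =>
      rw [List.replicate_succ, List.replicate_succ, blocks, ← List.replicate_succ, if_pos rfl]
      exact ih

theorem blocks_flatMap_replicate_le (k : Fin n →₀ ℕ) (l : List (Fin n)) :
    blocks (l.flatMap fun i => List.replicate (k i) i) ≤ l.length := by
  induction l with
  | nil => simp [blocks]
  | cons x l ih =>
    rw [List.flatMap_cons, List.length_cons]
    have h1 := blocks_append_le (List.replicate (k x) x) (l.flatMap fun i => List.replicate (k i) i)
    have h2 := blocks_replicate_le (k x) x
    omega

theorem blocks_ascending_le (k : Fin n →₀ ℕ) : blocks (ascending k) ≤ n :=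
  (blocks_flatMap_replicate_le k _).trans (by simp)

theorem blocks_reverse_ascending_le (k : Fin n →₀ ℕ) : blocks (ascending k).reverse ≤ n := by
  have h : (ascending k).reverse
      = (List.finRange n).reverse.flatMap fun i => List.replicate (k i) i := by
    rw [ascending, List.reverse_flatMap]
    congr 1
    funext i
    simp
  rw [h]
  exact (blocks_flatMap_replicate_le k _).trans (by simp)

variable (q : CStar)

theorem polydiskWeight_of_norm_lt_one {q : CStar} (hq : ‖(q : ℂ)‖ < 1) (k : Fin n →₀ ℕ) :
    QSeries.polydiskWeight q k = ‖(q : ℂ)‖ ^ cross k k := by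
  rw [QSeries.polydiskWeight, if_neg hq.not_ge]
  simp only [cross, mul_comm]

theorem polydiskWeight_of_one_le_norm {q : CStar} (hq : 1 ≤ ‖(q : ℂ)‖) (k : Fin n →₀ ℕ) :
    QSeries.polydiskWeight q k = 1 := if_pos hq

theorem polydiskWeight_pos (k : Fin n →₀ ℕ) : 0 < QSeries.polydiskWeight q k := by
  have hq : 0 < ‖(q : ℂ)‖ := norm_pos_iff.2 q.2
  unfold QSeries.polydiskWeight
  split_ifs <;> positivity

/-- This bound makes the homomorphism to the quantum polydisk contractive. For `|q| < 1` it holds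
because no word of content `k` has more than `∑_{i<j} k_i k_j` inversions. -/
theorem inv_pow_inversions_mul_polydiskWeight_le (w : List (Fin n)) :
    ‖((q : ℂ)⁻¹) ^ inversions w‖ * QSeries.polydiskWeight q (content w) ≤ 1 := by
  have hq : 0 < ‖(q : ℂ)‖ := norm_pos_iff.2 q.2
  rw [norm_pow, norm_inv]
  rcases le_or_gt 1 ‖(q : ℂ)‖ with h | h
  · rw [polydiskWeight_of_one_le_norm h, mul_one]
    exact pow_le_one₀ (by positivity) (inv_le_one_of_one_le₀ h)
  · rw [polydiskWeight_of_norm_lt_one h, ← inversions_add_inversions_reverse, pow_add, ← mul_assoc,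
      ← mul_pow, inv_mul_cancel₀ hq.ne', one_pow, one_mul]
    exact pow_le_one₀ hq.le h.le

open Classical in
/-- The word which represents the monomial `x^k`, up to a factor: the letters ascend if `|q| ≥ 1`
and descend if `|q| < 1`. -/
noncomputable def orderedWord (k : Fin n →₀ ℕ) : List (Fin n) :=
  if 1 ≤ ‖(q : ℂ)‖ then ascending k else (ascending k).reverse

theorem content_orderedWord (k : Fin n →₀ ℕ) : content (orderedWord q k) = k := by
  unfold orderedWord
  split_ifs
  · exact content_ascending k
  · rw [content_reverse, content_ascending]

theorem blocks_orderedWord_le (k : Fin n →₀ ℕ) : blocks (orderedWord q k) ≤ n := by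
  unfold orderedWord
  split_ifs
  · exact blocks_ascending_le k
  · exact blocks_reverse_ascending_le k

/-- The ordered word has no inversions if `|q| ≥ 1` and as many as possible if `|q| < 1`. -/
theorem norm_pow_inversions_orderedWord (k : Fin n →₀ ℕ) :
    ‖(q : ℂ) ^ inversions (orderedWord q k)‖ = QSeries.polydiskWeight q k := by
  rw [norm_pow]
  unfold orderedWord
  split_ifs with h
  · rw [inversions_ascending, pow_zero, polydiskWeight_of_one_le_norm h]
  · have h1 := inversions_add_inversions_reverse (ascending k)
    rw [inversions_ascending, zero_add, content_ascending] at h1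
    rw [h1, polydiskWeight_of_norm_lt_one (not_le.1 h)]

open Classical in
/-- The coefficients of the section of the homomorphism to the quantum polydisk, which sends `x^k`
to a multiple of an ordered word. -/
noncomputable def polydiskSection (w : List (Fin n)) : ℂ :=
  if w = orderedWord q (content w) then (q : ℂ) ^ inversions w else 0

theorem sum_words_polydiskSection {M : Type} [AddCommMonoid M] (k : Fin n →₀ ℕ)
    (F : List (Fin n) → ℂ → M) (hF : ∀ w, F w 0 = 0) :
    ∑ w ∈ words k, F w (polydiskSection q w)
      = F (orderedWord q k) ((q : ℂ) ^ inversions (orderedWord q k)) := by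
  rw [Finset.sum_eq_single_of_mem (orderedWord q k) (mem_words.2 (content_orderedWord q k))]
  · rw [polydiskSection, content_orderedWord, if_pos rfl]
  · intro w hw hne
    rw [polydiskSection, mem_words.1 hw, if_neg hne, hF]

theorem isBoundedFor_toQuantum_polydisk (r : ℝ≥0∞) :
    IsBoundedFor (fun i : Radii r × {τ : ℝ // 1 ≤ τ} => polydiskNorm (n := n) i.1 i.2 i.1.2.1 i.2.2)
      (fun ρ : Radii r => QSeries.weightNorm (n := n) q (QSeries.polydiskWeight q)
        (QSeries.polydiskWeight_nonneg q) (QSeries.polydiskWeight_mul q) ρ ρ.2.1)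
      (toQuantumLinear q) := by
  intro ρ
  have hρ : 0 < (ρ : ℝ) := ρ.2.1
  refine ⟨(ρ, ⟨1, le_rfl⟩), 1, ENNReal.one_ne_top, fun a => ?_⟩
  rw [one_mul, polydiskNorm_apply, ← tsum_sum_words]
  refine ENNReal.tsum_le_tsum fun k => ?_
  change ‖∑ w ∈ words k, ((q : ℂ)⁻¹) ^ inversions w * a w‖ₑ * _ ≤ _
  refine (mul_le_mul_left (enorm_sum_le _ _) _).trans ?_
  rw [Finset.sum_mul]
  refine Finset.sum_le_sum fun w hw => ?_
  obtain rfl := mem_words.1 hw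
  rw [enorm_mul, mul_comm ‖_‖ₑ, mul_assoc]
  refine mul_le_mul_right ?_ _
  rw [← ofReal_norm, ← ENNReal.ofReal_mul (norm_nonneg _), sum_content, one_pow, mul_one,
    ← mul_assoc]
  refine ENNReal.ofReal_le_ofReal ?_
  exact mul_le_of_le_one_left (by positivity) (inv_pow_inversions_mul_polydiskWeight_le q w)

/-- The factor `τ ^ blocks` in the norms is harmless: ordered words have at most `n` blocks. -/
theorem isBoundedFor_spread_polydisk (r : ℝ≥0∞) :
    IsBoundedFor (fun ρ : Radii r => QSeries.weightNorm (n := n) q (QSeries.polydiskWeight q)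
        (QSeries.polydiskWeight_nonneg q) (QSeries.polydiskWeight_mul q) ρ ρ.2.1)
      (fun i : Radii r × {τ : ℝ // 1 ≤ τ} => polydiskNorm (n := n) i.1 i.2 i.1.2.1 i.2.2)
      (spread q (polydiskSection q)) := by
  rintro ⟨ρ, τ⟩
  have hρ : 0 < (ρ : ℝ) := ρ.2.1
  have hτ : 1 ≤ (τ : ℝ) := τ.2
  refine ⟨ρ, ENNReal.ofReal ((τ : ℝ) ^ n), ENNReal.ofReal_ne_top, fun c => ?_⟩
  rw [polydiskNorm_apply, ← tsum_sum_words]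
  change _ ≤ _ * ∑' k : Fin n →₀ ℕ, _
  rw [← ENNReal.tsum_mul_left]
  refine ENNReal.tsum_le_tsum fun k => ?_
  have h := sum_words_polydiskSection q k (fun w s => ‖c (content w) * s‖ₑ *
    ENNReal.ofReal ((ρ : ℝ) ^ w.length * (τ : ℝ) ^ blocks w)) (fun w => by simp)
  refine h.trans_le ?_
  have hlen : (orderedWord q k).length = ∑ j, k j := by
    rw [← sum_content, content_orderedWord]
  rw [content_orderedWord, enorm_mul, mul_assoc]
  refine le_of_le_of_eq (mul_le_mul_right ?_ ‖c k‖ₑ) (mul_left_comm _ _ _)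
  rw [← ofReal_norm, norm_pow_inversions_orderedWord, hlen,
    ← ENNReal.ofReal_mul (QSeries.polydiskWeight_nonneg q k), ← ENNReal.ofReal_mul (by positivity)]
  refine ENNReal.ofReal_le_ofReal ?_
  have h0 := QSeries.polydiskWeight_nonneg q k
  calc _ = (τ : ℝ) ^ blocks (orderedWord q k)
        * (QSeries.polydiskWeight q k * (ρ : ℝ) ^ ∑ j, k j) := by
        ring
    _ ≤ _ := by
        gcongr
        exact blocks_orderedWord_le q k

theorem nonempty_polydisk_fib_equiv {r : ℝ≥0∞} (hr : 0 < r) :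
    Nonempty ((canonicalBundle (defScalar (freePolydiskGen n r))).Fib q ≃A[ℂ] QPolydisk q n r) := by
  obtain ⟨e, he⟩ := exists_isCoefficientFamily_polydisk (n := n) hr
  refine he.nonempty_fib_equiv (fun w _ => polydiskNorm_word_lt_top _ _ _ _ w)
    (QSeries.t2Space_of_weight_pos hr _ _ (polydiskWeight_pos q))
    (isBoundedFor_toQuantum_polydisk q r) (fun k => ?_) (isBoundedFor_spread_polydisk q r)
  rw [sum_words_polydiskSection q k (fun w s => ((q : ℂ)⁻¹) ^ inversions w * s)
    (fun w => mul_zero _), ← mul_pow, inv_mul_cancel₀ q.2, one_pow]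

end FreeSeries

/-! ### The generating function of inversions -/

namespace QSeries

/-- The decomposition `[k_1 + ⋯ + k_n]_t = ∑_x t^{k_1 + ⋯ + k_{x-1}} [k_x]_t`. -/
theorem tNum_sum (t : ℝ) : ∀ {n : ℕ} (k : Fin n → ℕ),
    ∑ x, t ^ (∑ i, if i < x then k i else 0) * tNum t (k x) = tNum t (∑ x, k x)
  | 0, k => by simp [tNum]
  | n + 1, k => by
    have ih := tNum_sum t fun i : Fin n => k i.castSucc
    rw [Fin.sum_univ_castSucc, Fin.sum_univ_castSucc (f := k), tNum_add, ← ih]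
    congr 1
    · refine Finset.sum_congr rfl fun x _ => ?_
      rw [Fin.sum_univ_castSucc]
      simp [(Fin.castSucc_lt_last x).not_gt]
    · rw [Fin.sum_univ_castSucc]
      simp [Fin.castSucc_lt_last]

variable {n : ℕ}

theorem factRatio_zero (t : ℝ) : factRatio t (0 : Fin n → ℕ) = 1 := by
  simp [factRatio, tFact]

/-- The effect of one more letter `x` on the inverse of the `t`-multinomial coefficient. -/
theorem factRatio_add_single {t : ℝ} (ht : 0 < t) (k : Fin n →₀ ℕ) (x : Fin n) :
    factRatio t (k + Finsupp.single x 1 : Fin n →₀ ℕ) * tNum t ((∑ j, k j) + 1)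
      = factRatio t k * tNum t (k x + 1) := by
  have h1 : ∏ j, tFact t ((k + Finsupp.single x 1 : Fin n →₀ ℕ) j)
      = (∏ j, tFact t (k j)) * tNum t (k x + 1) := by
    rw [← Finset.mul_prod_erase _ _ (Finset.mem_univ x),
      ← Finset.mul_prod_erase _ (fun j => tFact t (k j)) (Finset.mem_univ x)]
    have h2 : ∏ j ∈ Finset.univ.erase x, tFact t ((k + Finsupp.single x 1 : Fin n →₀ ℕ) j)
        = ∏ j ∈ Finset.univ.erase x, tFact t (k j) := by
      refine Finset.prod_congr rfl fun j hj => ?_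
      simp [(Finset.ne_of_mem_erase hj).symm]
    rw [h2]
    simp only [Finsupp.add_apply, Finsupp.single_eq_same, tFact_succ]
    ring
  have h3 : ∑ j, (k + Finsupp.single x 1 : Fin n →₀ ℕ) j = (∑ j, k j) + 1 := by
    simp [Finset.sum_add_distrib, Finsupp.single_apply]
  have h4 := (tNum_succ_pos ht (∑ j, k j)).ne'
  have h5 := (tFact_pos ht (∑ j, k j)).ne'
  rw [factRatio, factRatio, h1, h3, tFact_succ]
  field_simp

end QSeries

namespace FreeSeries
open ExtSeminorm
open QSeries (cross tNum factRatio)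
variable {n : ℕ}

theorem words_zero : words (0 : Fin n →₀ ℕ) = {[]} := by
  ext w
  rw [mem_words, Finset.mem_singleton, ← content_nil, content_eq_iff_perm, List.perm_nil]

/-- Words of a nonzero content are sorted by their first letters. -/
theorem sum_words_eq {M : Type} [AddCommMonoid M] {k : Fin n →₀ ℕ} (hk : k ≠ 0)
    (f : List (Fin n) → M) :
    ∑ w ∈ words k, f w = ∑ x ∈ Finset.univ.filter (fun x => k x ≠ 0),
      ∑ v ∈ words (k - Finsupp.single x 1), f (x :: v) := by
  rw [Finset.sum_sigma']
  symm
  refine Finset.sum_nbij (fun s => s.1 :: s.2) ?_ ?_ ?_ (fun _ _ => rfl)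
  · rintro ⟨x, v⟩ h
    simp only [Finset.mem_sigma, Finset.mem_filter, Finset.mem_univ, true_and, mem_words] at h
    rw [mem_words, content_cons, h.2, content_singleton]
    exact add_tsub_cancel_of_le (Finsupp.single_le_iff.2 (Nat.one_le_iff_ne_zero.2 h.1))
  · rintro ⟨x, v⟩ - ⟨y, u⟩ - h
    simp only [List.cons.injEq] at h
    rw [h.1, h.2]
  · intro w hw
    rw [Finset.mem_coe, mem_words] at hw
    cases w with
    | nil => exact absurd (hw.symm.trans content_nil) hk
    | cons x v =>
      refine ⟨⟨x, v⟩, ?_, rfl⟩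
      rw [content_cons, content_singleton] at hw
      simp only [Finset.coe_sigma, Set.mem_sigma_iff, Finset.coe_filter, Finset.mem_univ, true_and,
        Set.mem_ofPred_eq, Finset.mem_coe, mem_words]
      rw [← hw]
      simp

/-- MacMahon's theorem: the inversions of the words of content `k` are counted by the
`t`-multinomial coefficient. The recursion sorts the words by their first letter `x`, which is the
larger letter of as many inversions as there are letters smaller than `x`. -/
theorem sum_pow_inversions {t : ℝ} (ht : 0 < t) (k : Fin n →₀ ℕ) :
    (∑ w ∈ words k, t ^ inversions w) * factRatio t k = 1 := by
  obtain ⟨m, hm⟩ : ∃ m, ∑ j, k j = m := ⟨_, rfl⟩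
  induction m generalizing k with
  | zero =>
    have hk : k = 0 := by
      ext j
      exact Finset.sum_eq_zero_iff.1 hm j (Finset.mem_univ j)
    subst hk
    rw [words_zero, Finset.sum_singleton, inversions, pow_zero, one_mul, Finsupp.coe_zero,
      QSeries.factRatio_zero]
  | succ m ih =>
    have hk : k ≠ 0 := by
      rintro rfl
      simp at hm
    have hpos := QSeries.tNum_succ_pos ht m
    have hterm : ∀ x ∈ Finset.univ.filter (fun x => k x ≠ 0),
        (∑ v ∈ words (k - Finsupp.single x 1), t ^ inversions (x :: v))
          * (factRatio t k * tNum t (m + 1))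
          = t ^ (∑ i, if i < x then k i else 0) * tNum t (k x) := by
      intro x hx
      have hx0 : k x ≠ 0 := (Finset.mem_filter.1 hx).2
      obtain ⟨l, rfl⟩ : ∃ l, k = l + Finsupp.single x 1 := ⟨k - Finsupp.single x 1,
        (tsub_add_cancel_of_le (Finsupp.single_le_iff.2 (Nat.one_le_iff_ne_zero.2 hx0))).symm⟩
      have hl : ∑ j, l j = m := by
        simpa [Finset.sum_add_distrib, Finsupp.single_apply] using hm
      have hF := QSeries.factRatio_add_single ht l x
      rw [hl] at hF
      have hinv : ∀ v ∈ words l, t ^ inversions (x :: v)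
          = t ^ (∑ i, if i < x then l i else 0) * t ^ inversions v := by
        intro v hv
        rw [inversions, mem_words.1 hv, cross_single, pow_add]
      have hsum : (∑ i, if i < x then (l + Finsupp.single x 1 : Fin n →₀ ℕ) i else 0)
          = ∑ i, if i < x then l i else 0 := by
        refine Finset.sum_congr rfl fun i _ => ?_
        split_ifs with hi
        · simp [hi.ne']
        · rfl
      rw [hF, hsum, add_tsub_cancel_right, Finset.sum_congr rfl hinv, ← Finset.mul_sum, mul_assoc,
        ← mul_assoc (∑ w ∈ words l, _), ih l hl, one_mul]
      simp
    refine mul_right_cancel₀ hpos.ne' ?_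
    rw [one_mul, mul_assoc, sum_words_eq hk, Finset.sum_mul, Finset.sum_congr rfl hterm,
      ← hm, ← QSeries.tNum_sum t k]
    refine Finset.sum_filter_of_ne fun x _ hne h0 => hne ?_
    rw [h0]
    simp [tNum]

/-! ### The ball -/

/-- The `ℓ²`-norm of the part of content `k` of a series. -/
noncomputable def contentNorm (k : Fin n →₀ ℕ) (a : FreeSeries n) : ℝ≥0∞ :=
  (∑ w ∈ words k, ‖a w‖ₑ ^ 2) ^ (1 / 2 : ℝ)

theorem ballNorm_apply {ρ : ℝ} (hρ : 0 < ρ) (a : FreeSeries n) :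
    (ballNorm ρ hρ).toFun a = ∑' k, contentNorm k a * ENNReal.ofReal (ρ ^ ∑ j, k j) := by
  refine tsum_congr fun k => ?_
  have h : (words k : Set (List (Fin n))) = {w | content w = k} := by
    ext w
    simp [mem_words]
  have h2 := Finset.tsum_subtype' (words k) fun w => ‖a w‖ₑ ^ 2
  rw [h] at h2
  rw [contentNorm, ← h2]
  rfl

theorem contentNorm_eq_ofReal (k : Fin n →₀ ℕ) (a : FreeSeries n) :
    contentNorm k a = ENNReal.ofReal (Real.sqrt (∑ w ∈ words k, ‖a w‖ ^ 2)) := by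
  have h : ∀ w, ‖a w‖ₑ ^ 2 = ENNReal.ofReal (‖a w‖ ^ 2) := fun w => by
    rw [ENNReal.ofReal_pow (norm_nonneg _), ofReal_norm]
  rw [contentNorm, Real.sqrt_eq_rpow,
    ← ENNReal.ofReal_rpow_of_nonneg (Finset.sum_nonneg fun _ _ => by positivity) (by norm_num),
    ENNReal.ofReal_sum_of_nonneg fun _ _ => by positivity]
  simp only [h]

theorem contentNorm_mono {k : Fin n →₀ ℕ} {a b : FreeSeries n}
    (h : ∀ w ∈ words k, ‖a w‖ₑ ≤ ‖b w‖ₑ) : contentNorm k a ≤ contentNorm k b := by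
  refine ENNReal.rpow_le_rpow (Finset.sum_le_sum fun w hw => ?_) (by norm_num)
  gcongr
  exact h w hw

theorem contentNorm_eq_zero {k : Fin n →₀ ℕ} {a : FreeSeries n} (h : ∀ w ∈ words k, a w = 0) :
    contentNorm k a = 0 := by
  rw [contentNorm, Finset.sum_eq_zero fun w hw => by simp [h w hw], ENNReal.zero_rpow_of_pos]
  norm_num

theorem enorm_le_contentNorm (a : FreeSeries n) (w : List (Fin n)) :
    ‖a w‖ₑ ≤ contentNorm (content w) a := by
  have h : ‖a w‖ₑ = (‖a w‖ₑ ^ 2) ^ (1 / 2 : ℝ) := by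
    rw [← ENNReal.rpow_natCast, ← ENNReal.rpow_mul]
    norm_num
  rw [h]
  exact ENNReal.rpow_le_rpow (Finset.single_le_sum (f := fun w => ‖a w‖ₑ ^ 2)
    (fun _ _ => zero_le) (mem_words.2 rfl)) (by norm_num)

theorem ballNorm_mono {ρ ρ' : ℝ} (hρ : 0 < ρ) (hρ' : 0 < ρ') (h : ρ ≤ ρ') (a : FreeSeries n) :
    (ballNorm ρ hρ).toFun a ≤ (ballNorm ρ' hρ').toFun a := by
  rw [ballNorm_apply, ballNorm_apply]
  refine ENNReal.tsum_le_tsum fun k => ?_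
  gcongr

theorem exists_isCoefficientFamily_ball {r : ℝ≥0∞} (hr : 0 < r) :
    ∃ e, IsCoefficientFamily (fun ρ : Radii r => ballNorm (n := n) ρ ρ.2.1) e := by
  classical
  obtain ⟨e, hmono, hcof⟩ := Radii.exists_cofinal_seq hr
  refine ⟨e, ?_, ?_, ?_, ?_, ?_⟩
  · intro k l hkl a
    exact ballNorm_mono _ _ (hmono k l hkl) a
  · intro ρ
    obtain ⟨k, hk⟩ := hcof ρ
    exact ⟨k, ballNorm_mono _ _ hk⟩
  · intro w
    have hpos : 0 < (e 0 : ℝ) ^ ∑ j, content w j := pow_pos (e 0).2.1 _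
    refine ⟨0, (ENNReal.ofReal ((e 0 : ℝ) ^ ∑ j, content w j))⁻¹, ?_, fun a =>
      (enorm_le_contentNorm a w).trans
      (le_inv_mul ?_ ENNReal.ofReal_ne_top ?_)⟩
    · simpa using hpos
    · simpa using hpos
    · rw [ballNorm_apply]
      exact ENNReal.le_tsum (content w)
  · intro ρ u a c hu hc
    rw [ballNorm_apply]
    simp only [ballNorm_apply] at hc
    refine tsum_le_of_tendsto
      (φ := fun k a => contentNorm k a * ENNReal.ofReal ((ρ : ℝ) ^ ∑ j, k j)) (fun k => ?_) hc
    refine ENNReal.Tendsto.mul_const ?_ (Or.inr ENNReal.ofReal_ne_top)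
    exact (tendsto_finsetSum _ fun w _ => ENNReal.Tendsto.pow (hu w).enorm).ennrpow_const _
  · intro ρ a ha
    rw [ballNorm_apply] at ha
    have ht := ENNReal.tendsto_tsum_compl_atTop_zero ha.ne
    refine ENNReal.tendsto_nhds_zero.2 fun ε hε => ?_
    obtain ⟨S, hS⟩ := ((ENNReal.tendsto_nhds_zero.1 ht) ε hε).exists
    filter_upwards [eventually_ge_atTop (S.biUnion words)] with T hT
    refine le_trans ?_ hS
    have h : ∑' k : {k // k ∉ S}, contentNorm k.1 a * ENNReal.ofReal ((ρ : ℝ) ^ ∑ j, k.1 j)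
        = ∑' k, ({k | k ∉ S} : Set _).indicator
          (fun k : Fin n →₀ ℕ => contentNorm k a * ENNReal.ofReal ((ρ : ℝ) ^ ∑ j, k j)) k :=
      tsum_subtype {k | k ∉ S}
        fun k : Fin n →₀ ℕ => contentNorm k a * ENNReal.ofReal ((ρ : ℝ) ^ ∑ j, k j)
    refine le_of_le_of_eq ?_ h.symm
    rw [ballNorm_apply]
    refine ENNReal.tsum_le_tsum fun k => ?_
    by_cases hk : k ∈ S
    · rw [contentNorm_eq_zero fun w hw => truncate_sub_apply_of_mem a
        (hT (Finset.mem_biUnion.2 ⟨k, hk, hw⟩)), zero_mul]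
      exact zero_le
    · rw [Set.indicator_of_mem (show k ∈ {k | k ∉ S} from hk)]
      gcongr
      exact contentNorm_mono fun w _ => enorm_truncate_sub_le T a w

variable (q : CStar)

theorem sq_norm_inv_pow (m : ℕ) : ‖((q : ℂ)⁻¹) ^ m‖ ^ 2 = ((‖(q : ℂ)‖ ^ 2)⁻¹) ^ m := by
  rw [norm_pow, norm_inv, ← pow_mul, mul_comm, pow_mul, inv_pow]

theorem normSq_param_pos : 0 < (‖(q : ℂ)‖ ^ 2)⁻¹ := by
  have := norm_pos_iff.2 q.2
  positivity

theorem ballWeight_pos (k : Fin n →₀ ℕ) : 0 < QSeries.ballWeight q k :=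
  Real.sqrt_pos.2 (QSeries.factRatio_pos (normSq_param_pos q) k)

/-- MacMahon's theorem at `t = |q|^{-2}`: the weight of the quantum ball is the inverse of the `ℓ²`
norm of the family of the `q^{-inv w}`, where `w` runs over the words of content `k`. -/
theorem sum_sq_norm_mul_sq_ballWeight (k : Fin n →₀ ℕ) :
    (∑ w ∈ words k, ‖((q : ℂ)⁻¹) ^ inversions w‖ ^ 2) * QSeries.ballWeight q k ^ 2 = 1 := by
  rw [QSeries.ballWeight, Real.sq_sqrt (QSeries.factRatio_pos (normSq_param_pos q) k).le]
  simp only [sq_norm_inv_pow]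
  exact sum_pow_inversions (normSq_param_pos q) k

theorem isBoundedFor_toQuantum_ball (r : ℝ≥0∞) :
    IsBoundedFor (fun ρ : Radii r => ballNorm (n := n) ρ ρ.2.1)
      (fun ρ : Radii r => QSeries.weightNorm (n := n) q (QSeries.ballWeight q)
        (fun _ => Real.sqrt_nonneg _) (QSeries.ballWeight_mul q) ρ ρ.2.1)
      (toQuantumLinear q) := by
  intro ρ
  have hρ : 0 < (ρ : ℝ) := ρ.2.1
  refine ⟨ρ, 1, ENNReal.one_ne_top, fun a => ?_⟩
  rw [one_mul, ballNorm_apply]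
  refine ENNReal.tsum_le_tsum fun k => ?_
  change ‖∑ w ∈ words k, ((q : ℂ)⁻¹) ^ inversions w * a w‖ₑ
    * ENNReal.ofReal (QSeries.ballWeight q k * (ρ : ℝ) ^ ∑ j, k j) ≤ _
  have hw := (ballWeight_pos q k).le
  rw [contentNorm_eq_ofReal, ← ofReal_norm, ← ENNReal.ofReal_mul (norm_nonneg _),
    ← ENNReal.ofReal_mul (Real.sqrt_nonneg _), ← mul_assoc]
  refine ENNReal.ofReal_le_ofReal (mul_le_mul_of_nonneg_right ?_ (by positivity))
  -- the Cauchy–Schwarz inequality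
  have h1 : ‖∑ w ∈ words k, ((q : ℂ)⁻¹) ^ inversions w * a w‖
      ≤ Real.sqrt (∑ w ∈ words k, ‖((q : ℂ)⁻¹) ^ inversions w‖ ^ 2)
        * Real.sqrt (∑ w ∈ words k, ‖a w‖ ^ 2) := by
    refine (norm_sum_le _ _).trans ?_
    simp only [norm_mul]
    exact Real.sum_mul_le_sqrt_mul_sqrt _ _ _
  have h2 : Real.sqrt (∑ w ∈ words k, ‖((q : ℂ)⁻¹) ^ inversions w‖ ^ 2)
      * QSeries.ballWeight q k = 1 := by
    rw [← Real.sqrt_one, ← sum_sq_norm_mul_sq_ballWeight q k,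
      Real.sqrt_mul (Finset.sum_nonneg fun _ _ => by positivity), Real.sqrt_sq hw]
  calc _ ≤ Real.sqrt (∑ w ∈ words k, ‖((q : ℂ)⁻¹) ^ inversions w‖ ^ 2)
        * Real.sqrt (∑ w ∈ words k, ‖a w‖ ^ 2) * QSeries.ballWeight q k := by gcongr
    _ = _ := by rw [mul_right_comm, h2, one_mul]

/-- The coefficients of the section of the homomorphism to the quantum ball, which sends `x^k` to
the shortest vector in its preimage among the combinations of words of content `k`. -/
noncomputable def ballSection (w : List (Fin n)) : ℂ :=
  (starRingEnd ℂ) (((q : ℂ)⁻¹) ^ inversions w) * (QSeries.ballWeight q (content w) ^ 2 : ℝ)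

theorem sum_mul_ballSection (k : Fin n →₀ ℕ) :
    ∑ w ∈ words k, ((q : ℂ)⁻¹) ^ inversions w * ballSection q w = 1 := by
  have h : ∀ w ∈ words k, ((q : ℂ)⁻¹) ^ inversions w * ballSection q w
      = ((‖((q : ℂ)⁻¹) ^ inversions w‖ ^ 2 * QSeries.ballWeight q k ^ 2 : ℝ) : ℂ) := by
    intro w hw
    rw [ballSection, mem_words.1 hw, ← mul_assoc, Complex.mul_conj, Complex.normSq_eq_norm_sq]
    push_cast
    ring
  rw [Finset.sum_congr rfl h, ← Complex.ofReal_sum, ← Finset.sum_mul,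
    sum_sq_norm_mul_sq_ballWeight, Complex.ofReal_one]

/-- The section is isometric, as the minimal `ℓ²` norm of a preimage of `x^k` is the weight
of `x^k`. -/
theorem isBoundedFor_spread_ball (r : ℝ≥0∞) :
    IsBoundedFor (fun ρ : Radii r => QSeries.weightNorm (n := n) q (QSeries.ballWeight q)
        (fun _ => Real.sqrt_nonneg _) (QSeries.ballWeight_mul q) ρ ρ.2.1)
      (fun ρ : Radii r => ballNorm (n := n) ρ ρ.2.1) (spread q (ballSection q)) := by
  intro ρ
  have hρ : 0 < (ρ : ℝ) := ρ.2.1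
  refine ⟨ρ, 1, ENNReal.one_ne_top, fun c => ?_⟩
  rw [one_mul, ballNorm_apply]
  refine ENNReal.tsum_le_tsum fun k => ?_
  have hw := (ballWeight_pos q k).le
  have h1 : ∑ w ∈ words k, ‖spread q (ballSection q) c w‖ ^ 2
      = (‖c k‖ * QSeries.ballWeight q k) ^ 2 := by
    have h2 : ∀ w ∈ words k, ‖spread q (ballSection q) c w‖ ^ 2
        = ‖((q : ℂ)⁻¹) ^ inversions w‖ ^ 2 * (‖c k‖ * QSeries.ballWeight q k ^ 2) ^ 2 := by
      intro w hw'
      rw [spread_apply, ballSection, mem_words.1 hw', norm_mul, norm_mul, RCLike.norm_conj,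
        Complex.norm_real, Real.norm_of_nonneg (sq_nonneg _)]
      ring
    rw [Finset.sum_congr rfl h2, ← Finset.sum_mul]
    calc _ = ((∑ w ∈ words k, ‖((q : ℂ)⁻¹) ^ inversions w‖ ^ 2) * QSeries.ballWeight q k ^ 2)
          * (‖c k‖ * QSeries.ballWeight q k) ^ 2 := by ring
      _ = _ := by rw [sum_sq_norm_mul_sq_ballWeight, one_mul]
  rw [contentNorm_eq_ofReal, h1, Real.sqrt_sq (by positivity),
    ENNReal.ofReal_mul (norm_nonneg _), ofReal_norm, ENNReal.ofReal_mul hw, mul_assoc]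
  exact le_rfl

theorem nonempty_ball_fib_equiv {r : ℝ≥0∞} (hr : 0 < r) :
    Nonempty ((canonicalBundle (defScalar (freeBallGen n r))).Fib q ≃A[ℂ] QBall q n r) := by
  obtain ⟨e, he⟩ := exists_isCoefficientFamily_ball (n := n) hr
  exact he.nonempty_fib_equiv (fun w _ => ballNorm_word_lt_top _ _ w)
    (QSeries.t2Space_of_weight_pos hr _ _ (ballWeight_pos q))
    (isBoundedFor_toQuantum_ball q r) (sum_mul_ballSection q) (isBoundedFor_spread_ball q r)

/-- The deformation algebra of an algebra of free series is a Fréchet algebra over the holomorphic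
functions, and its fibers form a Fréchet algebra bundle. -/
theorem IsCoefficientFamily.isFrechetHolAlgebra_and_bundle {ι : Type}
    {N : ι → ExtSeminorm (FreeSeries n)} {e : ℕ → ι} (h : IsCoefficientFamily N e)
    (x : Fin n → FiniteAlg N) :
    IsFrechetHolAlgebra (defScalar x) ∧ (canonicalBundle (defScalar x)).IsFrechetAlgebraBundle := by
  obtain ⟨P, hP⟩ := exists_isDefiningSeq_defAlg x h.isDefiningSeq
  exact ⟨isFrechetHolAlgebra_defScalar x h.isDefiningSeq h.completeSpace,
    CanonicalBundle.isFrechetAlgebraBundle hP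
      (completeSpace_defAlg x h.isDefiningSeq h.completeSpace)⟩

end FreeSeries

theorem mainTheorem3 (n : ℕ) (r : ℝ≥0∞) (hr : 0 < r) :
    (IsFrechetHolAlgebra (defScalar (freePolydiskGen n r)) ∧
      (canonicalBundle (defScalar (freePolydiskGen n r))).IsFrechetAlgebraBundle ∧
      ∀ q : CStar,
        Nonempty ((canonicalBundle (defScalar (freePolydiskGen n r))).Fib q ≃A[ℂ]
          QPolydisk q n r)) ∧
    (IsFrechetHolAlgebra (defScalar (freeBallGen n r)) ∧
      (canonicalBundle (defScalar (freeBallGen n r))).IsFrechetAlgebraBundle ∧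
      ∀ q : CStar,
        Nonempty ((canonicalBundle (defScalar (freeBallGen n r))).Fib q ≃A[ℂ]
          QBall q n r)) := by
  obtain ⟨_, hd⟩ := FreeSeries.exists_isCoefficientFamily_polydisk (n := n) hr
  obtain ⟨_, hb⟩ := FreeSeries.exists_isCoefficientFamily_ball (n := n) hr
  obtain ⟨hd1, hd2⟩ := hd.isFrechetHolAlgebra_and_bundle (freePolydiskGen n r)
  obtain ⟨hb1, hb2⟩ := hb.isFrechetHolAlgebra_and_bundle (freeBallGen n r)
  exact ⟨⟨hd1, hd2, fun q => FreeSeries.nonempty_polydisk_fib_equiv q hr⟩,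
    ⟨hb1, hb2, fun q => FreeSeries.nonempty_ball_fib_equiv q hr⟩⟩
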